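/- Consider the remarkable Fokker--Planck (Kolmogorov) equation $u_t+xu_y=u_{xx}$ for real functions $u(t,x,y)$. A point symmetry of it is a smooth local diffeomorphism of $\mathbb R^4_{t,x,y,u}$ that maps graphs of solutions to graphs of solutions in both directions. For constants $\alpha,\beta,\gamma,\delta,\lambda_0,\dots,\lambda_3,\sigma$ with $\alpha\delta-\beta\gamma=1$, $\sigma\ne0$, and a solution $f$ on an open set $\operatorname{dom}f\subseteq\mathbb R^3_{t,x,y}$, put $\hat x=x+3\lambda_3t^2+2\lambda_2t+\lambda_1$, $\hat y=y+\lambda_3t^3+\lambda_2t^2+\lambda_1t+\lambda_0$ and consider \[ \tilde t=\frac{\alpha t+\beta}{\gamma t+\delta},\quad \tilde x=\frac{\hat x}{\gamma t+\delta}-\frac{3\gamma\hat y}{(\gamma t+\delta)^2},\quad \tilde y=\frac{\hat y}{(\gamma t+\delta)^3}, \] \[ \tilde u=\sigma(\gamma t+\delta)^2\exp\Big(\frac{\gamma\hat x^2}{\gamma t+\delta}-\frac{3\gamma^2\hat x\hat y}{(\gamma t+\delta)^2}+\frac{3\gamma^3\hat y^2}{(\gamma t+\delta)^3}\Big) \exp\big(3\lambda_3(y-tx)-\lambda_2x-(3\lambda_3^2t^3+3\lambda_3\lambda_2t^2+\lambda_2^2t)\big)\,\big(u+f(t,x,y)\big)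 \qquad(*) \] on the domain $\{(t,x,y)\in\operatorname{dom}f,\ \gamma t+\delta\ne0\}$. The transformations $(*)$ constitute the complete point symmetry (pseudo)group of the equation: each of them with dense domain and range is a point symmetry, and a local diffeomorphism with connected domain is a point symmetry if and only if, with fixed values of the constants, it has the form $(*)$ near each point of its domain (the solution $f$ may depend on the point). Moreover, the transformations $(*)$ with $\operatorname{dom}f$ dense, considered up to continuous extension, constitute a group $G$ with respect to composition followed by continuous extension. Endow $G$ with the finest topology in which all continuous curves of transformations are continuous; here a curve $s\mapsto\Phi_s\in G$, $s\in\mathbb R$, is continuous if it is represented by a jointly continuous map $(s,P)\mapsto\Phi_s(P)$ on an open subset of $\mathbb R\times\mathbb R^4$ whose slice at each $s$ is dense in $\mathbb R^4$. Let $G_0$ be the connected component of the identity in $G$ (the continuous point symmetries). Then a complete list of discrete point symmetries of the equation (the elements of $G\setminus G_0$) that are independent up to combining with each other and with continuous point symmetries is exhausted by the single involution $\mathscr I'\colon(t,x,y,u)\mapsto(t,x,y,-u)$. That is, $\mathscr I'\in G$, $\mathscr I'\circ\mathscr I'=\mathrm{id}$, $\mathscr I'\notin G_0$, and every element of $G\setminus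 G_0$ is of the form $\mathscr I'\circ h$ with $h\in G_0$. Thus, $G_0$ is a normal subgroup of $G$ and the factor group $G/G_0$ is isomorphic to $\mathbb Z_2$. -/

import Mathlib

open Set Filter Topology
open scoped ContDiff

namespace Kolmogorov

/-- The space of independent variables `(t, x, y)`. -/
abbrev Base : Type := ℝ × ℝ × ℝ

/-- The space with coordinates `((t, x, y), u)`. -/
abbrev Total : Type := Base × ℝ

/-- `f` is a (smooth, classical) solution of `u_t + x u_y = u_xx` on the set `D`
(used for open `D`). -/
def IsSolutionOn (f : Base → ℝ) (D : Set Base) : Prop :=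
  ContDiffOn ℝ ∞ f D ∧
    ∀ t x y : ℝ, (t, x, y) ∈ D →
      deriv (fun s => f (s, x, y)) t + x * deriv (fun s => f (t, x, s)) y
        = deriv (fun s => deriv (fun r => f (t, r, y)) s) x

/-- The graph of `f` over `D`. -/
def graphOver (f : Base → ℝ) (D : Set Base) : Set Total :=
  (fun p => (p, f p)) '' D

/-- A local diffeomorphism (a smooth invertible partial map between open sets) of the space
with coordinates `(t, x, y, u)`. -/
def IsPointTransformation (Φ : OpenPartialHomeomorph Total Total) : Prop :=
  ContDiffOn ℝ ∞ Φ Φ.source ∧ ContDiffOn ℝ ∞ Φ.symm Φ.target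

/-- A point transformation is a point symmetry of the equation if, whenever it maps the graph of a
smooth function over an open set onto the graph of a smooth function over an open set, one of
these functions is a solution if and only if the other one is. -/
def IsPointSymmetry (Φ : OpenPartialHomeomorph Total Total) : Prop :=
  IsPointTransformation Φ ∧
    ∀ (D D' : Set Base) (f g : Base → ℝ), IsOpen D → IsOpen D' →
      ContDiffOn ℝ ∞ f D → ContDiffOn ℝ ∞ g D' →
      graphOver f D ⊆ Φ.source → Φ '' graphOver f D = graphOver g D' →
      (IsSolutionOn f D ↔ IsSolutionOn g D')

/-- The constant parameters of the transformations. -/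
structure Params where
  (α β γ δ l₀ l₁ l₂ l₃ σ : ℝ)
  det_eq : α * δ - β * γ = 1
  σ_ne : σ ≠ 0

/-- `x̂ = x + 3λ₃t² + 2λ₂t + λ₁`. -/
def Params.xHat (a : Params) (t x : ℝ) : ℝ :=
  x + 3 * a.l₃ * t ^ 2 + 2 * a.l₂ * t + a.l₁

/-- `ŷ = y + λ₃t³ + λ₂t² + λ₁t + λ₀`. -/
def Params.yHat (a : Params) (t y : ℝ) : ℝ :=
  y + a.l₃ * t ^ 3 + a.l₂ * t ^ 2 + a.l₁ * t + a.l₀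

/-- `γt + δ`. -/
def Params.den (a : Params) (t : ℝ) : ℝ := a.γ * t + a.δ

/-- The `(t, x, y)`-components of the transformation with parameters `a`. -/
noncomputable def Params.baseMap (a : Params) : Base → Base := fun (t, x, y) =>
  ((a.α * t + a.β) / a.den t,
    a.xHat t x / a.den t - 3 * a.γ * a.yHat t y / a.den t ^ 2,
    a.yHat t y / a.den t ^ 3)

/-- The factor multiplying `u + f` in the `u`-component. -/
noncomputable def Params.multiplier (a : Params) : Base → ℝ := fun (t, x, y) =>
  a.σ * a.den t ^ 2
    * Real.exp (a.γ * a.xHat t x ^ 2 / a.den t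
        - 3 * a.γ ^ 2 * a.xHat t x * a.yHat t y / a.den t ^ 2
        + 3 * a.γ ^ 3 * a.yHat t y ^ 2 / a.den t ^ 3)
    * Real.exp (3 * a.l₃ * (y - t * x) - a.l₂ * x
        - (3 * a.l₃ ^ 2 * t ^ 3 + 3 * a.l₃ * a.l₂ * t ^ 2 + a.l₂ ^ 2 * t))

/-- The transformation with constant parameters `a` and functional parameter `f`. -/
noncomputable def Params.map (a : Params) (f : Base → ℝ) : Total → Total := fun P =>
  (a.baseMap P.1, a.multiplier P.1 * (P.2 + f P.1))

/-- The domain of this transformation when the function `f` has the domain `D`. -/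
def Params.dom (a : Params) (D : Set Base) : Set Total :=
  {P | P.1 ∈ D ∧ a.den P.1.1 ≠ 0}

/-- `Φ` is the transformation with constant parameters `a` and with a solution `f`, defined on an
open set `D`, as functional parameter. -/
def HasForm (Φ : OpenPartialHomeomorph Total Total) : Prop :=
  ∃ (a : Params) (D : Set Base) (f : Base → ℝ), IsOpen D ∧ IsSolutionOn f D ∧
    Φ.source = a.dom D ∧ EqOn Φ (a.map f) Φ.source

/-- `Φ` is, with the same constant parameters on all of its domain, locally of the above form. -/
def LocallyHasForm (Φ : OpenPartialHomeomorph Total Total) : Prop :=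
  ∃ a : Params, ∀ P ∈ Φ.source, ∃ (D : Set Base) (f : Base → ℝ), IsOpen D ∧ IsSolutionOn f D ∧
    P ∈ a.dom D ∧ ∀ᶠ Q in 𝓝 P, Φ Q = a.map f Q

/-- A point transformation whose domain and range are dense. -/
structure DenseDiffeo where
  toHomeo : OpenPartialHomeomorph Total Total
  isPointTransformation : IsPointTransformation toHomeo
  dense_source : Dense toHomeo.source
  dense_target : Dense toHomeo.target

namespace DenseDiffeo

/-- Two transformations are identified if they agree on the (open dense) intersection of their
domains, that is, if they are restrictions of a common continuous map on the union of the
domains. -/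
instance instSetoid : Setoid DenseDiffeo where
  r Φ Ψ := EqOn Φ.toHomeo Ψ.toHomeo (Φ.toHomeo.source ∩ Ψ.toHomeo.source)
  iseqv := by
    refine ⟨fun Φ => fun _ _ => rfl, fun {Φ Ψ} h P hP => (h ⟨hP.2, hP.1⟩).symm, ?_⟩
    intro Φ Ψ Χ h₁ h₂ P hP
    have hO : IsOpen (Φ.toHomeo.source ∩ Χ.toHomeo.source) :=
      Φ.toHomeo.open_source.inter Χ.toHomeo.open_source
    have hsub : Φ.toHomeo.source ∩ Χ.toHomeo.source ⊆
        closure ((Φ.toHomeo.source ∩ Χ.toHomeo.source) ∩ Ψ.toHomeo.source) :=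
      Ψ.dense_source.open_subset_closure_inter hO
    have key : EqOn Φ.toHomeo Χ.toHomeo
        ((Φ.toHomeo.source ∩ Χ.toHomeo.source) ∩ Ψ.toHomeo.source) := fun Q hQ =>
      (h₁ ⟨hQ.1.1, hQ.2⟩).trans (h₂ ⟨hQ.2, hQ.1.2⟩)
    exact key.of_subset_closure (Φ.toHomeo.continuousOn.mono inter_subset_left)
      (Χ.toHomeo.continuousOn.mono inter_subset_right) inter_subset_left hsub hP

theorem equiv_iff {Φ Ψ : DenseDiffeo} :
    Φ ≈ Ψ ↔ EqOn Φ.toHomeo Ψ.toHomeo (Φ.toHomeo.source ∩ Ψ.toHomeo.source) := Iff.rfl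

/-- Transformations agreeing on a dense set are identified. -/
theorem equiv_of_dense {Φ Ψ : DenseDiffeo} {S : Set Total}
    (hd : Φ.toHomeo.source ∩ Ψ.toHomeo.source ⊆ closure S)
    (hS : S ⊆ Φ.toHomeo.source ∩ Ψ.toHomeo.source)
    (h : EqOn Φ.toHomeo Ψ.toHomeo S) : Φ ≈ Ψ :=
  h.of_subset_closure (Φ.toHomeo.continuousOn.mono inter_subset_left)
    (Ψ.toHomeo.continuousOn.mono inter_subset_right) hS hd

/-- The identity transformation. -/
def refl : DenseDiffeo where
  toHomeo := OpenPartialHomeomorph.refl Total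
  isPointTransformation := ⟨contDiff_id.contDiffOn, contDiff_id.contDiffOn⟩
  dense_source := dense_univ
  dense_target := dense_univ

/-- The inverse transformation. -/
def symm (Φ : DenseDiffeo) : DenseDiffeo where
  toHomeo := Φ.toHomeo.symm
  isPointTransformation := ⟨Φ.isPointTransformation.2, Φ.isPointTransformation.1⟩
  dense_source := Φ.dense_target
  dense_target := Φ.dense_source

/-- The preimage of a dense set is dense in the domain. -/
theorem preimage_dense (Φ : DenseDiffeo) {S : Set Total} (hS : Dense S) :
    Φ.toHomeo.source ⊆ closure (Φ.toHomeo.source ∩ Φ.toHomeo ⁻¹' S) := by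
  intro P hP
  rw [mem_closure_iff]
  intro O hO hPO
  have hO' : IsOpen (Φ.toHomeo '' (Φ.toHomeo.source ∩ O)) :=
    Φ.toHomeo.isOpen_image_of_subset_source (Φ.toHomeo.open_source.inter hO) inter_subset_left
  obtain ⟨Q, ⟨R, hR, rfl⟩, hQS⟩ := hS.inter_open_nonempty _ hO' ⟨_, P, ⟨hP, hPO⟩, rfl⟩
  exact ⟨R, hR.2, hR.1, hQS⟩

theorem dense_trans_source (Φ Ψ : DenseDiffeo) :
    Dense (Φ.toHomeo.trans Ψ.toHomeo).source := by
  rw [OpenPartialHomeomorph.trans_source]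
  have h := Φ.preimage_dense Ψ.dense_source
  exact dense_closure.mp (Φ.dense_source.mono h)

/-- The composition `Ψ ∘ Φ` on its natural domain `Φ⁻¹(dom Ψ)`. -/
def trans (Φ Ψ : DenseDiffeo) : DenseDiffeo where
  toHomeo := Φ.toHomeo.trans Ψ.toHomeo
  isPointTransformation := by
    constructor
    · rw [OpenPartialHomeomorph.trans_source]
      exact Ψ.isPointTransformation.1.comp
        (Φ.isPointTransformation.1.mono inter_subset_left) (fun P hP => hP.2)
    · rw [OpenPartialHomeomorph.trans_target]
      exact Φ.isPointTransformation.2.comp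
        (Ψ.isPointTransformation.2.mono inter_subset_left) (fun P hP => hP.2)
  dense_source := dense_trans_source Φ Ψ
  dense_target := dense_trans_source Ψ.symm Φ.symm

theorem trans_congr {Φ Φ' Ψ Ψ' : DenseDiffeo} (h₁ : Φ ≈ Φ') (h₂ : Ψ ≈ Ψ') :
    Φ.trans Ψ ≈ Φ'.trans Ψ' := by
  intro P hP
  have e : Φ.toHomeo P = Φ'.toHomeo P := h₁ ⟨hP.1.1, hP.2.1⟩
  have hb : Φ.toHomeo P ∈ Ψ'.toHomeo.source := by rw [e]; exact hP.2.2
  change Ψ.toHomeo (Φ.toHomeo P) = Ψ'.toHomeo (Φ'.toHomeo P)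
  rw [← e]
  exact h₂ ⟨hP.1.2, hb⟩

theorem symm_congr {Φ Ψ : DenseDiffeo} (h : Φ ≈ Ψ) : Φ.symm ≈ Ψ.symm := by
  have hS := (dense_trans_source Φ.symm Ψ).open_subset_closure_inter
    (Φ.toHomeo.open_target.inter Ψ.toHomeo.open_target)
  refine equiv_of_dense hS inter_subset_left ?_
  intro P hP
  have h1 : Φ.toHomeo.symm P ∈ Φ.toHomeo.source := Φ.toHomeo.map_target hP.1.1
  have h2 : Φ.toHomeo.symm P ∈ Ψ.toHomeo.source := hP.2.2
  have h3 : P = Ψ.toHomeo (Φ.toHomeo.symm P) := by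
    rw [← h ⟨h1, h2⟩, Φ.toHomeo.right_inv hP.1.1]
  change Φ.toHomeo.symm P = Ψ.toHomeo.symm P
  conv_rhs => rw [h3]
  exact (Ψ.toHomeo.left_inv h2).symm

end DenseDiffeo

/-- Point transformations with dense domain and range, up to continuous extension. Each class has a
unique member with the largest domain, and the product below is the composition followed by the
continuous extension of the composite. -/
def TransformationClass : Type := Quotient DenseDiffeo.instSetoid

/-- The class of a transformation. -/
def DenseDiffeo.toClass (Φ : DenseDiffeo) : TransformationClass :=
  Quotient.mk DenseDiffeo.instSetoid Φ

/-- The group of classes of transformations, with `g * h = g ∘ h`. -/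
instance : Group TransformationClass where
  mul := Quotient.map₂ (fun Φ Ψ => Ψ.trans Φ) (fun _ _ h₁ _ _ h₂ => DenseDiffeo.trans_congr h₂ h₁)
  one := DenseDiffeo.refl.toClass
  inv := Quotient.map DenseDiffeo.symm (fun _ _ h => DenseDiffeo.symm_congr h)
  mul_assoc := by
    rintro ⟨Φ⟩ ⟨Ψ⟩ ⟨Χ⟩
    exact Quotient.sound (fun _ _ => rfl)
  one_mul := by
    rintro ⟨Φ⟩
    exact Quotient.sound (fun _ _ => rfl)
  mul_one := by
    rintro ⟨Φ⟩
    exact Quotient.sound (fun _ _ => rfl)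
  inv_mul_cancel := by
    rintro ⟨Φ⟩
    exact Quotient.sound (fun P hP => Φ.toHomeo.left_inv hP.1.1)

/-- The group `G`: the group, under composition followed by continuous extension, of the
transformations of the above form whose parameter function has dense domain. -/
def pointSymmetryGroup : Subgroup TransformationClass :=
  Subgroup.closure {g | ∃ Φ : DenseDiffeo, HasForm Φ.toHomeo ∧ g = Φ.toClass}

/-- A curve of transformations is continuous if it is represented by a jointly continuous map
`(s, P) ↦ F (s, P)` on an open set `W` of pairs such that, for each `s`, the set of the points `P`
with `(s, P) ∈ W` is dense. -/
def IsContinuousCurve (c : ℝ → TransformationClass) : Prop :=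
  ∃ (W : Set (ℝ × Total)) (F : ℝ × Total → Total), IsOpen W ∧ ContinuousOn F W ∧
    ∀ s : ℝ, Dense {P | (s, P) ∈ W} ∧
      ∃ Φ : DenseDiffeo, Φ.toClass = c s ∧
        ∀ P ∈ Φ.toHomeo.source, (s, P) ∈ W → F (s, P) = Φ.toHomeo P

/-- The topology of `G`: the finest one for which all continuous curves of transformations from `G`
are continuous. -/
instance : TopologicalSpace pointSymmetryGroup where
  IsOpen U := ∀ c : ℝ → pointSymmetryGroup,
    IsContinuousCurve (fun s => (c s : TransformationClass)) → IsOpen (c ⁻¹' U)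
  isOpen_univ := fun _ _ => isOpen_univ
  isOpen_inter := fun _ _ hU hV c hc => (hU c hc).inter (hV c hc)
  isOpen_sUnion := fun S hS c hc => by
    rw [preimage_sUnion]
    exact isOpen_biUnion fun U hU => hS U hU c hc

/-- The involution `(t, x, y, u) ↦ (t, x, y, -u)`. -/
def signChange : DenseDiffeo where
  toHomeo := ((Homeomorph.refl Base).prodCongr (Homeomorph.neg ℝ)).toOpenPartialHomeomorph
  isPointTransformation :=
    ⟨(contDiff_fst.prodMk contDiff_snd.neg).contDiffOn,
      (contDiff_fst.prodMk contDiff_snd.neg).contDiffOn⟩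
  dense_source := dense_univ
  dense_target := dense_univ

end Kolmogorov

/-! Write L = ∂_t + x∂_y − ∂_x².

Sufficiency. Let B be the base map and M the multiplier of a transformation (*). If g∘B = M·k, then
(Lg)∘B = (γt+δ)²·M·Lk (`Params.kolmogorovOp_baseMap`). The factor does not vanish, and L is linear,
so adding a solution f to u changes nothing. Hence a function solves the equation if and only if its
image does.

Necessity. Near a point where the image of the graph of a solution is transversal to the fibres,
that image is again the graph of a solution. Compare two polynomial solutions with the same 1-jet
whose difference is `quadT` or `quadY`. Their images are solutions with a common 1-jet, and the
equation expresses g_xx through first derivatives, so the images agree to second order along the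
x-axis. Pulled back, the difference of the two originals is o(s²) along some curve, and this forces
the direction mapped to ∂_x to be proportional to ∂_x. Consequently the components T and Y of the
symmetry do not depend on x and u (`IsPointSymmetry.fderiv_t_y`).

Evaluating the equation for the images of solutions with arbitrary 1-jet (r, q, s) then gives an
identity that is polynomial in r, q, s (`IsPointSymmetry.determining`). Splitting it gives X_u = 0,
U_uu = 0 and four further equations. They are solved inside the algebra of smooth functions on the
domain, equipped with the commuting derivations along the coordinates (`determining_solution`). The
Jacobian of (T, Y) in (t, y) does not depend on x, which yields T_y = 0; T and Y are then expressed
through two functions ρ and H of t. Compatibility of the logarithmic derivatives of U_u yields ρ'' =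
0 and H'''' = 0. Thus ρ = γt+δ, H is a cubic, and U_u is a constant multiple of M. What remains of U
is a solution f.

The group. Parameters compose by an explicit law: matrices multiply, cubics are transported by the
action on binary cubic forms, and the factors σ multiply up to a positive exponential
(`Params.comp`, `Params.comp_multiplier`). Therefore the transformations with dense domain are
already closed under products and inverses.

The identity component. The sign of σ depends only on the class and is multiplicative. Along a
continuous curve it is locally constant, because it is the sign of an increment of the u-component
between two points of one fibre. Hence {σ > 0} is clopen in the final topology. Conversely, each
element with σ > 0 is joined to the identity: λᵢ, log σ and f are scaled by s, and the matrix is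
deformed by moving its second row along exp(s·log(δ+iγ)), which never vanishes, and scaling the
shear. So G₀ = {σ > 0}, and the sign is a homomorphism onto ℤ/2 with kernel G₀. -/

open Set Filter Topology
open scoped ContDiff

namespace Kolmogorov

/-! ### Directional derivatives -/

section Directional

variable {E : Type*} [NormedAddCommGroup E] [NormedSpace ℝ E]

/-- The derivative of `f` at `p` in the direction `v`. -/
noncomputable def pd (v : E) (f : E → ℝ) (p : E) : ℝ := fderiv ℝ f p v

theorem contDiffAt_pd {f : E → ℝ} {p : E} (v : E) (hf : ContDiffAt ℝ ∞ f p) :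
    ContDiffAt ℝ ∞ (pd v f) p :=
  (hf.fderiv_right (m := ∞) (by simp)).clm_apply contDiffAt_const

theorem differentiableAt_of_contDiffAt {F : Type*} [NormedAddCommGroup F] [NormedSpace ℝ F]
    {f : E → F} {p : E} (hf : ContDiffAt ℝ ∞ f p) : DifferentiableAt ℝ f p :=
  hf.differentiableAt (by simp)

theorem hasDerivAt_comp_curve {f : E → ℝ} {c : ℝ → E} {v : E} {s : ℝ}
    (hf : DifferentiableAt ℝ f (c s)) (hc : HasDerivAt c v s) :
    HasDerivAt (fun r => f (c r)) (pd v f (c s)) s :=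
  hf.hasFDerivAt.comp_hasDerivAt s hc

theorem pd_congr {f g : E → ℝ} {p : E} (v : E) (h : f =ᶠ[𝓝 p] g) : pd v f p = pd v g p := by
  unfold pd; rw [h.fderiv_eq]

theorem pd_add_vec (v w : E) (f : E → ℝ) (p : E) : pd (v + w) f p = pd v f p + pd w f p :=
  map_add _ _ _

theorem pd_smul_vec (r : ℝ) (v : E) (f : E → ℝ) (p : E) : pd (r • v) f p = r * pd v f p :=
  map_smul _ _ _

end Directional

theorem hasDerivAt_line_t (t x y : ℝ) :
    HasDerivAt (fun s : ℝ => ((s, x, y) : Base)) (1, 0, 0) t :=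
  (hasDerivAt_id t).prodMk ((hasDerivAt_const t x).prodMk (hasDerivAt_const t y))

theorem hasDerivAt_line_x (t x y : ℝ) :
    HasDerivAt (fun s : ℝ => ((t, s, y) : Base)) (0, 1, 0) x :=
  (hasDerivAt_const x t).prodMk ((hasDerivAt_id x).prodMk (hasDerivAt_const x y))

theorem hasDerivAt_line_y (t x y : ℝ) :
    HasDerivAt (fun s : ℝ => ((t, x, s) : Base)) (0, 0, 1) y :=
  (hasDerivAt_const y t).prodMk ((hasDerivAt_const y x).prodMk (hasDerivAt_id y))

theorem pd_base_decomp (a b c : ℝ) (f : Base → ℝ) (p : Base) :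
    pd (a, b, c) f p = a * pd (1, 0, 0) f p + b * pd (0, 1, 0) f p + c * pd (0, 0, 1) f p := by
  have : ((a, b, c) : Base) = a • ((1, 0, 0) : Base) + b • ((0, 1, 0) : Base)
      + c • ((0, 0, 1) : Base) := by simp
  rw [this, pd_add_vec, pd_add_vec, pd_smul_vec, pd_smul_vec, pd_smul_vec]

/-- The operator `∂_t + x ∂_y - ∂_x²`. -/
noncomputable def kolmogorovOp (f : Base → ℝ) (p : Base) : ℝ :=
  pd (1, 0, p.2.1) f p - pd (0, 1, 0) (pd (0, 1, 0) f) p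

section

variable {f g : Base → ℝ} {p : Base}

theorem kolmogorovOp_add (hf : ContDiffAt ℝ ∞ f p) (hg : ContDiffAt ℝ ∞ g p) :
    kolmogorovOp (f + g) p = kolmogorovOp f p + kolmogorovOp g p := by
  have hdiff {f : Base → ℝ} (hf : ContDiffAt ℝ ∞ f p) : ∀ᶠ q in 𝓝 p, DifferentiableAt ℝ f q :=
    ((hf.of_le (m := 1) (by simp)).eventually (by simp)).mono
      fun q hq => hq.differentiableAt one_ne_zero
  have h1 : pd (0, 1, 0) (f + g) =ᶠ[𝓝 p] pd (0, 1, 0) f + pd (0, 1, 0) g := by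
    filter_upwards [hdiff hf, hdiff hg] with q h1 h2
    simp [pd, fderiv_add h1 h2]
  unfold kolmogorovOp
  rw [pd_congr _ h1]
  have h2 := differentiableAt_of_contDiffAt (contDiffAt_pd (0, 1, 0) hf)
  have h3 := differentiableAt_of_contDiffAt (contDiffAt_pd (0, 1, 0) hg)
  simp only [pd] at h2 h3 ⊢
  rw [fderiv_add h2 h3, fderiv_add (differentiableAt_of_contDiffAt hf)
    (differentiableAt_of_contDiffAt hg)]
  simp only [_root_.add_apply]
  ring

theorem kolmogorovOp_const_mul (c : ℝ) (hf : ContDiffAt ℝ ∞ f p) :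
    kolmogorovOp (fun q => c * f q) p = c * kolmogorovOp f p := by
  have hpd {f : Base → ℝ} {q : Base} (v : Base) (hf : DifferentiableAt ℝ f q) :
      pd v (fun r => c * f r) q = c * pd v f q := by
    simp [pd, fderiv_const_mul hf]
  have h1 : pd (0, 1, 0) (fun q => c * f q) =ᶠ[𝓝 p] fun q => c * pd (0, 1, 0) f q :=
    ((hf.of_le (m := 1) (by simp)).eventually (by simp)).mono
      fun q hq => hpd _ (hq.differentiableAt one_ne_zero)
  unfold kolmogorovOp
  rw [pd_congr _ h1, hpd _ (differentiableAt_of_contDiffAt hf),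
    hpd _ (differentiableAt_of_contDiffAt (contDiffAt_pd _ hf))]
  ring

end

theorem eventually_contDiffAt {f : Base → ℝ} {D : Set Base} (hD : IsOpen D)
    (hf : ContDiffOn ℝ ∞ f D) {p : Base} (hp : p ∈ D) : ∀ᶠ q in 𝓝 p, ContDiffAt ℝ ∞ f q :=
  (hD.eventually_mem hp).mono fun _ hq => hf.contDiffAt (hD.mem_nhds hq)

/-- Passing to Fréchet derivatives makes the chain rule available for changes of variables. Openness
of D is needed for the second derivative, where the inner derivative must be identified on a whole
neighbourhood. -/
theorem isSolutionOn_iff {f : Base → ℝ} {D : Set Base} (hD : IsOpen D) :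
    IsSolutionOn f D ↔ ContDiffOn ℝ ∞ f D ∧ ∀ p ∈ D, kolmogorovOp f p = 0 := by
  unfold IsSolutionOn
  refine and_congr_right fun hf => ?_
  have key : ∀ t x y : ℝ, (t, x, y) ∈ D →
      (deriv (fun s => f (s, x, y)) t + x * deriv (fun s => f (t, x, s)) y
        - deriv (fun s => deriv (fun r => f (t, r, y)) s) x) = kolmogorovOp f (t, x, y) := by
    intro t x y h
    have hs : ContDiffAt ℝ ∞ f (t, x, y) := hf.contDiffAt (hD.mem_nhds h)
    have hd := differentiableAt_of_contDiffAt hs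
    have ev : (fun s => deriv (fun r => f (t, r, y)) s) =ᶠ[𝓝 x]
        fun s => pd (0, 1, 0) f (t, s, y) := by
      have := (hasDerivAt_line_x t x y).continuousAt.eventually
        (eventually_contDiffAt hD hf h)
      filter_upwards [this] with s hs
      exact (hasDerivAt_comp_curve (differentiableAt_of_contDiffAt hs)
        (hasDerivAt_line_x t s y)).deriv
    rw [ev.deriv_eq, (hasDerivAt_comp_curve hd (hasDerivAt_line_t t x y)).deriv,
      (hasDerivAt_comp_curve hd (hasDerivAt_line_y t x y)).deriv,
      (hasDerivAt_comp_curve (differentiableAt_of_contDiffAt (contDiffAt_pd (0, 1, 0) hs))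
        (hasDerivAt_line_x t x y)).deriv]
    simp only [kolmogorovOp]
    rw [pd_base_decomp 1 0 x]
    ring
  constructor
  · rintro h ⟨t, x, y⟩ hp
    rw [← key t x y hp, h t x y hp, sub_self]
  · intro h t x y hp
    exact sub_eq_zero.mp ((key t x y hp).trans (h _ hp))


/-! ### Derivatives of the transformation components -/

namespace Params

variable (a : Params)

theorem mem_dom {D : Set Base} {P : Total} : P ∈ a.dom D ↔ P.1 ∈ D ∧ a.den P.1.1 ≠ 0 := Iff.rfl

theorem continuous_den : Continuous a.den := by
  unfold den; fun_prop

theorem isOpen_den_ne : IsOpen {p : Base | a.den p.1 ≠ 0} :=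
  isOpen_ne.preimage (a.continuous_den.comp continuous_fst)

theorem contDiffAt_baseMap {p : Base} (hp : a.den p.1 ≠ 0) : ContDiffAt ℝ ∞ a.baseMap p := by
  have h : ContDiffAt ℝ ∞ (fun p : Base => a.den p.1) p := by unfold den; fun_prop
  have hx : ContDiffAt ℝ ∞ (fun p : Base => a.xHat p.1 p.2.1) p := by unfold xHat; fun_prop
  have hy : ContDiffAt ℝ ∞ (fun p : Base => a.yHat p.1 p.2.2) p := by unfold yHat; fun_prop
  refine ContDiffAt.prodMk ?_ (ContDiffAt.prodMk ?_ ?_)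
  · exact ContDiffAt.div (by fun_prop) h hp
  · exact (hx.div h hp).sub ((contDiffAt_const.mul hy).div (h.pow 2) (pow_ne_zero _ hp))
  · exact hy.div (h.pow 3) (pow_ne_zero _ hp)

theorem contDiffAt_multiplier {p : Base} (hp : a.den p.1 ≠ 0) :
    ContDiffAt ℝ ∞ a.multiplier p := by
  have h : ContDiffAt ℝ ∞ (fun p : Base => a.den p.1) p := by unfold den; fun_prop
  have hx : ContDiffAt ℝ ∞ (fun p : Base => a.xHat p.1 p.2.1) p := by unfold xHat; fun_prop
  have hy : ContDiffAt ℝ ∞ (fun p : Base => a.yHat p.1 p.2.2) p := by unfold yHat; fun_prop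
  refine ContDiffAt.mul (ContDiffAt.mul (contDiffAt_const.mul (h.pow 2)) (ContDiffAt.exp ?_))
    (ContDiffAt.exp (by fun_prop))
  exact (((contDiffAt_const.mul (hx.pow 2)).div h hp).sub
    (((contDiffAt_const.mul hx).mul hy).div (h.pow 2) (pow_ne_zero _ hp))).add
    ((contDiffAt_const.mul (hy.pow 2)).div (h.pow 3) (pow_ne_zero _ hp))

theorem multiplier_ne_zero {p : Base} (hp : a.den p.1 ≠ 0) : a.multiplier p ≠ 0 :=
  mul_ne_zero (mul_ne_zero (mul_ne_zero a.σ_ne (pow_ne_zero 2 hp)) (Real.exp_ne_zero _))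
    (Real.exp_ne_zero _)

/-- The coefficient `(X_t + x X_y) / X_x` of the transformation. -/
noncomputable def kappa (p : Base) : ℝ :=
  -4 * (a.γ / a.den p.1) * a.xHat p.1 p.2.1 + (6 * a.l₃ * p.1 + 2 * a.l₂)
    + 6 * (a.γ / a.den p.1) ^ 2 * a.yHat p.1 p.2.2

theorem hasDerivAt_den (t : ℝ) : HasDerivAt a.den a.γ t := by
  exact (((hasDerivAt_id t).const_mul a.γ).add_const a.δ).congr_deriv (mul_one _)

theorem hasDerivAt_xHat_t (t x : ℝ) :
    HasDerivAt (fun s => a.xHat s x) (6 * a.l₃ * t + 2 * a.l₂) t := by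
  have := ((((hasDerivAt_pow 2 t).const_mul (3 * a.l₃)).const_add x).add
    ((hasDerivAt_id t).const_mul (2 * a.l₂))).add_const a.l₁
  exact this.congr_deriv (by simp; ring)

theorem hasDerivAt_xHat_x (t x : ℝ) : HasDerivAt (fun s => a.xHat t s) 1 x :=
  (((hasDerivAt_id x).add_const _).add_const _).add_const _

theorem hasDerivAt_yHat_t (t y : ℝ) :
    HasDerivAt (fun s => a.yHat s y) (3 * a.l₃ * t ^ 2 + 2 * a.l₂ * t + a.l₁) t := by
  have := (((((hasDerivAt_pow 3 t).const_mul a.l₃).const_add y).add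
    ((hasDerivAt_pow 2 t).const_mul a.l₂)).add ((hasDerivAt_id t).const_mul a.l₁)).add_const a.l₀
  exact this.congr_deriv (by simp; ring)

theorem hasDerivAt_yHat_y (t y : ℝ) : HasDerivAt (fun s => a.yHat t s) 1 y :=
  ((((hasDerivAt_id y).add_const _).add_const _).add_const _).add_const _

/-- The direction of the derivation `∂_t + x ∂_y` is a combination of directions of lines. -/
theorem hasDerivAt_curve_of_components {T X Y : ℝ → ℝ} {T' X' Y' s : ℝ} (hT : HasDerivAt T T' s)
    (hX : HasDerivAt X X' s) (hY : HasDerivAt Y Y' s) :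
    HasDerivAt (fun r => ((T r, X r, Y r) : Base)) (T', X', Y') s :=
  hT.prodMk (hX.prodMk hY)

theorem hasDerivAt_baseMap_x {t : ℝ} (x y : ℝ) :
    HasDerivAt (fun s => a.baseMap (t, s, y)) (0, 1 / a.den t, 0) x := by
  refine hasDerivAt_curve_of_components (hasDerivAt_const x _) ?_ (hasDerivAt_const x _)
  exact ((a.hasDerivAt_xHat_x t x).div_const _).sub_const _

/-- The curve through `(t, x, y)` in the direction of `∂_t + x ∂_y`. -/
def driftCurve (t x y : ℝ) : ℝ → Base := fun s => (s, x, y + (s - t) * x)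

theorem hasDerivAt_driftCurve (t x y : ℝ) : HasDerivAt (driftCurve t x y) (1, 0, x) t := by
  refine hasDerivAt_curve_of_components (hasDerivAt_id t) (hasDerivAt_const t x) ?_
  simpa using (((hasDerivAt_id t).sub_const t).mul_const x).const_add y

theorem driftCurve_self (t x y : ℝ) : driftCurve t x y t = (t, x, y) := by
  simp [driftCurve]

/-- Adding a polynomial to y and its derivative to x respects the drift ∂_t + x∂_y: the drift
derivative of ŷ is x̂. -/
theorem hasDerivAt_yHat_drift (t x y : ℝ) :
    HasDerivAt (fun s => a.yHat s (y + (s - t) * x)) (a.xHat t x) t := by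
  have := (a.hasDerivAt_yHat_t t y).add (((hasDerivAt_id t).sub_const t).mul_const x)
  refine (this.congr_deriv ?_).congr_of_eventuallyEq (.of_forall fun s => ?_)
  · simp [xHat]; ring
  · simp [yHat]; ring

/-- The drift goes to (γt+δ)⁻² times the drift at the image point plus a multiple of ∂_x. Since ∂_x
scales by (γt+δ)⁻¹, the drift and ∂_x² acquire the same factor, and only the first-order term with
coefficient κ has to be removed by the multiplier. -/
theorem hasDerivAt_baseMap_drift {t : ℝ} (x y : ℝ) (ht : a.den t ≠ 0) :
    HasDerivAt (fun s => a.baseMap (driftCurve t x y s))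
      (1 / a.den t ^ 2, a.kappa (t, x, y) / a.den t,
        (a.baseMap (t, x, y)).2.1 / a.den t ^ 2) t := by
  have hd := a.hasDerivAt_den t
  have hx := a.hasDerivAt_xHat_t t x
  have hy := a.hasDerivAt_yHat_drift t x y
  have ey : a.yHat t (y + (t - t) * x) = a.yHat t y := by simp
  have hdet := a.det_eq
  refine hasDerivAt_curve_of_components ?_ ?_ ?_
  · refine ((((hasDerivAt_id t).const_mul a.α).add_const a.β).div hd ht).congr_deriv ?_
    simp only [id_eq, mul_one]
    congr 1
    simp only [den]
    linear_combination hdet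
  · refine ((hx.div hd ht).sub ((hy.const_mul (3 * a.γ)).div (hd.pow 2)
      (pow_ne_zero 2 ht))).congr_deriv ?_
    simp only [ey, kappa, Pi.pow_apply]
    field_simp
    ring
  · refine (hy.div (hd.pow 3) (pow_ne_zero 3 ht)).congr_deriv ?_
    simp only [ey, baseMap, Pi.pow_apply]
    field_simp
    ring

/-- The exponent of the multiplier. -/
noncomputable def exponent : Base → ℝ := fun (t, x, y) =>
  (a.γ * a.xHat t x ^ 2 / a.den t - 3 * a.γ ^ 2 * a.xHat t x * a.yHat t y / a.den t ^ 2
      + 3 * a.γ ^ 3 * a.yHat t y ^ 2 / a.den t ^ 3)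
    + (3 * a.l₃ * (y - t * x) - a.l₂ * x
      - (3 * a.l₃ ^ 2 * t ^ 3 + 3 * a.l₃ * a.l₂ * t ^ 2 + a.l₂ ^ 2 * t))

theorem multiplier_eq (p : Base) :
    a.multiplier p = a.σ * a.den p.1 ^ 2 * Real.exp (a.exponent p) := by
  simp only [multiplier, exponent, Real.exp_add]
  ring

/-- `∂_y log |M|` for the multiplier `M`. -/
noncomputable def kappaY (p : Base) : ℝ :=
  -3 * (a.γ / a.den p.1) ^ 2 * a.xHat p.1 p.2.1 + 6 * (a.γ / a.den p.1) ^ 3 * a.yHat p.1 p.2.2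
    + 3 * a.l₃

/-- After the change of variables the coefficient of k_x is −κM − 2M_x; this is the condition that
it vanishes. -/
theorem pd_x_multiplier {p : Base} (hp : a.den p.1 ≠ 0) :
    pd (0, 1, 0) a.multiplier p = -(a.kappa p / 2) * a.multiplier p := by
  obtain ⟨t, x, y⟩ := p
  have ht : a.den t ≠ 0 := hp
  have h := hasDerivAt_comp_curve (differentiableAt_of_contDiffAt (a.contDiffAt_multiplier hp))
    (hasDerivAt_line_x t x y)
  refine h.unique ?_
  have hx := a.hasDerivAt_xHat_x t x
  have hE : HasDerivAt (fun s => a.exponent (t, s, y)) (-(a.kappa (t, x, y) / 2)) x := by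
    refine (((((hx.pow 2).const_mul a.γ).div_const _).sub
      (((hx.const_mul (3 * a.γ ^ 2)).mul_const (a.yHat t y)).div_const _)).add_const _ |>.add
      ((((((hasDerivAt_id x).const_mul t).const_sub y).const_mul (3 * a.l₃)).sub
      ((hasDerivAt_id x).const_mul a.l₂)).sub_const _)).congr_deriv ?_
    simp only [kappa, xHat, yHat]
    field_simp
    simp
    ring
  refine ((hE.exp.const_mul (a.σ * a.den t ^ 2)).congr_deriv ?_).congr_of_eventuallyEq
    (.of_forall fun s => a.multiplier_eq _)
  rw [a.multiplier_eq]
  ring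

theorem pd_y_multiplier {p : Base} (hp : a.den p.1 ≠ 0) :
    pd (0, 0, 1) a.multiplier p = a.kappaY p * a.multiplier p := by
  obtain ⟨t, x, y⟩ := p
  have ht : a.den t ≠ 0 := hp
  have h := hasDerivAt_comp_curve (differentiableAt_of_contDiffAt (a.contDiffAt_multiplier hp))
    (hasDerivAt_line_y t x y)
  refine h.unique ?_
  have hy := a.hasDerivAt_yHat_y t y
  have hE : HasDerivAt (fun s => a.exponent (t, x, s)) (a.kappaY (t, x, y)) y := by
    refine ((((hy.const_mul (3 * a.γ ^ 2 * a.xHat t x)).div_const (a.den t ^ 2)).const_sub _).add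
      (((hy.pow 2).const_mul (3 * a.γ ^ 3)).div_const (a.den t ^ 3)) |>.add
      (((((hasDerivAt_id y).sub_const (t * x)).const_mul (3 * a.l₃)).sub_const _).sub_const
        _)).congr_deriv ?_
    simp only [kappaY]
    field_simp
    simp
    ring
  refine ((hE.exp.const_mul (a.σ * a.den t ^ 2)).congr_deriv ?_).congr_of_eventuallyEq
    (.of_forall fun s => a.multiplier_eq _)
  rw [a.multiplier_eq]
  ring

/-- This is the vanishing of the zeroth-order term, that is, drift M = κM_x + M_xx, with κ_x =
−4γ/(γt+δ). The exponential accounts for −κ²/4 and the prefactor (γt+δ)² for 2γ/(γt+δ). -/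
theorem pd_drift_multiplier {p : Base} (hp : a.den p.1 ≠ 0) :
    pd (1, 0, p.2.1) a.multiplier p
      = -(a.kappa p ^ 2 / 4 - 2 * (a.γ / a.den p.1)) * a.multiplier p := by
  obtain ⟨t, x, y⟩ := p
  have ht : a.den t ≠ 0 := hp
  have h := hasDerivAt_comp_curve (c := driftCurve t x y) (s := t) (v := (1, 0, x))
    (differentiableAt_of_contDiffAt
      (by rw [driftCurve_self]; exact a.contDiffAt_multiplier hp)) (hasDerivAt_driftCurve t x y)
  rw [driftCurve_self] at h
  refine h.unique ?_
  have hd := a.hasDerivAt_den t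
  have hx := a.hasDerivAt_xHat_t t x
  have hy := a.hasDerivAt_yHat_drift t x y
  have hid := hasDerivAt_id t
  have hE : HasDerivAt (fun s => a.exponent (driftCurve t x y s))
      (-(a.kappa (t, x, y) ^ 2 / 4)) t := by
    refine (((((hx.pow 2).const_mul a.γ).div hd ht).sub
      (((hx.const_mul (3 * a.γ ^ 2)).mul hy).div (hd.pow 2) (pow_ne_zero 2 ht))).add
      (((hy.pow 2).const_mul (3 * a.γ ^ 3)).div (hd.pow 3) (pow_ne_zero 3 ht)) |>.add
      (((((((hid.sub_const t).mul_const x).const_add y).sub (hid.mul_const x)).const_mul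
        (3 * a.l₃)).sub_const (a.l₂ * x)).sub
        ((((hid.pow 3).const_mul (3 * a.l₃ ^ 2)).add ((hid.pow 2).const_mul
          (3 * a.l₃ * a.l₂))).add (hid.const_mul (a.l₂ ^ 2))))).congr_deriv ?_
    have ey : a.yHat t (y + (t - t) * x) = a.yHat t y := by simp
    simp only [ey, kappa, Pi.pow_apply, id_eq]
    field_simp
    simp
    ring
  refine ((((hd.pow 2).const_mul a.σ).mul hE.exp).congr_deriv ?_).congr_of_eventuallyEq
    (.of_forall fun s => a.multiplier_eq _)
  rw [a.multiplier_eq, driftCurve_self]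
  simp only [Pi.pow_apply]
  field_simp
  simp
  ring

/-- The transformation intertwines the operator `∂_t + x ∂_y - ∂_x²` with a multiple of itself. -/
theorem kolmogorovOp_baseMap {g k : Base → ℝ} {p : Base} (hp : a.den p.1 ≠ 0)
    (hg : ContDiffAt ℝ ∞ g (a.baseMap p)) (hk : ContDiffAt ℝ ∞ k p)
    (h : ∀ᶠ q in 𝓝 p, g (a.baseMap q) = a.multiplier q * k q) :
    kolmogorovOp g (a.baseMap p) = a.den p.1 ^ 2 * a.multiplier p * kolmogorovOp k p := by
  have hdiff {f : Base → ℝ} {q : Base} (hf : ContDiffAt ℝ ∞ f q) :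
      ∀ᶠ r in 𝓝 q, DifferentiableAt ℝ f r :=
    ((hf.of_le (m := 1) (by simp)).eventually (by simp)).mono
      fun r hr => hr.differentiableAt one_ne_zero
  have hden : ∀ᶠ q in 𝓝 p, a.den q.1 ≠ 0 := a.isOpen_den_ne.eventually_mem hp
  have hgB : ∀ᶠ q in 𝓝 p, DifferentiableAt ℝ g (a.baseMap q) :=
    (a.contDiffAt_baseMap hp).continuousAt.eventually (hdiff hg)
  -- The formula is needed on a neighbourhood, because it is differentiated once more in x.
  have first : ∀ᶠ q in 𝓝 p, pd (0, 1, 0) g (a.baseMap q)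
      = a.den q.1 * (a.multiplier q * (pd (0, 1, 0) k q - a.kappa q / 2 * k q)) := by
    filter_upwards [hden, hgB, hdiff hk, h.eventually_nhds] with q hq hgq hkq hhq
    obtain ⟨t, x, y⟩ := q
    have ht : a.den t ≠ 0 := hq
    have e1 := hasDerivAt_comp_curve hgq (a.hasDerivAt_baseMap_x (t := t) x y)
    have e2 := (hasDerivAt_comp_curve (differentiableAt_of_contDiffAt
      (a.contDiffAt_multiplier hq)) (hasDerivAt_line_x t x y)).mul
      (hasDerivAt_comp_curve hkq (hasDerivAt_line_x t x y))
    have e3 := e1.unique (e2.congr_of_eventuallyEq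
      ((hasDerivAt_line_x t x y).continuousAt.eventually hhq))
    rw [a.pd_x_multiplier hq, pd_base_decomp] at e3
    simp only [zero_mul, zero_add, add_zero] at e3
    change _ = a.den t * _
    field_simp at e3 ⊢
    linear_combination e3
  obtain ⟨t, x, y⟩ := p
  have ht : a.den t ≠ 0 := hp
  have hM := differentiableAt_of_contDiffAt (a.contDiffAt_multiplier hp)
  have hkd := differentiableAt_of_contDiffAt hk
  have hk1 := differentiableAt_of_contDiffAt (contDiffAt_pd (0, 1, 0) hk)
  have hgd := differentiableAt_of_contDiffAt hg
  have hg1 := differentiableAt_of_contDiffAt (contDiffAt_pd (0, 1, 0) hg)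
  have lx := hasDerivAt_line_x t x y
  have hkap : HasDerivAt (fun s => a.kappa (t, s, y)) (-4 * (a.γ / a.den t)) x := by
    exact ((((a.hasDerivAt_xHat_x t x).const_mul (-4 * (a.γ / a.den t))).add_const
      (6 * a.l₃ * t + 2 * a.l₂)).add_const (6 * (a.γ / a.den t) ^ 2 * a.yHat t y)).congr_deriv
      (mul_one _)
  have second : pd (0, 1, 0) (pd (0, 1, 0) g) (a.baseMap (t, x, y))
      = a.den t ^ 2 * (a.multiplier (t, x, y) *
        (pd (0, 1, 0) (pd (0, 1, 0) k) (t, x, y) - a.kappa (t, x, y) * pd (0, 1, 0) k (t, x, y)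
          + (2 * (a.γ / a.den t) + a.kappa (t, x, y) ^ 2 / 4) * k (t, x, y))) := by
    have e1 := hasDerivAt_comp_curve hg1 (a.hasDerivAt_baseMap_x (t := t) x y)
    have e2 := ((hasDerivAt_comp_curve hM lx).mul ((hasDerivAt_comp_curve hk1 lx).sub
      ((hkap.div_const 2).mul (hasDerivAt_comp_curve hkd lx)))).const_mul (a.den t)
    have e3 := e1.unique (e2.congr_of_eventuallyEq (lx.continuousAt.eventually first))
    rw [a.pd_x_multiplier hp, pd_base_decomp] at e3
    simp only [zero_mul, zero_add, add_zero, Pi.mul_apply, Pi.sub_apply] at e3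
    field_simp at e3 ⊢
    linear_combination e3
  have drift : pd (1, 0, (a.baseMap (t, x, y)).2.1) g (a.baseMap (t, x, y))
      = a.den t ^ 2 * (a.multiplier (t, x, y) * (pd (1, 0, x) k (t, x, y)
        - (a.kappa (t, x, y) ^ 2 / 4 - 2 * (a.γ / a.den t)) * k (t, x, y)
        - a.kappa (t, x, y) * (pd (0, 1, 0) k (t, x, y) - a.kappa (t, x, y) / 2 * k (t, x, y)))) := by
    have ld := hasDerivAt_driftCurve t x y
    have e0 := driftCurve_self t x y
    have e1 := hasDerivAt_comp_curve (f := g) (by rwa [e0]) (a.hasDerivAt_baseMap_drift x y ht)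
    have e2 := (hasDerivAt_comp_curve (f := a.multiplier) (by rwa [e0]) ld).mul
      (hasDerivAt_comp_curve (f := k) (by rwa [e0]) ld)
    have h' : ∀ᶠ s in 𝓝 t, g (a.baseMap (driftCurve t x y s))
        = a.multiplier (driftCurve t x y s) * k (driftCurve t x y s) := by
      have hc := ld.continuousAt
      rw [ContinuousAt, e0] at hc
      exact hc.eventually h
    have e3 := e1.unique (e2.congr_of_eventuallyEq h')
    rw [e0, a.pd_drift_multiplier hp, pd_base_decomp] at e3
    rw [pd_base_decomp 1 0]
    have f1 := first.self_of_nhds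
    simp only at f1 e3
    rw [f1] at e3
    field_simp at e3 ⊢
    linear_combination e3
  simp only [kolmogorovOp]
  rw [drift, second]
  ring

end Params

/-! ### Transformations of the given form are point symmetries -/

/-- Near each point of the graph, g∘B = M(f + k) with a solution k. Intertwining and linearity give
(Lg)∘B = (γt+δ)²M·Lf with a nonvanishing factor, so Lf and Lg vanish together. Different local
functions k do no harm. -/
theorem isPointSymmetry_of_locallyHasForm {Φ : OpenPartialHomeomorph Total Total}
    (hΦ : IsPointTransformation Φ) (h : LocallyHasForm Φ) : IsPointSymmetry Φ := by
  refine ⟨hΦ, fun D D' f g hD hD' hf hg hsub himg => ?_⟩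
  obtain ⟨a, ha⟩ := h
  have key : ∀ p ∈ D, a.baseMap p ∈ D' ∧ a.den p.1 ≠ 0 ∧ Φ (p, f p) = (a.baseMap p, g (a.baseMap p))
      ∧ kolmogorovOp g (a.baseMap p) = a.den p.1 ^ 2 * a.multiplier p * kolmogorovOp f p := by
    intro p hp
    obtain ⟨E, k, hE, hk, hP, hev⟩ := ha (p, f p) (hsub ⟨p, hp, rfl⟩)
    have hden : a.den p.1 ≠ 0 := hP.2
    have hfp : ContDiffAt ℝ ∞ f p := hf.contDiffAt (hD.mem_nhds hp)
    have hkp : ContDiffAt ℝ ∞ k p := hk.1.contDiffAt (hE.mem_nhds hP.1)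
    have hval : ∀ q ∈ D, Φ (q, f q) = a.map k (q, f q) →
        a.baseMap q ∈ D' ∧ g (a.baseMap q) = a.multiplier q * (f q + k q) := by
      intro q hq hqe
      have : Φ (q, f q) ∈ graphOver g D' := himg ▸ ⟨_, ⟨q, hq, rfl⟩, rfl⟩
      obtain ⟨r, hr, hre⟩ := this
      rw [hqe] at hre
      have h1 : r = a.baseMap q := congrArg Prod.fst hre
      have h2 : g r = a.multiplier q * (f q + k q) := congrArg Prod.snd hre
      exact h1 ▸ ⟨hr, h2⟩
    have hgr : ContinuousAt (fun q => (q, f q)) p := continuousAt_id.prodMk hfp.continuousAt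
    have hev' : ∀ᶠ q in 𝓝 p, g (a.baseMap q) = a.multiplier q * (f q + k q) := by
      filter_upwards [hgr.eventually hev, hD.eventually_mem hp] with q hq hqD
      exact (hval q hqD hq).2
    obtain ⟨hB, hgB⟩ := hval p hp hev.self_of_nhds
    refine ⟨hB, hden, ?_, ?_⟩
    · rw [hev.self_of_nhds, hgB]; rfl
    · have hfk := a.kolmogorovOp_baseMap hden (hg.contDiffAt (hD'.mem_nhds hB)) (hfp.add hkp) hev'
      rw [hfk]
      have hk0 := ((isSolutionOn_iff hE).mp hk).2 p hP.1
      have hadd : kolmogorovOp (fun x => f x + k x) p = kolmogorovOp f p + kolmogorovOp k p :=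
        kolmogorovOp_add hfp hkp
      rw [hadd, hk0, add_zero]
  rw [isSolutionOn_iff hD, isSolutionOn_iff hD', and_iff_right hf, and_iff_right hg]
  constructor
  · intro hs q hq
    have : (q, g q) ∈ Φ '' graphOver f D := himg ▸ ⟨q, hq, rfl⟩
    obtain ⟨_, ⟨p, hp, rfl⟩, hpe⟩ := this
    obtain ⟨-, -, h1, h2⟩ := key p hp
    have : q = a.baseMap p := by rw [h1] at hpe; exact (congrArg Prod.fst hpe).symm
    rw [this, h2, hs p hp, mul_zero]
  · intro hs p hp
    obtain ⟨hB, hden, -, h2⟩ := key p hp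
    rw [hs _ hB] at h2
    exact (mul_eq_zero.mp h2.symm).resolve_left
      (mul_ne_zero (pow_ne_zero 2 hden) (a.multiplier_ne_zero hden))

theorem HasForm.locallyHasForm {Φ : OpenPartialHomeomorph Total Total} (h : HasForm Φ) :
    LocallyHasForm Φ := by
  obtain ⟨a, D, f, hD, hf, hs, he⟩ := h
  refine ⟨a, fun P hP => ⟨D, f, hD, hf, hs ▸ hP, ?_⟩⟩
  filter_upwards [Φ.open_source.mem_nhds hP] with Q hQ using he hQ


/-! ### Composition of transformations on the level of constant parameters -/

namespace Params

/-- Coefficients of the cubic polynomial `(γt+δ)³ h((αt+β)/(γt+δ))`, where `h` is the polynomial with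
the coefficients `l₀, …, l₃`. -/
def act (a : Params) (l : Fin 4 → ℝ) : Fin 4 → ℝ :=
  ![l 3 * a.β ^ 3 + l 2 * (a.β ^ 2 * a.δ) + l 1 * (a.β * a.δ ^ 2) + l 0 * a.δ ^ 3,
    l 3 * (3 * a.α * a.β ^ 2) + l 2 * (a.β ^ 2 * a.γ + 2 * a.α * a.β * a.δ)
      + l 1 * (a.α * a.δ ^ 2 + 2 * a.β * a.γ * a.δ) + l 0 * (3 * a.γ * a.δ ^ 2),
    l 3 * (3 * a.α ^ 2 * a.β) + l 2 * (a.α ^ 2 * a.δ + 2 * a.α * a.β * a.γ)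
      + l 1 * (a.β * a.γ ^ 2 + 2 * a.α * a.γ * a.δ) + l 0 * (3 * a.γ ^ 2 * a.δ),
    l 3 * a.α ^ 3 + l 2 * (a.α ^ 2 * a.γ) + l 1 * (a.α * a.γ ^ 2) + l 0 * a.γ ^ 3]

/-- The coefficients `λ₀, …, λ₃`. -/
def coeffs (a : Params) : Fin 4 → ℝ := ![a.l₀, a.l₁, a.l₂, a.l₃]

/-- The logarithm of the constant appearing in the composition of multipliers. -/
noncomputable def cocycle (b a : Params) : ℝ :=
  (3 * a.act b.coeffs 3 * a.act b.coeffs 0 - a.act b.coeffs 2 * a.act b.coeffs 1) / 2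
    - (3 * b.l₃ * b.l₀ - b.l₂ * b.l₁) / 2
    + (3 * a.act b.coeffs 3 * a.l₀ - a.act b.coeffs 2 * a.l₁)

/-- The parameters of the composition of `b` after `a`. -/
noncomputable def comp (b a : Params) : Params where
  α := b.α * a.α + b.β * a.γ
  β := b.α * a.β + b.β * a.δ
  γ := b.γ * a.α + b.δ * a.γ
  δ := b.γ * a.β + b.δ * a.δ
  l₀ := a.l₀ + a.act b.coeffs 0
  l₁ := a.l₁ + a.act b.coeffs 1
  l₂ := a.l₂ + a.act b.coeffs 2
  l₃ := a.l₃ + a.act b.coeffs 3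
  σ := b.σ * a.σ * Real.exp (cocycle b a)
  det_eq := by
    linear_combination b.det_eq + (b.α * b.δ - b.β * b.γ) * a.det_eq
  σ_ne := mul_ne_zero (mul_ne_zero b.σ_ne a.σ_ne) (Real.exp_ne_zero _)

variable (b a : Params) {t : ℝ}

theorem det_eq_den (t : ℝ) : a.α * a.den t - a.γ * (a.α * t + a.β) = 1 := by
  simp only [den]; linear_combination a.det_eq

theorem comp_den (ht : a.den t ≠ 0) (x y : ℝ) :
    (comp b a).den t = a.den t * b.den (a.baseMap (t, x, y)).1 := by
  simp only [baseMap]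
  have : a.den t * b.den ((a.α * t + a.β) / a.den t) = b.γ * (a.α * t + a.β) + b.δ * a.den t := by
    simp only [den] at ht ⊢; field_simp
  rw [this]
  simp only [comp, den]; ring

/-- The t-derivative of the identity `comp_den`, since dT/dt = 1/(γt+δ)². -/
theorem comp_gamma (ht : a.den t ≠ 0) (x y : ℝ) :
    (comp b a).γ = b.γ / a.den t + a.γ * b.den (a.baseMap (t, x, y)).1 := by
  simp only [baseMap, comp]
  have h := a.det_eq_den t
  rw [den.eq_1 b]
  field_simp
  linear_combination b.γ * h

/-- The polynomial with coefficients `l` and its divided derivatives. -/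
theorem act_eval (ht : a.den t ≠ 0) (l : Fin 4 → ℝ) {T : ℝ} (hT : T = (a.α * t + a.β) / a.den t) :
    a.act l 3 * t ^ 3 + a.act l 2 * t ^ 2 + a.act l 1 * t + a.act l 0
        = a.den t ^ 3 * (l 3 * T ^ 3 + l 2 * T ^ 2 + l 1 * T + l 0) ∧
      3 * a.act l 3 * t ^ 2 + 2 * a.act l 2 * t + a.act l 1
        = 3 * a.γ * a.den t ^ 2 * (l 3 * T ^ 3 + l 2 * T ^ 2 + l 1 * T + l 0)
          + a.den t * (3 * l 3 * T ^ 2 + 2 * l 2 * T + l 1) ∧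
      3 * a.act l 3 * t + a.act l 2
        = 3 * a.γ ^ 2 * a.den t * (l 3 * T ^ 3 + l 2 * T ^ 2 + l 1 * T + l 0)
          + 2 * a.γ * (3 * l 3 * T ^ 2 + 2 * l 2 * T + l 1) + (3 * l 3 * T + l 2) / a.den t ∧
      a.act l 3
        = a.γ ^ 3 * (l 3 * T ^ 3 + l 2 * T ^ 2 + l 1 * T + l 0)
          + a.γ ^ 2 * (3 * l 3 * T ^ 2 + 2 * l 2 * T + l 1) / a.den t
          + a.γ * (3 * l 3 * T + l 2) / a.den t ^ 2 + l 3 / a.den t ^ 3 := by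
  have h := a.det_eq_den t
  have hNt : a.den t = a.γ * t + a.δ := rfl
  set N := a.α * t + a.β with hN
  set D := a.den t with hD
  have h0 : a.act l 3 * t ^ 3 + a.act l 2 * t ^ 2 + a.act l 1 * t + a.act l 0
      = l 3 * N ^ 3 + l 2 * N ^ 2 * D + l 1 * N * D ^ 2 + l 0 * D ^ 3 := by
    rw [hN, hNt]; simp [act]; ring
  have h1 : 3 * a.act l 3 * t ^ 2 + 2 * a.act l 2 * t + a.act l 1
      = a.α * (3 * l 3 * N ^ 2 + 2 * l 2 * N * D + l 1 * D ^ 2)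
        + a.γ * (l 2 * N ^ 2 + 2 * l 1 * N * D + 3 * l 0 * D ^ 2) := by
    rw [hN, hNt]; simp [act]; ring
  have h2 : 3 * a.act l 3 * t + a.act l 2
      = a.α ^ 2 * (3 * l 3 * N + l 2 * D) + 2 * a.α * a.γ * (l 2 * N + l 1 * D)
        + a.γ ^ 2 * (l 1 * N + 3 * l 0 * D) := by
    rw [hN, hNt]; simp [act]; ring
  have h3 : a.act l 3
      = l 3 * a.α ^ 3 + l 2 * (a.α ^ 2 * a.γ) + l 1 * (a.α * a.γ ^ 2) + l 0 * a.γ ^ 3 := by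
    simp [act]
  -- Eliminating α through the determinant leaves only γ, N and D, so each identity becomes rational
  -- in free quantities.
  have hα : a.α = (a.γ * N + 1) / D := by field_simp; linear_combination h
  rw [h0, h1, h2, h3, hT, hα]
  refine ⟨?_, ?_, ?_, ?_⟩ <;> field_simp <;> ring

theorem comp_yHat (ht : a.den t ≠ 0) (x y : ℝ) :
    (comp b a).yHat t y
      = a.den t ^ 3 * b.yHat (a.baseMap (t, x, y)).1 (a.baseMap (t, x, y)).2.2 := by
  have h := (a.act_eval ht b.coeffs rfl).1
  simp only [coeffs, Matrix.cons_val] at h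
  simp only [comp, yHat, baseMap, coeffs]
  have e : a.den t ^ 3 * ((y + a.l₃ * t ^ 3 + a.l₂ * t ^ 2 + a.l₁ * t + a.l₀) / a.den t ^ 3)
    = y + a.l₃ * t ^ 3 + a.l₂ * t ^ 2 + a.l₁ * t + a.l₀ := by field_simp
  linear_combination h - e

/-- The counterpart of `comp_yHat` under the drift derivative, which takes ŷ to x̂ and (γt+δ)³ to
3γ(γt+δ)². -/
theorem comp_xHat (ht : a.den t ≠ 0) (x y : ℝ) :
    (comp b a).xHat t x
      = a.den t * b.xHat (a.baseMap (t, x, y)).1 (a.baseMap (t, x, y)).2.1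
        + 3 * a.γ * a.den t ^ 2 * b.yHat (a.baseMap (t, x, y)).1 (a.baseMap (t, x, y)).2.2 := by
  have h := (a.act_eval ht b.coeffs rfl).2.1
  simp only [coeffs, Matrix.cons_val] at h
  simp only [comp, xHat, yHat, baseMap, coeffs]
  set X := x + 3 * a.l₃ * t ^ 2 + 2 * a.l₂ * t + a.l₁
  set Y := y + a.l₃ * t ^ 3 + a.l₂ * t ^ 2 + a.l₁ * t + a.l₀
  have e : a.den t * (X / a.den t - 3 * a.γ * Y / a.den t ^ 2)
      + 3 * a.γ * a.den t ^ 2 * (Y / a.den t ^ 3) = X := by field_simp; ring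
  simp only [X] at e ⊢
  linear_combination h - e

theorem comp_baseMap (ht : a.den t ≠ 0) (x y : ℝ) (hb : b.den (a.baseMap (t, x, y)).1 ≠ 0) :
    (comp b a).baseMap (t, x, y) = b.baseMap (a.baseMap (t, x, y)) := by
  have h1 := comp_den b a ht x y
  have h2 := comp_gamma b a ht x y
  have h3 := comp_xHat b a ht x y
  have h4 := comp_yHat b a ht x y
  have hT : (comp b a).α * t + (comp b a).β
      = a.den t * (b.α * (a.baseMap (t, x, y)).1 + b.β) := by
    simp only [comp, baseMap]
    field_simp
    simp only [den]
    ring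
  rcases hB : a.baseMap (t, x, y) with ⟨T, X, Y⟩
  rw [hB] at h1 h2 h3 h4 hT hb
  simp only [baseMap]
  simp only at h1 h2 h3 h4 hT hb
  rw [h1, h2, h3, h4, hT]
  refine Prod.ext ?_ (Prod.ext ?_ ?_)
  · simp only; field_simp
  · simp only; field_simp; ring
  · simp only; field_simp

/-- The quadratic parts of the exponents add up exactly once the part of `a` is evaluated at the
hatted variables of the composite. The discrepancy from this shift is linear in x̂, ŷ plus a term in
t, and the λ-dependent exponents compensate it up to a constant. -/
theorem comp_exponent (ht : a.den t ≠ 0) (x y : ℝ) (hb : b.den (a.baseMap (t, x, y)).1 ≠ 0) :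
    b.exponent (a.baseMap (t, x, y)) + a.exponent (t, x, y)
      = (comp b a).exponent (t, x, y) + cocycle b a := by
  have h1 := comp_den b a ht x y
  have h2 := comp_gamma b a ht x y
  have h3 := comp_xHat b a ht x y
  have h4 := comp_yHat b a ht x y
  obtain ⟨k0, k1, k2, k3⟩ := a.act_eval ht b.coeffs (T := (a.baseMap (t, x, y)).1) rfl
  have hX : (a.baseMap (t, x, y)).2.1 = a.xHat t x / a.den t
      - 3 * a.γ * a.yHat t y / a.den t ^ 2 := rfl
  have hY : (a.baseMap (t, x, y)).2.2 = a.yHat t y / a.den t ^ 3 := rfl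
  rcases hB : a.baseMap (t, x, y) with ⟨T, X, Y⟩
  rw [hB] at h1 h2 h3 h4 k0 k1 k2 k3 hb hX hY
  simp only at h1 h2 h3 h4 k0 k1 k2 k3 hb hX hY
  have quad : b.γ * b.xHat T X ^ 2 / b.den T - 3 * b.γ ^ 2 * b.xHat T X * b.yHat T Y / b.den T ^ 2
        + 3 * b.γ ^ 3 * b.yHat T Y ^ 2 / b.den T ^ 3
      = ((comp b a).γ * (comp b a).xHat t x ^ 2 / (comp b a).den t
        - 3 * (comp b a).γ ^ 2 * (comp b a).xHat t x * (comp b a).yHat t y / (comp b a).den t ^ 2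
        + 3 * (comp b a).γ ^ 3 * (comp b a).yHat t y ^ 2 / (comp b a).den t ^ 3)
      - (a.γ * (comp b a).xHat t x ^ 2 / a.den t
        - 3 * a.γ ^ 2 * (comp b a).xHat t x * (comp b a).yHat t y / a.den t ^ 2
        + 3 * a.γ ^ 3 * (comp b a).yHat t y ^ 2 / a.den t ^ 3) := by
    rw [h1, h2, h3, h4]
    field_simp
    ring
  have l0 : (comp b a).l₀ = a.l₀ + a.act b.coeffs 0 := rfl
  have l1 : (comp b a).l₁ = a.l₁ + a.act b.coeffs 1 := rfl
  have l2 : (comp b a).l₂ = a.l₂ + a.act b.coeffs 2 := rfl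
  have l3 : (comp b a).l₃ = a.l₃ + a.act b.coeffs 3 := rfl
  simp only [exponent]
  rw [quad]
  have hx' : (comp b a).xHat t x = a.xHat t x
      + (3 * a.act b.coeffs 3 * t ^ 2 + 2 * a.act b.coeffs 2 * t + a.act b.coeffs 1) := by
    simp only [xHat, l1, l2, l3]; ring
  have hy' : (comp b a).yHat t y = a.yHat t y + (a.act b.coeffs 3 * t ^ 3
      + a.act b.coeffs 2 * t ^ 2 + a.act b.coeffs 1 * t + a.act b.coeffs 0) := by
    simp only [yHat, l0, l1, l2, l3]; ring
  rw [hx', hy', l2, l3]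
  have hyx : 3 * (a.l₃ + a.act b.coeffs 3) * (y - t * x) - (a.l₂ + a.act b.coeffs 2) * x
      - (3 * (a.l₃ + a.act b.coeffs 3) ^ 2 * t ^ 3
        + 3 * (a.l₃ + a.act b.coeffs 3) * (a.l₂ + a.act b.coeffs 2) * t ^ 2
        + (a.l₂ + a.act b.coeffs 2) ^ 2 * t)
      + (3 * a.act b.coeffs 3 * a.l₀ - a.act b.coeffs 2 * a.l₁)
      + (3 * a.act b.coeffs 3 * a.act b.coeffs 0 - a.act b.coeffs 2 * a.act b.coeffs 1) / 2
      = 3 * a.l₃ * (y - t * x) - a.l₂ * x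
        - (3 * a.l₃ ^ 2 * t ^ 3 + 3 * a.l₃ * a.l₂ * t ^ 2 + a.l₂ ^ 2 * t)
      + (3 * a.act b.coeffs 3 * a.yHat t y
        - (3 * a.act b.coeffs 3 * t + a.act b.coeffs 2) * a.xHat t x)
      + (3 * a.act b.coeffs 3 * (a.act b.coeffs 3 * t ^ 3 + a.act b.coeffs 2 * t ^ 2
          + a.act b.coeffs 1 * t + a.act b.coeffs 0)
        - (3 * a.act b.coeffs 3 * t + a.act b.coeffs 2) * (3 * a.act b.coeffs 3 * t ^ 2
          + 2 * a.act b.coeffs 2 * t + a.act b.coeffs 1)) / 2 := by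
    simp only [xHat, yHat]; ring
  have hb' : 3 * b.l₃ * (Y - T * X) - b.l₂ * X
      - (3 * b.l₃ ^ 2 * T ^ 3 + 3 * b.l₃ * b.l₂ * T ^ 2 + b.l₂ ^ 2 * T)
      + (3 * b.l₃ * b.l₀ - b.l₂ * b.l₁) / 2
      = 3 * b.l₃ * Y - (3 * b.l₃ * T + b.l₂) * X
        + (3 * b.l₃ * (b.l₃ * T ^ 3 + b.l₂ * T ^ 2 + b.l₁ * T + b.l₀)
          - (3 * b.l₃ * T + b.l₂) * (3 * b.l₃ * T ^ 2 + 2 * b.l₂ * T + b.l₁)) / 2 := by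
    ring
  have c0 : b.coeffs 0 = b.l₀ := rfl
  have c1 : b.coeffs 1 = b.l₁ := rfl
  have c2 : b.coeffs 2 = b.l₂ := rfl
  have c3 : b.coeffs 3 = b.l₃ := rfl
  rw [c0, c1, c2, c3] at k0 k1 k2 k3
  simp only [cocycle]
  -- B0 and B1 are the value and the derivative of the cubic of `b` at T, B2 is half its second
  -- derivative and B3 its leading coefficient. K0, …, K3 are the same quantities at t for the
  -- transported cubic. The claim is an identity in these numbers alone.
  have main : ∀ K0 K1 K2 K3 B0 B1 B2 B3 D g xh yh : ℝ, D ≠ 0 → K0 = D ^ 3 * B0 →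
      K1 = 3 * g * D ^ 2 * B0 + D * B1 → K2 = 3 * g ^ 2 * D * B0 + 2 * g * B1 + B2 / D →
      K3 = g ^ 3 * B0 + g ^ 2 * B1 / D + g * B2 / D ^ 2 + B3 / D ^ 3 →
      3 * B3 * (yh / D ^ 3) - B2 * (xh / D - 3 * g * yh / D ^ 2) + (3 * B3 * B0 - B2 * B1) / 2
        - (g * (xh + K1) ^ 2 / D - 3 * g ^ 2 * (xh + K1) * (yh + K0) / D ^ 2
          + 3 * g ^ 3 * (yh + K0) ^ 2 / D ^ 3)
        + (g * xh ^ 2 / D - 3 * g ^ 2 * xh * yh / D ^ 2 + 3 * g ^ 3 * yh ^ 2 / D ^ 3)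
      = 3 * K3 * yh - K2 * xh + (3 * K3 * K0 - K2 * K1) / 2 := by
    rintro K0 K1 K2 K3 B0 B1 B2 B3 D g xh yh hD rfl rfl rfl rfl
    field_simp
    ring
  have := main _ _ _ _ _ _ _ _ _ _ (a.xHat t x) (a.yHat t y) ht k0 k1 k2 k3
  rw [← hX, ← hY] at this
  linear_combination this + hb' - hyx

theorem comp_multiplier (ht : a.den t ≠ 0) (x y : ℝ) (hb : b.den (a.baseMap (t, x, y)).1 ≠ 0) :
    (comp b a).multiplier (t, x, y)
      = b.multiplier (a.baseMap (t, x, y)) * a.multiplier (t, x, y) := by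
  have h := comp_exponent b a ht x y hb
  rw [multiplier_eq, multiplier_eq, multiplier_eq]
  have h1 := comp_den b a ht x y
  simp only
  rw [h1]
  have h2 : Real.exp ((comp b a).exponent (t, x, y)) * Real.exp (cocycle b a)
      = Real.exp (b.exponent (a.baseMap (t, x, y))) * Real.exp (a.exponent (t, x, y)) := by
    rw [← Real.exp_add, ← Real.exp_add, h]
  have h3 : (comp b a).σ = b.σ * a.σ * Real.exp (cocycle b a) := rfl
  rw [h3]
  linear_combination b.σ * a.σ * (a.den t * b.den (a.baseMap (t, x, y)).1) ^ 2 * h2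

/-- The parameters of the identity transformation. -/
def one : Params := ⟨1, 0, 0, 1, 0, 0, 0, 0, 1, by norm_num, one_ne_zero⟩

theorem one_den (t : ℝ) : one.den t = 1 := by simp [den, one]

theorem one_baseMap (p : Base) : one.baseMap p = p := by
  obtain ⟨t, x, y⟩ := p
  simp only [baseMap, one_den]
  simp [one, xHat, yHat]

theorem one_multiplier (p : Base) : one.multiplier p = 1 := by
  obtain ⟨t, x, y⟩ := p
  simp [multiplier, one_den]
  simp [one, xHat, yHat]

/-- The inverse of the linear fractional part. -/
def adj (a : Params) : Params :=
  ⟨a.δ, -a.β, -a.γ, a.α, 0, 0, 0, 0, 1, by linear_combination a.det_eq, one_ne_zero⟩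

/-- The parameters of the inverse transformation up to the constant `σ`. -/
def preInv (a : Params) : Params :=
  { a.adj with
    l₀ := -a.adj.act a.coeffs 0
    l₁ := -a.adj.act a.coeffs 1
    l₂ := -a.adj.act a.coeffs 2
    l₃ := -a.adj.act a.coeffs 3 }

/-- The parameters of the inverse transformation. -/
noncomputable def inv (a : Params) : Params :=
  { a.preInv with
    σ := (a.σ * Real.exp (cocycle a.preInv a))⁻¹
    σ_ne := inv_ne_zero (mul_ne_zero a.σ_ne (Real.exp_ne_zero _)) }

/-- `act` is the action of 2×2 matrices on binary cubic forms, so composing with the adjugate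
multiplies by the cube of the determinant. -/
theorem act_act_adj (l : Fin 4 → ℝ) : a.act (a.adj.act l) = l := by
  have key : ∀ i, a.act (a.adj.act l) i = (a.α * a.δ - a.β * a.γ) ^ 3 * l i := by
    intro i
    fin_cases i <;> simp [act, adj] <;> ring
  funext i
  rw [key, a.det_eq]; ring

theorem act_neg (l : Fin 4 → ℝ) (i : Fin 4) : a.act (-l) i = -a.act l i := by
  fin_cases i <;> simp [act] <;> ring

theorem coeffs_inv : a.inv.coeffs = -a.adj.act a.coeffs := by
  funext i
  fin_cases i <;> rfl

theorem act_inv (i : Fin 4) : a.act a.inv.coeffs i = -a.coeffs i := by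
  rw [coeffs_inv, act_neg, act_act_adj]

theorem comp_inv_self : comp a.inv a = one := by
  -- The cocycle does not involve σ, so it could be computed from `preInv` before the σ of the
  -- inverse was chosen to cancel it.
  have hc : cocycle a.inv a = cocycle a.preInv a := rfl
  have h : ∀ i, a.act a.inv.coeffs i = -a.coeffs i := a.act_inv
  have hd := a.det_eq
  simp only [comp, one, Params.mk.injEq, h, hc]
  have hs : a.inv.σ = (a.σ * Real.exp (cocycle a.preInv a))⁻¹ := rfl
  have e1 : a.inv.α = a.δ := rfl
  have e2 : a.inv.β = -a.β := rfl
  have e3 : a.inv.γ = -a.γ := rfl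
  have e4 : a.inv.δ = a.α := rfl
  rw [hs, e1, e2, e3, e4]
  refine ⟨by linarith, by ring, by ring, by linarith, ?_, ?_, ?_, ?_, ?_⟩
  · simp [coeffs]
  · simp [coeffs]
  · simp [coeffs]
  · simp [coeffs]
  · rw [mul_assoc]
    exact inv_mul_cancel₀ (mul_ne_zero a.σ_ne (Real.exp_ne_zero _))

theorem den_inv (ht : a.den t ≠ 0) (x y : ℝ) :
    a.den t * a.inv.den (a.baseMap (t, x, y)).1 = 1 := by
  rw [← comp_den a.inv a ht x y, comp_inv_self, one_den]

variable {a} in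
theorem den_inv_ne {p : Base} (hp : a.den p.1 ≠ 0) : a.inv.den (a.baseMap p).1 ≠ 0 := by
  obtain ⟨t, x, y⟩ := p
  intro h
  have := a.den_inv hp x y
  rw [h, mul_zero] at this
  exact zero_ne_one this

variable {a} in
theorem baseMap_inv_baseMap {p : Base} (hp : a.den p.1 ≠ 0) :
    a.inv.baseMap (a.baseMap p) = p := by
  obtain ⟨t, x, y⟩ := p
  rw [← comp_baseMap a.inv a hp x y (den_inv_ne hp), comp_inv_self, one_baseMap]

variable {a} in
theorem multiplier_inv_mul {p : Base} (hp : a.den p.1 ≠ 0) :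
    a.inv.multiplier (a.baseMap p) * a.multiplier p = 1 := by
  obtain ⟨t, x, y⟩ := p
  rw [← comp_multiplier a.inv a hp x y (den_inv_ne hp), comp_inv_self, one_multiplier]

/-- σ is left out because the base map does not depend on it. This suffices to turn left-inverse
statements for base maps into right-inverse ones. -/
theorem inv_inv_fields : a.inv.inv.α = a.α ∧ a.inv.inv.β = a.β ∧ a.inv.inv.γ = a.γ ∧
    a.inv.inv.δ = a.δ ∧ a.inv.inv.l₀ = a.l₀ ∧ a.inv.inv.l₁ = a.l₁ ∧ a.inv.inv.l₂ = a.l₂ ∧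
    a.inv.inv.l₃ = a.l₃ := by
  have hadj : ∀ l, a.inv.adj.act l = a.act l := by
    intro l; funext i
    have e : ∀ z : ℝ, - -z = z := neg_neg
    fin_cases i <;> simp [act, adj, inv, preInv]
  have h : ∀ i, a.inv.inv.coeffs i = a.coeffs i := by
    intro i
    rw [coeffs_inv, Pi.neg_apply, hadj, act_inv, neg_neg]
  exact ⟨rfl, neg_neg _, neg_neg _, rfl, h 0, h 1, h 2, h 3⟩

theorem inv_inv_den (t : ℝ) : a.inv.inv.den t = a.den t := by
  obtain ⟨-, -, h3, h4, -⟩ := a.inv_inv_fields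
  simp only [den, h3, h4]

theorem inv_inv_baseMap (p : Base) : a.inv.inv.baseMap p = a.baseMap p := by
  obtain ⟨h1, h2, h3, h4, h5, h6, h7, h8⟩ := a.inv_inv_fields
  obtain ⟨t, x, y⟩ := p
  simp only [baseMap, inv_inv_den, xHat, yHat, h1, h2, h3, h5, h6, h7, h8]

variable {a} in
theorem den_baseMap_inv_ne {q : Base} (hq : a.inv.den q.1 ≠ 0) :
    a.den (a.inv.baseMap q).1 ≠ 0 := by
  rw [← inv_inv_den]; exact den_inv_ne hq

variable {a} in
theorem baseMap_baseMap_inv {q : Base} (hq : a.inv.den q.1 ≠ 0) :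
    a.baseMap (a.inv.baseMap q) = q := by
  rw [← inv_inv_baseMap]; exact baseMap_inv_baseMap hq

end Params


/-! ### The group of transformations of the given form -/

/-- Restriction of the operator equation to a source set and to functions related by a
transformation. -/
theorem IsSolutionOn.of_intertwine (a : Params) {g k : Base → ℝ} {D D' : Set Base}
    (hD : IsOpen D) (hD' : IsOpen D') (hg : IsSolutionOn g D') (hk : ContDiffOn ℝ ∞ k D)
    (hmaps : ∀ p ∈ D, a.den p.1 ≠ 0 ∧ a.baseMap p ∈ D')
    (h : ∀ p ∈ D, g (a.baseMap p) = a.multiplier p * k p) : IsSolutionOn k D := by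
  rw [isSolutionOn_iff hD]
  rw [isSolutionOn_iff hD'] at hg
  refine ⟨hk, fun p hp => ?_⟩
  obtain ⟨h1, h2⟩ := hmaps p hp
  have := a.kolmogorovOp_baseMap h1 (hg.1.contDiffAt (hD'.mem_nhds h2))
    (hk.contDiffAt (hD.mem_nhds hp)) ((hD.eventually_mem hp).mono h)
  rw [hg.2 _ h2] at this
  exact (mul_eq_zero.mp this.symm).resolve_left
    (mul_ne_zero (pow_ne_zero 2 h1) (a.multiplier_ne_zero h1))

theorem IsSolutionOn.const_mul {f : Base → ℝ} {D : Set Base} (hD : IsOpen D)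
    (hf : IsSolutionOn f D) (c : ℝ) : IsSolutionOn (fun p => c * f p) D := by
  rw [isSolutionOn_iff hD] at hf ⊢
  exact ⟨contDiffOn_const.mul hf.1, fun p hp => by
    rw [kolmogorovOp_const_mul c (hf.1.contDiffAt (hD.mem_nhds hp)), hf.2 p hp, mul_zero]⟩

theorem IsSolutionOn.add {f g : Base → ℝ} {D : Set Base} (hD : IsOpen D)
    (hf : IsSolutionOn f D) (hg : IsSolutionOn g D) : IsSolutionOn (f + g) D := by
  rw [isSolutionOn_iff hD] at hf hg ⊢
  exact ⟨hf.1.add hg.1, fun p hp => by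
    rw [kolmogorovOp_add (hf.1.contDiffAt (hD.mem_nhds hp)) (hg.1.contDiffAt (hD.mem_nhds hp)),
      hf.2 p hp, hg.2 p hp, add_zero]⟩

theorem isSolutionOn_zero (D : Set Base) : IsSolutionOn 0 D :=
  ⟨contDiffOn_const, fun t x y _ => by simp⟩

/-! ### Inverse transformations and density of their domains -/

namespace Params

variable (a : Params)

theorem contDiffOn_baseMap {D : Set Base} (h : ∀ p ∈ D, a.den p.1 ≠ 0) :
    ContDiffOn ℝ ∞ a.baseMap D :=
  fun p hp => (a.contDiffAt_baseMap (h p hp)).contDiffWithinAt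

theorem contDiffOn_multiplier {D : Set Base} (h : ∀ p ∈ D, a.den p.1 ≠ 0) :
    ContDiffOn ℝ ∞ a.multiplier D :=
  fun p hp => (a.contDiffAt_multiplier (h p hp)).contDiffWithinAt

/-- The set of the points with nonzero `γt + δ` that are mapped into a given set. -/
def pullback (D : Set Base) : Set Base := {p | a.den p.1 ≠ 0 ∧ a.baseMap p ∈ D}

theorem isOpen_pullback {D : Set Base} (hD : IsOpen D) : IsOpen (a.pullback D) :=
  (a.contDiffOn_baseMap fun _ hp => hp).continuousOn.isOpen_inter_preimage a.isOpen_den_ne hD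

theorem isOpen_dom {D : Set Base} (hD : IsOpen D) : IsOpen (a.dom D) :=
  (hD.inter a.isOpen_den_ne).preimage continuous_fst

theorem contDiffOn_map {f : Base → ℝ} {D : Set Base} (hf : ContDiffOn ℝ ∞ f D) :
    ContDiffOn ℝ ∞ (a.map f) (a.dom D) := by
  have hfst : ContDiffOn ℝ ∞ (Prod.fst : Total → Base) (a.dom D) := contDiff_fst.contDiffOn
  refine ((a.contDiffOn_baseMap (D := {p | a.den p.1 ≠ 0}) fun _ hp => hp).comp hfst
    fun P hP => hP.2).prodMk (((a.contDiffOn_multiplier (D := {p | a.den p.1 ≠ 0})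
    fun _ hp => hp).comp hfst fun P hP => hP.2).mul
    (contDiff_snd.contDiffOn.add (hf.comp hfst fun P hP => hP.1)))

/-- The functional parameter of the inverse transformation. -/
noncomputable def invFun (f : Base → ℝ) : Base → ℝ := fun q =>
  -(a.multiplier (a.inv.baseMap q) * f (a.inv.baseMap q))

variable {a}

theorem map_map_inv {f : Base → ℝ} {P : Total} (hP : a.den P.1.1 ≠ 0) :
    a.inv.map (a.invFun f) (a.map f P) = P := by
  obtain ⟨p, u⟩ := P
  have h1 := baseMap_inv_baseMap hP
  have h2 := multiplier_inv_mul hP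
  simp only at h1 h2
  simp only [map, invFun, h1, Prod.mk.injEq, true_and]
  linear_combination u * h2

theorem map_inv_map {f : Base → ℝ} {Q : Total} (hQ : a.inv.den Q.1.1 ≠ 0) :
    a.map f (a.inv.map (a.invFun f) Q) = Q := by
  obtain ⟨q, u⟩ := Q
  have h1 := baseMap_baseMap_inv hQ
  have h2 := multiplier_inv_mul (den_baseMap_inv_ne hQ)
  rw [h1] at h2
  simp only at h1 h2
  simp only [map, invFun, h1, Prod.mk.injEq, true_and]
  linear_combination (u - a.multiplier (a.inv.baseMap q) * f (a.inv.baseMap q)) * h2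

theorem mem_dom_inv_pullback {D : Set Base} {f : Base → ℝ} {P : Total} (hP : P ∈ a.dom D) :
    a.map f P ∈ a.inv.dom (a.inv.pullback D) := by
  have := den_inv_ne hP.2
  exact ⟨⟨this, by simp only [map]; rw [baseMap_inv_baseMap hP.2]; exact hP.1⟩, this⟩

theorem mem_dom_of_inv {D : Set Base} {f : Base → ℝ} {Q : Total}
    (hQ : Q ∈ a.inv.dom (a.inv.pullback D)) : a.inv.map f Q ∈ a.dom D :=
  ⟨hQ.1.2, den_baseMap_inv_ne hQ.2⟩

theorem contDiffOn_invFun {f : Base → ℝ} {D : Set Base} (hf : ContDiffOn ℝ ∞ f D) :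
    ContDiffOn ℝ ∞ (a.invFun f) (a.inv.pullback D) := by
  have hB := a.inv.contDiffOn_baseMap (D := a.inv.pullback D) fun _ hp => hp.1
  exact (((a.contDiffOn_multiplier (D := {p | a.den p.1 ≠ 0}) fun _ hp => hp).comp hB
    fun q hq => den_baseMap_inv_ne hq.1).mul (hf.comp hB fun q hq => hq.2)).neg

theorem isSolutionOn_invFun {f : Base → ℝ} {D : Set Base} (hD : IsOpen D)
    (hf : IsSolutionOn f D) : IsSolutionOn (a.invFun f) (a.inv.pullback D) := by
  refine IsSolutionOn.of_intertwine a.inv (a.inv.isOpen_pullback hD) hD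
    (hf.const_mul hD (-1)) (contDiffOn_invFun hf.1) (fun p hp => hp) fun q hq => ?_
  have h2 := multiplier_inv_mul (den_baseMap_inv_ne hq.1)
  rw [baseMap_baseMap_inv hq.1] at h2
  simp only [invFun]
  linear_combination f (a.inv.baseMap q) * h2

variable (a)

/-- The transformation with constant parameters `a` and functional parameter `f` on `D`. -/
noncomputable def homeo (f : Base → ℝ) (D : Set Base) (hD : IsOpen D) (hf : ContDiffOn ℝ ∞ f D) :
    OpenPartialHomeomorph Total Total where
  toFun := a.map f
  invFun := a.inv.map (a.invFun f)
  source := a.dom D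
  target := a.inv.dom (a.inv.pullback D)
  map_source' _ hP := mem_dom_inv_pullback hP
  map_target' _ hQ := mem_dom_of_inv hQ
  left_inv' _ hP := map_map_inv hP.2
  right_inv' _ hQ := map_inv_map hQ.2
  open_source := a.isOpen_dom hD
  open_target := a.inv.isOpen_dom (a.inv.isOpen_pullback hD)
  continuousOn_toFun := (a.contDiffOn_map hf).continuousOn
  continuousOn_invFun := (a.inv.contDiffOn_map (contDiffOn_invFun hf)).continuousOn

theorem dense_den_ne : Dense {p : Base | a.den p.1 ≠ 0} := by
  have h : Dense {t : ℝ | a.den t ≠ 0} := by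
    have hfin : {t : ℝ | a.den t = 0}.Subsingleton := by
      intro t ht s hs
      by_contra hts
      have h1 : a.γ * t + a.δ = 0 := ht
      have h2 : a.γ * s + a.δ = 0 := hs
      have h3 : a.γ = 0 := by
        have : a.γ * (t - s) = 0 := by linear_combination h1 - h2
        exact (mul_eq_zero.mp this).resolve_right (sub_ne_zero.mpr hts)
      have h4 : a.δ = 0 := by rw [h3] at h1; linarith
      have := a.det_eq
      rw [h3, h4] at this
      norm_num at this
    exact hfin.finite.countable.dense_compl ℝ
  exact h.preimage isOpenMap_fst

variable {a} in
theorem dense_dom {D : Set Base} (hD : Dense D) : Dense (a.dom D) := by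
  have : Dense (D ∩ {p | a.den p.1 ≠ 0}) := hD.inter_of_isOpen_right a.dense_den_ne a.isOpen_den_ne
  exact this.preimage isOpenMap_fst

variable {a} in
theorem dense_pullback {D : Set Base} (hD : Dense D) : Dense (a.pullback D) := by
  refine dense_closure.mp (a.dense_den_ne.mono fun q hq => ?_)
  have hq' : a.inv.inv.den q.1 ≠ 0 := by rwa [inv_inv_den]
  have hp := den_inv_ne hq
  rw [mem_closure_iff]
  intro O hO hqO
  have hO' : IsOpen (a.inv.pullback O) := a.inv.isOpen_pullback hO
  obtain ⟨p, hp1, hp2⟩ := hD.inter_open_nonempty _ hO'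
    ⟨a.baseMap q, hp, by rwa [baseMap_inv_baseMap hq]⟩
  exact ⟨a.inv.baseMap p, hp1.2, den_baseMap_inv_ne hp1.1, by rwa [baseMap_baseMap_inv hp1.1]⟩

/-- The transformation with constant parameters `a` and functional parameter `f` with dense
domain. -/
noncomputable def diffeo (f : Base → ℝ) (D : Set Base) (hD : IsOpen D) (hf : ContDiffOn ℝ ∞ f D)
    (hDd : Dense D) : DenseDiffeo where
  toHomeo := a.homeo f D hD hf
  isPointTransformation := ⟨a.contDiffOn_map hf, a.inv.contDiffOn_map (contDiffOn_invFun hf)⟩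
  dense_source := dense_dom hDd
  dense_target := dense_dom (dense_pullback hDd)

theorem hasForm_homeo {f : Base → ℝ} {D : Set Base} (hD : IsOpen D) (hf : IsSolutionOn f D) :
    HasForm (a.homeo f D hD hf.1) :=
  ⟨a, D, f, hD, hf, rfl, fun _ _ => rfl⟩

theorem hasForm_homeo_symm {f : Base → ℝ} {D : Set Base} (hD : IsOpen D) (hf : IsSolutionOn f D) :
    HasForm (a.homeo f D hD hf.1).symm :=
  ⟨a.inv, a.inv.pullback D, a.invFun f, a.inv.isOpen_pullback hD, isSolutionOn_invFun hD hf, rfl,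
    fun _ _ => rfl⟩

end Params

/-- The functional parameter with dense domain of a transformation with dense domain. -/
theorem dense_of_dense_dom {a : Params} {D : Set Base} (h : Dense (a.dom D)) : Dense D := by
  have h1 : Dense (Prod.fst '' a.dom D) :=
    Prod.fst_surjective.denseRange.dense_image continuous_fst h
  exact h1.mono (by rintro _ ⟨P, hP, rfl⟩; exact hP.1)

/-- The composite has functional parameter f + (g∘B)/M with B, M taken from `a`; the second summand
is a solution by the intertwining relation. Shrinking E to E' makes the denominator of the
composite, a product of the two denominators, nonzero on S. -/
theorem hasForm_trans {Φ Ψ : OpenPartialHomeomorph Total Total} {a b : Params} {D E : Set Base}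
    {f g : Base → ℝ} (hD : IsOpen D) (hf : IsSolutionOn f D) (hΦ : Φ.source = a.dom D)
    (hΦe : EqOn Φ (a.map f) Φ.source) (hE : IsOpen E) (hg : IsSolutionOn g E)
    (hΨ : Ψ.source = b.dom E) (hΨe : EqOn Ψ (b.map g) Ψ.source) :
    ∃ (S : Set Base) (k : Base → ℝ), IsOpen S ∧ IsSolutionOn k S ∧
      (Φ.trans Ψ).source = (Params.comp b a).dom S ∧
      EqOn (Φ.trans Ψ) ((Params.comp b a).map k) (Φ.trans Ψ).source := by
  set E' : Set Base := E ∩ {p | b.den p.1 ≠ 0} with hE'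
  have hE'o : IsOpen E' := hE.inter b.isOpen_den_ne
  have hgE' : IsSolutionOn g E' := by
    rw [isSolutionOn_iff hE] at hg
    rw [isSolutionOn_iff hE'o]
    exact ⟨hg.1.mono inter_subset_left, fun p hp => hg.2 p hp.1⟩
  set S : Set Base := D ∩ a.pullback E' with hS
  have hSo : IsOpen S := hD.inter (a.isOpen_pullback hE'o)
  have hsrc : (Φ.trans Ψ).source = (Params.comp b a).dom S := by
    ext P
    rw [OpenPartialHomeomorph.trans_source, mem_inter_iff, mem_preimage]
    constructor
    · rintro ⟨hP, hP'⟩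
      rw [hΦe hP, hΨ] at hP'
      rw [hΦ] at hP
      refine ⟨⟨hP.1, hP.2, hP'.1, hP'.2⟩, ?_⟩
      rw [Params.comp_den b a hP.2 P.1.2.1 P.1.2.2]
      exact mul_ne_zero hP.2 hP'.2
    · rintro ⟨⟨h1, h2, h3, h4⟩, -⟩
      have hP : P ∈ Φ.source := by rw [hΦ]; exact ⟨h1, h2⟩
      refine ⟨hP, ?_⟩
      rw [hΦe hP, hΨ]
      exact ⟨h3, h4⟩
  have hk0 : IsSolutionOn (fun p => g (a.baseMap p) / a.multiplier p) S := by
    have hsm : ContDiffOn ℝ ∞ (fun p => g (a.baseMap p) / a.multiplier p) S :=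
      (hgE'.1.comp (a.contDiffOn_baseMap fun p hp => hp.2.1) fun p hp => hp.2.2).div
        (a.contDiffOn_multiplier fun p hp => hp.2.1) fun p hp => a.multiplier_ne_zero hp.2.1
    refine IsSolutionOn.of_intertwine a hSo hE'o hgE' hsm (fun p hp => hp.2) fun p hp => ?_
    have := a.multiplier_ne_zero hp.2.1
    field_simp
  have hfS : IsSolutionOn f S := by
    rw [isSolutionOn_iff hD] at hf
    rw [isSolutionOn_iff hSo]
    exact ⟨hf.1.mono inter_subset_left, fun p hp => hf.2 p hp.1⟩
  refine ⟨S, _, hSo, hfS.add hSo hk0, hsrc, fun P hP => ?_⟩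
  have hPS := hP
  rw [hsrc] at hPS
  rw [OpenPartialHomeomorph.trans_source] at hP
  obtain ⟨⟨h1, h2, h3, h4⟩, -⟩ := hPS
  obtain ⟨⟨t, x, y⟩, u⟩ := P
  have hM := a.multiplier_ne_zero h2
  change Ψ (Φ _) = _
  rw [hΨe hP.2, hΦe hP.1]
  simp only [Params.map]
  rw [Params.comp_baseMap b a h2 x y h4, Params.comp_multiplier b a h2 x y h4]
  simp only [Prod.mk.injEq, true_and, Pi.add_apply]
  simp only at hM
  field_simp
  ring

theorem HasForm.trans {Φ Ψ : OpenPartialHomeomorph Total Total} (hΦ : HasForm Φ)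
    (hΨ : HasForm Ψ) : HasForm (Φ.trans Ψ) := by
  obtain ⟨a, D, f, hD, hf, h1, h2⟩ := hΦ
  obtain ⟨b, E, g, hE, hg, h3, h4⟩ := hΨ
  obtain ⟨S, k, hS, hk, h5, h6⟩ := hasForm_trans hD hf h1 h2 hE hg h3 h4
  exact ⟨_, S, k, hS, hk, h5, h6⟩

theorem toClass_eq {Φ Ψ : DenseDiffeo} :
    Φ.toClass = Ψ.toClass ↔ EqOn Φ.toHomeo Ψ.toHomeo (Φ.toHomeo.source ∩ Ψ.toHomeo.source) :=
  Quotient.eq (r := DenseDiffeo.instSetoid)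

theorem toClass_mul (Φ Ψ : DenseDiffeo) : Ψ.toClass * Φ.toClass = (Φ.trans Ψ).toClass := rfl

theorem toClass_inv (Φ : DenseDiffeo) : Φ.toClass⁻¹ = Φ.symm.toClass := rfl

theorem toClass_one : DenseDiffeo.refl.toClass = 1 := rfl

/-- A transformation of the given form is in the class of a transformation constructed from
parameters. -/
theorem HasForm.exists_params {Φ : DenseDiffeo} (h : HasForm Φ.toHomeo) :
    ∃ (a : Params) (D : Set Base) (f : Base → ℝ) (hD : IsOpen D) (hf : IsSolutionOn f D)
      (hDd : Dense D), Φ.toClass = (a.diffeo f D hD hf.1 hDd).toClass := by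
  obtain ⟨a, D, f, hD, hf, h1, h2⟩ := h
  have hDd : Dense D := dense_of_dense_dom (h1 ▸ Φ.dense_source)
  exact ⟨a, D, f, hD, hf, hDd, toClass_eq.mpr fun P hP => h2 hP.1⟩

theorem hasForm_refl : HasForm DenseDiffeo.refl.toHomeo := by
  refine ⟨Params.one, univ, 0, isOpen_univ, isSolutionOn_zero _, ?_, fun P _ => ?_⟩
  · ext P
    simp [DenseDiffeo.refl, Params.mem_dom, Params.one_den]
  · simp [DenseDiffeo.refl, Params.map, Params.one_baseMap, Params.one_multiplier]

/-- The generating set is already a subgroup. For inverses, the representative is first replaced by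
the one built from parameters, whose inverse visibly has the required form. -/
theorem mem_pointSymmetryGroup {g : TransformationClass} :
    g ∈ pointSymmetryGroup ↔ ∃ Φ : DenseDiffeo, HasForm Φ.toHomeo ∧ g = Φ.toClass := by
  refine ⟨fun h => ?_, fun h => Subgroup.subset_closure h⟩
  induction h using Subgroup.closure_induction with
  | mem g hg => exact hg
  | one => exact ⟨DenseDiffeo.refl, hasForm_refl, rfl⟩
  | mul g h _ _ hg hh =>
    obtain ⟨Ψ, hΨ, rfl⟩ := hg
    obtain ⟨Φ, hΦ, rfl⟩ := hh
    exact ⟨Φ.trans Ψ, hΦ.trans hΨ, toClass_mul Φ Ψ⟩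
  | inv g _ hg =>
    obtain ⟨Φ, hΦ, rfl⟩ := hg
    obtain ⟨a, D, f, hD, hf, hDd, e⟩ := hΦ.exists_params
    rw [e, toClass_inv]
    exact ⟨_, a.hasForm_homeo_symm hD hf, rfl⟩


/-! ### The sign of a transformation -/

theorem Params.multiplier_pos_iff (a : Params) {p : Base} (hp : a.den p.1 ≠ 0) :
    0 < a.multiplier p ↔ 0 < a.σ := by
  rw [a.multiplier_eq, mul_pos_iff_of_pos_right (Real.exp_pos _),
    mul_pos_iff_of_pos_right (by positivity)]

/-- Equality of classes of transformations of the given form implies equality of signs. -/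
theorem sigma_pos_iff_of_toClass_eq {Φ Ψ : DenseDiffeo} (h : Φ.toClass = Ψ.toClass)
    {a b : Params} {D E : Set Base} {f g : Base → ℝ}
    (hΦ : Φ.toHomeo.source = a.dom D) (hΦe : EqOn Φ.toHomeo (a.map f) Φ.toHomeo.source)
    (hΨ : Ψ.toHomeo.source = b.dom E) (hΨe : EqOn Ψ.toHomeo (b.map g) Ψ.toHomeo.source) :
    0 < a.σ ↔ 0 < b.σ := by
  rw [toClass_eq] at h
  obtain ⟨⟨p, u⟩, hP⟩ := (Φ.dense_source.inter_of_isOpen_right Ψ.dense_source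
    Ψ.toHomeo.open_source).nonempty
  -- The domains are unions of full fibres, so the two maps agree on the whole fibre over p.
  -- Comparing increments in u then removes f and g and identifies the multipliers.
  have hall : ∀ v : ℝ, a.map f (p, v) = b.map g (p, v) := by
    intro v
    have h1 : (p, v) ∈ Φ.toHomeo.source := by
      have := hP.1; rw [hΦ] at this ⊢; exact this
    have h2 : (p, v) ∈ Ψ.toHomeo.source := by
      have := hP.2; rw [hΨ] at this ⊢; exact this
    rw [← hΦe h1, ← hΨe h2]
    exact h ⟨h1, h2⟩
  have h1 : a.den p.1 ≠ 0 := by have := hP.1; rw [hΦ] at this; exact this.2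
  have h2 : b.den p.1 ≠ 0 := by have := hP.2; rw [hΨ] at this; exact this.2
  have e0 := congrArg Prod.snd (hall 0)
  have e1 := congrArg Prod.snd (hall 1)
  simp only [Params.map] at e0 e1
  have : a.multiplier p = b.multiplier p := by linear_combination e1 - e0
  rw [← a.multiplier_pos_iff h1, ← b.multiplier_pos_iff h2, this]

theorem exists_params (g : pointSymmetryGroup) :
    ∃ (a : Params) (D : Set Base) (f : Base → ℝ) (hD : IsOpen D) (hf : IsSolutionOn f D)
      (hDd : Dense D), (g : TransformationClass) = (a.diffeo f D hD hf.1 hDd).toClass := by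
  obtain ⟨Φ, hΦ, h⟩ := mem_pointSymmetryGroup.mp g.2
  rw [h]
  exact hΦ.exists_params

/-- The element of the group with given parameters. -/
noncomputable def ofParams (a : Params) (f : Base → ℝ) {D : Set Base} (hD : IsOpen D)
    (hf : IsSolutionOn f D) (hDd : Dense D) : pointSymmetryGroup :=
  ⟨(a.diffeo f D hD hf.1 hDd).toClass,
    mem_pointSymmetryGroup.mpr ⟨_, a.hasForm_homeo hD hf, rfl⟩⟩

theorem exists_eq_ofParams (g : pointSymmetryGroup) :
    ∃ (a : Params) (D : Set Base) (f : Base → ℝ) (hD : IsOpen D) (hf : IsSolutionOn f D)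
      (hDd : Dense D), g = ofParams a f hD hf hDd := by
  obtain ⟨a, D, f, hD, hf, hDd, h⟩ := exists_params g
  exact ⟨a, D, f, hD, hf, hDd, Subtype.ext h⟩

/-- The transformation preserves the orientation of the `u`-axis. -/
def IsPositive (g : pointSymmetryGroup) : Prop := 0 < (exists_params g).choose.σ

/-- The choice of parameters in `IsPositive` is immaterial, since the sign of σ depends only on the
class. -/
theorem isPositive_ofParams {a : Params} {f : Base → ℝ} {D : Set Base} (hD : IsOpen D)
    (hf : IsSolutionOn f D) (hDd : Dense D) : IsPositive (ofParams a f hD hf hDd) ↔ 0 < a.σ := by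
  obtain ⟨D', f', hD', hf', hDd', h⟩ := (exists_params (ofParams a f hD hf hDd)).choose_spec
  exact sigma_pos_iff_of_toClass_eq h.symm rfl (fun _ _ => rfl) rfl (fun _ _ => rfl)

theorem isPositive_mul (g h : pointSymmetryGroup) :
    IsPositive (g * h) ↔ (IsPositive g ↔ IsPositive h) := by
  obtain ⟨b, E, k, hE, hk, hEd, rfl⟩ := exists_eq_ofParams g
  obtain ⟨a, D, f, hD, hf, hDd, rfl⟩ := exists_eq_ofParams h
  obtain ⟨S, m, hS, hm, h1, h2⟩ := hasForm_trans (Φ := a.homeo f D hD hf.1)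
    (Ψ := b.homeo k E hE hk.1) hD hf rfl (fun _ _ => rfl) hE hk rfl (fun _ _ => rfl)
  have e : ((ofParams b k hE hk hEd * ofParams a f hD hf hDd : pointSymmetryGroup) :
      TransformationClass)
      = ((a.diffeo f D hD hf.1 hDd).trans (b.diffeo k E hE hk.1 hEd)).toClass := rfl
  obtain ⟨c, D', f', hD', hf', hDd', h3⟩ :=
    exists_eq_ofParams (ofParams b k hE hk hEd * ofParams a f hD hf hDd)
  have h4 := congrArg Subtype.val h3
  rw [e] at h4
  have h5 := sigma_pos_iff_of_toClass_eq h4 h1 h2 rfl (fun _ _ => rfl)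
  rw [h3, isPositive_ofParams, ← h5, isPositive_ofParams, isPositive_ofParams]
  have h6 : (Params.comp b a).σ = b.σ * a.σ * Real.exp (Params.cocycle b a) := rfl
  rw [h6, mul_pos_iff_of_pos_right (Real.exp_pos _), mul_pos_iff]
  rcases lt_or_gt_of_ne b.σ_ne with hb | hb <;> rcases lt_or_gt_of_ne a.σ_ne with ha | ha <;>
    simp [ha, hb, ha.not_gt, hb.not_gt]

/-! ### The sign is constant along continuous curves -/

section Curve

variable {W : Set (ℝ × Total)} {F : ℝ × Total → Total} {a : Params} {D : Set Base} {f : Base → ℝ}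

theorem isOpen_slice (hW : IsOpen W) (s : ℝ) : IsOpen {P | (s, P) ∈ W} :=
  hW.preimage (Continuous.prodMk_right s)

theorem continuousOn_slice (hF : ContinuousOn F W) (s : ℝ) :
    ContinuousOn (fun P => F (s, P)) {P | (s, P) ∈ W} :=
  hF.comp (Continuous.prodMk_right s).continuousOn fun _ hP => hP

/-- Representation of slices of a continuous curve by parameters. -/
theorem slice_eq_map (hW : IsOpen W) (hF : ContinuousOn F W) {s : ℝ} (hD : IsOpen D)
    (hf : ContDiffOn ℝ ∞ f D) (hDd : Dense D) {Φ : DenseDiffeo}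
    (hΦ : Φ.toClass = (a.diffeo f D hD hf hDd).toClass)
    (h : ∀ P ∈ Φ.toHomeo.source, (s, P) ∈ W → F (s, P) = Φ.toHomeo P) {P : Total}
    (hP : P ∈ a.dom D) (hPW : (s, P) ∈ W) : F (s, P) = a.map f P := by
  rw [toClass_eq] at hΦ
  have hO : IsOpen ({P | (s, P) ∈ W} ∩ a.dom D) := (isOpen_slice hW s).inter (a.isOpen_dom hD)
  have hE : EqOn (fun P => F (s, P)) (a.map f) ({P | (s, P) ∈ W} ∩ a.dom D ∩ Φ.toHomeo.source) :=
    fun Q hQ => (h Q hQ.2 hQ.1.1).trans (hΦ ⟨hQ.2, hQ.1.2⟩)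
  exact hE.of_subset_closure ((continuousOn_slice hF s).mono inter_subset_left)
    ((a.contDiffOn_map hf).continuousOn.mono inter_subset_right) inter_subset_left
    (Φ.dense_source.open_subset_closure_inter hO) ⟨hPW, hP⟩

/-- The sign is determined by the increments of the `u`-component. -/
theorem sigma_pos_of_increment (hW : IsOpen W) (hF : ContinuousOn F W) {s : ℝ} (hDd : Dense D)
    (h : ∀ P ∈ a.dom D, (s, P) ∈ W → F (s, P) = a.map f P) {p : Base} {u v : ℝ}
    (huv : u < v) (hu : (s, (p, u)) ∈ W) (hv : (s, (p, v)) ∈ W) {c : ℝ}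
    (hpos : 0 < c * ((F (s, (p, v))).2 - (F (s, (p, u))).2)) : 0 < c * a.σ := by
  have key : ∀ w : ℝ, (s, (p, w)) ∈ W → (∀ᶠ q in 𝓝 p, (s, (q, w)) ∈ W) ∧
      ContinuousAt (fun q => (F (s, (q, w))).2) p := by
    intro w hw
    have hc : ContinuousAt (fun q : Base => (s, (q, w))) p := by fun_prop
    exact ⟨hc.eventually (hW.mem_nhds hw), continuous_snd.continuousAt.comp
      (ContinuousAt.comp (f := fun q : Base => (s, (q, w)))
        (hF.continuousAt (hW.mem_nhds hw)) hc)⟩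
  obtain ⟨hu1, hu2⟩ := key u hu
  obtain ⟨hv1, hv2⟩ := key v hv
  have hev := ((continuousAt_const (y := c)).mul (hv2.sub hu2)).eventually (lt_mem_nhds hpos)
  have hd : Dense (D ∩ {q | a.den q.1 ≠ 0}) :=
    hDd.inter_of_isOpen_right a.dense_den_ne a.isOpen_den_ne
  -- The point p may lie outside the domain for these parameters. By density and continuity it is
  -- replaced by a nearby q inside, where the increment is the multiplier times v − u.
  obtain ⟨q, hq, hq1, hq2, hq3⟩ := ((mem_closure_iff_frequently.mp (hd p)).and_eventually
    (hu1.and (hv1.and hev))).exists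
  have e1 := h (q, u) hq hq1
  have e2 := h (q, v) hq hq2
  simp only [Pi.mul_apply, Pi.sub_apply, e1, e2, Params.map] at hq3
  have hq4 : 0 < c * a.multiplier q * (v - u) := by
    calc 0 < _ := hq3
      _ = _ := by ring
  have hq5 := pos_of_mul_pos_left hq4 (sub_pos.mpr huv).le
  rw [a.multiplier_eq] at hq5
  have hden : 0 < a.den q.1 ^ 2 * Real.exp (a.exponent q) :=
    mul_pos (sq_pos_iff.mpr hq.2) (Real.exp_pos _)
  exact pos_of_mul_pos_left (b := a.den q.1 ^ 2 * Real.exp (a.exponent q))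
    (by calc 0 < _ := hq5
          _ = _ := by ring) hden.le

end Curve

/-- Two points (p, u), (p, v) of one fibre are fixed in the slice at s₀. The difference of the
u-components of their images is nonzero at s₀ and continuous in s, and for each nearby s its sign
determines the sign of σ there. -/
theorem eventually_isPositive_iff {c : ℝ → pointSymmetryGroup}
    (hc : IsContinuousCurve (fun s => (c s : TransformationClass))) (s₀ : ℝ) :
    ∀ᶠ s in 𝓝 s₀, IsPositive (c s) ↔ IsPositive (c s₀) := by
  obtain ⟨W, F, hW, hF, hs⟩ := hc
  have rep : ∀ s, ∃ (a : Params) (D : Set Base) (f : Base → ℝ), IsOpen D ∧ Dense D ∧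
      (IsPositive (c s) ↔ 0 < a.σ) ∧ ∀ P ∈ a.dom D, (s, P) ∈ W → F (s, P) = a.map f P := by
    intro s
    obtain ⟨-, Φ, hΦ, h⟩ := hs s
    obtain ⟨a, D, f, hD, hf, hDd, he⟩ := exists_eq_ofParams (c s)
    refine ⟨a, D, f, hD, hDd, by rw [he, isPositive_ofParams], fun P hP hPW => ?_⟩
    exact slice_eq_map hW hF hD hf.1 hDd (hΦ.trans (congrArg Subtype.val he)) h hP hPW
  obtain ⟨a, D, f, hD, hDd, hpos, hmap⟩ := rep s₀
  obtain ⟨⟨p, u⟩, hP1, hP2⟩ := ((hs s₀).1.inter_of_isOpen_right (Params.dense_dom (a := a) hDd)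
    (a.isOpen_dom hD)).nonempty
  have hev : ∀ᶠ v in 𝓝[>] u, (s₀, (p, v)) ∈ W := by
    have hcont : ContinuousAt (fun v : ℝ => (s₀, (p, v))) u := by fun_prop
    exact (hcont.eventually (hW.mem_nhds hP1)).filter_mono nhdsWithin_le_nhds
  obtain ⟨v, hv, huv⟩ := (hev.and self_mem_nhdsWithin).exists
  have huv' : u < v := huv
  have e1 := hmap (p, u) hP2 hP1
  have e2 := hmap (p, v) hP2 hv
  have key : ∀ w : ℝ, (s₀, (p, w)) ∈ W → (∀ᶠ s in 𝓝 s₀, (s, (p, w)) ∈ W) ∧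
      ContinuousAt (fun s => (F (s, (p, w))).2) s₀ := by
    intro w hw
    have hc : ContinuousAt (fun s : ℝ => (s, (p, w))) s₀ := by fun_prop
    exact ⟨hc.eventually (hW.mem_nhds hw), continuous_snd.continuousAt.comp
      (ContinuousAt.comp (f := fun s : ℝ => (s, (p, w)))
        (hF.continuousAt (hW.mem_nhds hw)) hc)⟩
  obtain ⟨hu1, hu2⟩ := key u hP1
  obtain ⟨hv1, hv2⟩ := key v hv
  have hσ : 0 < a.σ * ((F (s₀, (p, v))).2 - (F (s₀, (p, u))).2) := by
    rw [e1, e2]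
    have hden : 0 < a.σ ^ 2 * a.den p.1 ^ 2 * Real.exp (a.exponent p) * (v - u) :=
      mul_pos (mul_pos (mul_pos (sq_pos_iff.mpr a.σ_ne) (sq_pos_iff.mpr hP2.2))
        (Real.exp_pos _)) (sub_pos.mpr huv')
    simp only [Params.map, a.multiplier_eq]
    calc 0 < _ := hden
      _ = _ := by ring
  have hev2 := ((continuousAt_const (y := a.σ)).mul (hv2.sub hu2)).eventually (lt_mem_nhds hσ)
  filter_upwards [hu1, hv1, hev2] with s h1 h2 h3
  obtain ⟨b, E, g, -, hEd, hpos', hmap'⟩ := rep s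
  have := sigma_pos_of_increment hW hF hEd hmap' huv' h1 h2 h3
  rw [hpos, hpos']
  constructor
  · intro hb; exact pos_of_mul_pos_left this hb.le
  · intro ha; exact pos_of_mul_pos_right this ha.le

/-- Openness in this topology is tested along continuous curves only, and along these the sign is
locally constant. -/
theorem isClopen_isPositive : IsClopen {g : pointSymmetryGroup | IsPositive g} := by
  constructor
  · rw [← isOpen_compl_iff]
    intro c hc
    rw [isOpen_iff_mem_nhds]
    intro s hs
    filter_upwards [eventually_isPositive_iff hc s] with r hr
    exact fun h => hs (hr.mp h)
  · intro c hc
    rw [isOpen_iff_mem_nhds]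
    intro s hs
    filter_upwards [eventually_isPositive_iff hc s] with r hr
    exact hr.mpr hs


/-! ### Paths to the identity -/

namespace Params

/-- The path of second rows of matrices: `δ + iγ` is moved along its one-parameter group. -/
noncomputable def rowPath (a : Params) (s : ℝ) : ℂ := Complex.exp (s * Complex.log ⟨a.δ, a.γ⟩)

theorem normSq_rowPath_ne (a : Params) (s : ℝ) :
    (a.rowPath s).re ^ 2 + (a.rowPath s).im ^ 2 ≠ 0 := by
  have : Complex.normSq (a.rowPath s) ≠ 0 := by
    rw [Ne, Complex.normSq_eq_zero]; exact Complex.exp_ne_zero _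
  rw [Complex.normSq_apply] at this
  rwa [sq, sq]

/-- The upper triangular part of the linear fractional transformation. -/
noncomputable def shear (a : Params) : ℝ := (a.α * a.γ + a.β * a.δ) / (a.δ ^ 2 + a.γ ^ 2)

/-- A path of parameters joining the identity with a transformation with positive sign. -/
noncomputable def path (a : Params) (s : ℝ) : Params where
  α := (a.rowPath s).re / ((a.rowPath s).re ^ 2 + (a.rowPath s).im ^ 2)
    + s * a.shear * (a.rowPath s).im
  β := -(a.rowPath s).im / ((a.rowPath s).re ^ 2 + (a.rowPath s).im ^ 2)
    + s * a.shear * (a.rowPath s).re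
  γ := (a.rowPath s).im
  δ := (a.rowPath s).re
  l₀ := s * a.l₀
  l₁ := s * a.l₁
  l₂ := s * a.l₂
  l₃ := s * a.l₃
  σ := Real.exp (s * Real.log a.σ)
  det_eq := by
    have := a.normSq_rowPath_ne s
    field_simp
    ring
  σ_ne := Real.exp_ne_zero _

theorem path_zero (a : Params) : a.path 0 = one := by
  simp [path, rowPath, one]

theorem path_one (a : Params) (ha : 0 < a.σ) : a.path 1 = a := by
  have hd := a.det_eq
  have hz : (⟨a.δ, a.γ⟩ : ℂ) ≠ 0 := by
    intro h
    have h1 : a.δ = 0 := congrArg Complex.re h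
    have h2 : a.γ = 0 := congrArg Complex.im h
    rw [h1, h2] at hd
    norm_num at hd
  have hr : a.rowPath 1 = ⟨a.δ, a.γ⟩ := by simp [rowPath, Complex.exp_log hz]
  have hn := a.normSq_rowPath_ne 1
  rw [hr] at hn
  simp only at hn
  -- With second row (γ, δ) and determinant 1, the first row is (δ, −γ)/(γ²+δ²) plus a multiple of
  -- (γ, δ); that multiple is `shear`.
  have e1 : a.δ / (a.δ ^ 2 + a.γ ^ 2) + a.shear * a.γ = a.α := by
    rw [shear]; field_simp; linear_combination -a.δ * hd
  have e2 : -a.γ / (a.δ ^ 2 + a.γ ^ 2) + a.shear * a.δ = a.β := by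
    rw [shear]; field_simp; linear_combination a.γ * hd
  have e3 : Real.exp (1 * Real.log a.σ) = a.σ := by rw [one_mul, Real.exp_log ha]
  cases a
  simp only [path, hr, one_mul, mk.injEq] at e1 e2 e3 ⊢
  exact ⟨e1, e2, trivial, trivial, trivial, trivial, trivial, trivial, e3⟩

theorem continuous_rowPath (a : Params) : Continuous a.rowPath := by
  unfold rowPath; fun_prop

theorem continuous_path_α (a : Params) : Continuous fun s => (a.path s).α := by
  have h := a.continuous_rowPath
  exact ((Complex.continuous_re.comp h).div (((Complex.continuous_re.comp h).pow 2).add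
    ((Complex.continuous_im.comp h).pow 2)) a.normSq_rowPath_ne).add
    ((continuous_id.mul continuous_const).mul (Complex.continuous_im.comp h))

theorem continuous_path_β (a : Params) : Continuous fun s => (a.path s).β := by
  have h := a.continuous_rowPath
  exact ((Complex.continuous_im.comp h).neg.div (((Complex.continuous_re.comp h).pow 2).add
    ((Complex.continuous_im.comp h).pow 2)) a.normSq_rowPath_ne).add
    ((continuous_id.mul continuous_const).mul (Complex.continuous_re.comp h))

theorem continuous_path_γ (a : Params) : Continuous fun s => (a.path s).γ :=
  Complex.continuous_im.comp a.continuous_rowPath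

theorem continuous_path_δ (a : Params) : Continuous fun s => (a.path s).δ :=
  Complex.continuous_re.comp a.continuous_rowPath

theorem continuous_path_den (a : Params) :
    Continuous fun z : ℝ × Total => (a.path z.1).den z.2.1.1 := by
  have ht : Continuous fun z : ℝ × Total => z.2.1.1 := by fun_prop
  exact ((a.continuous_path_γ.comp continuous_fst).mul ht).add
    (a.continuous_path_δ.comp continuous_fst)

theorem continuousOn_path_map (a : Params) {f : Base → ℝ} {D : Set Base}
    (hf : ContinuousOn f D) :
    ContinuousOn (fun z : ℝ × Total => (a.path z.1).map (fun p => z.1 * f p) z.2)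
      {z | z.2 ∈ (a.path z.1).dom D} := by
  set W : Set (ℝ × Total) := {z | z.2 ∈ (a.path z.1).dom D}
  have hα := a.continuous_path_α
  have hβ := a.continuous_path_β
  have hγ := a.continuous_path_γ
  have hσ : Continuous fun s => (a.path s).σ := by simp only [path]; fun_prop
  have hd : ContinuousOn (fun z : ℝ × Total => (a.path z.1).den z.2.1.1) W :=
    a.continuous_path_den.continuousOn
  have hx : ContinuousOn (fun z : ℝ × Total => (a.path z.1).xHat z.2.1.1 z.2.1.2.1) W := by
    simp only [xHat, path]; fun_prop
  have hy : ContinuousOn (fun z : ℝ × Total => (a.path z.1).yHat z.2.1.1 z.2.1.2.2) W := by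
    simp only [yHat, path]; fun_prop
  have hγ' : ContinuousOn (fun z : ℝ × Total => (a.path z.1).γ) W :=
    (hγ.comp continuous_fst).continuousOn
  have hσ' : ContinuousOn (fun z : ℝ × Total => (a.path z.1).σ) W :=
    (hσ.comp continuous_fst).continuousOn
  have hne : ∀ z ∈ W, (a.path z.1).den z.2.1.1 ≠ 0 := fun z hz => hz.2
  have hne' : ∀ n : ℕ, ∀ z ∈ W, (a.path z.1).den z.2.1.1 ^ n ≠ 0 :=
    fun n z hz => pow_ne_zero n hz.2
  have hB : ContinuousOn (fun z : ℝ × Total => (a.path z.1).baseMap z.2.1) W := by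
    refine ContinuousOn.prodMk ?_ (ContinuousOn.prodMk ?_ ?_)
    · have ht : Continuous fun z : ℝ × Total => z.2.1.1 := by fun_prop
      exact (((hα.comp continuous_fst).mul ht).add (hβ.comp continuous_fst)).continuousOn.div hd hne
    · exact (hx.div hd hne).sub (((continuousOn_const.mul hγ').mul hy).div (hd.pow 2) (hne' 2))
    · exact hy.div (hd.pow 3) (hne' 3)
  have hM : ContinuousOn (fun z : ℝ × Total => (a.path z.1).multiplier z.2.1) W := by
    refine ((hσ'.mul (hd.pow 2)).mul (Real.continuous_exp.comp_continuousOn ?_)).mul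
      (Real.continuous_exp.comp_continuousOn ?_)
    · exact (((hγ'.mul (hx.pow 2)).div hd hne).sub ((((continuousOn_const.mul (hγ'.pow 2)).mul
        hx).mul hy).div (hd.pow 2) (hne' 2))).add (((continuousOn_const.mul (hγ'.pow 3)).mul
        (hy.pow 2)).div (hd.pow 3) (hne' 3))
    · simp only [path]
      fun_prop
  have hf' : ContinuousOn (fun z : ℝ × Total => f z.2.1) W :=
    hf.comp (by fun_prop) fun z hz => hz.1
  exact hB.prodMk (hM.mul ((by fun_prop : Continuous fun z : ℝ × Total => z.2.2).continuousOn.add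
    (continuous_fst.continuousOn.mul hf')))

end Params

theorem continuous_of_isContinuousCurve {c : ℝ → pointSymmetryGroup}
    (hc : IsContinuousCurve (fun s => (c s : TransformationClass))) : Continuous c :=
  continuous_def.mpr fun _ hU => hU c hc

/-- The curve uses the constants `a.path s` and the function s·f on the fixed dense set D, so every
slice is dense. It runs from the identity at s = 0 to g at s = 1. -/
theorem mem_connectedComponent_of_isPositive {g : pointSymmetryGroup} (hg : IsPositive g) :
    g ∈ connectedComponent (1 : pointSymmetryGroup) := by
  obtain ⟨a, D, f, hD, hf, hDd, rfl⟩ := exists_eq_ofParams g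
  rw [isPositive_ofParams] at hg
  let c : ℝ → pointSymmetryGroup := fun s => ofParams (a.path s) (fun p => s * f p) hD
    (hf.const_mul hD s) hDd
  have hc : IsContinuousCurve (fun s => (c s : TransformationClass)) := by
    refine ⟨{z | z.2 ∈ (a.path z.1).dom D}, _, ?_, a.continuousOn_path_map hf.1.continuousOn, ?_⟩
    · exact (hD.preimage (by fun_prop : Continuous fun z : ℝ × Total => z.2.1)).inter
        (isOpen_ne.preimage a.continuous_path_den)
    · intro s
      exact ⟨Params.dense_dom (a := a.path s) hDd, _, rfl, fun _ _ _ => rfl⟩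
  have hcont := continuous_of_isContinuousCurve hc
  have h0 : c 0 = 1 := by
    refine Subtype.ext (toClass_eq.mpr fun P _ => ?_)
    change (a.path 0).map (fun p => 0 * f p) P = P
    rw [Params.path_zero]
    simp [Params.map, Params.one_baseMap, Params.one_multiplier]
  have h1 : c 1 = ofParams a f hD hf hDd := by
    refine Subtype.ext (toClass_eq.mpr fun P _ => ?_)
    change (a.path 1).map (fun p => 1 * f p) P = a.map f P
    rw [Params.path_one a hg]
    simp
  exact (isPreconnected_range hcont).subset_connectedComponent ⟨0, h0⟩ ⟨1, h1⟩

theorem isPositive_one : IsPositive 1 := by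
  have := isPositive_mul 1 1
  rw [mul_one] at this
  tauto

theorem connectedComponent_one :
    connectedComponent (1 : pointSymmetryGroup) = {g | IsPositive g} :=
  Subset.antisymm (isClopen_isPositive.connectedComponent_subset isPositive_one)
    fun _ hg => mem_connectedComponent_of_isPositive hg

/-- The parameters of the change of the sign of `u`. -/
noncomputable def Params.neg : Params := { Params.one with σ := -1, σ_ne := by norm_num }

/-- The change of the sign of `u` as an element of the group. -/
noncomputable def signChangeElement : pointSymmetryGroup :=
  ofParams Params.neg 0 isOpen_univ (isSolutionOn_zero univ) dense_univ

theorem coe_signChangeElement :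
    (signChangeElement : TransformationClass) = signChange.toClass := by
  refine toClass_eq.mpr fun P _ => ?_
  have hB : ∀ p, Params.neg.baseMap p = p := Params.one_baseMap
  have hM : Params.neg.multiplier P.1 = -1 := by
    have h := Params.one_multiplier P.1
    rw [Params.multiplier_eq] at h ⊢
    have h1 : Params.neg.σ = -Params.one.σ := rfl
    rw [h1, neg_mul, neg_mul]
    exact congrArg Neg.neg h
  change (Params.neg.baseMap P.1, Params.neg.multiplier P.1 * (P.2 + 0)) = (P.1, -P.2)
  rw [hB, hM, add_zero, neg_one_mul]

theorem signChangeElement_mul_self : signChangeElement * signChangeElement = 1 := by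
  refine Subtype.ext ?_
  rw [Subgroup.coe_mul, coe_signChangeElement, toClass_mul, Subgroup.coe_one, ← toClass_one]
  exact toClass_eq.mpr fun P _ => Prod.ext rfl (neg_neg P.2)

theorem not_isPositive_signChangeElement : ¬ IsPositive signChangeElement := by
  rw [signChangeElement, isPositive_ofParams]
  simp [Params.neg]

open Classical in
/-- The sign as a homomorphism. -/
noncomputable def signHom : pointSymmetryGroup →* Multiplicative (ZMod 2) where
  toFun g := if IsPositive g then 1 else Multiplicative.ofAdd 1
  map_one' := if_pos isPositive_one
  map_mul' g h := by
    have h2 : (Multiplicative.ofAdd (1 : ZMod 2)) * Multiplicative.ofAdd (1 : ZMod 2) = 1 := by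
      decide
    by_cases hg : IsPositive g <;> by_cases hh : IsPositive h <;>
      simp [isPositive_mul, hg, hh, h2]

theorem mem_ker_signHom {g : pointSymmetryGroup} : g ∈ signHom.ker ↔ IsPositive g := by
  classical
  rw [MonoidHom.mem_ker]
  change (if IsPositive g then 1 else Multiplicative.ofAdd (1 : ZMod 2)) = 1 ↔ _
  split_ifs with h
  · simp [h]
  · simp [h]

theorem signHom_surjective : Function.Surjective signHom := by
  classical
  intro z
  have hz : z = 1 ∨ z = Multiplicative.ofAdd (1 : ZMod 2) := by
    revert z; decide
  rcases hz with rfl | rfl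
  · exact ⟨1, map_one _⟩
  · exact ⟨signChangeElement, if_neg not_isPositive_signChangeElement⟩

theorem exists_signChange :
    ∃ J : pointSymmetryGroup, (J : TransformationClass) = signChange.toClass ∧ J * J = 1 ∧
      J ∉ connectedComponent (1 : pointSymmetryGroup) ∧
      ∀ g : pointSymmetryGroup, g ∉ connectedComponent (1 : pointSymmetryGroup) →
        ∃ h ∈ connectedComponent (1 : pointSymmetryGroup), g = J * h := by
  rw [connectedComponent_one]
  refine ⟨signChangeElement, coe_signChangeElement, signChangeElement_mul_self,
    not_isPositive_signChangeElement, fun g hg => ⟨signChangeElement * g, ?_, ?_⟩⟩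
  · exact (isPositive_mul _ _).mpr (iff_of_false not_isPositive_signChangeElement hg)
  · rw [← mul_assoc, signChangeElement_mul_self, one_mul]

theorem exists_identity_component :
    ∃ (N : Subgroup pointSymmetryGroup) (_ : N.Normal),
      (N : Set pointSymmetryGroup) = connectedComponent (1 : pointSymmetryGroup) ∧
      Nonempty ((pointSymmetryGroup ⧸ N) ≃* Multiplicative (ZMod 2)) := by
  refine ⟨signHom.ker, inferInstance, ?_,
    ⟨QuotientGroup.quotientKerEquivOfSurjective _ signHom_surjective⟩⟩
  rw [connectedComponent_one]
  ext g
  exact mem_ker_signHom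


/-! ### Images of graphs of solutions -/

/-- The base component of the image of the graph of `f`. -/
def baseImage (Φ : Total → Total) (f : Base → ℝ) (q : Base) : Base := (Φ (q, f q)).1

section Image

variable {Φ : OpenPartialHomeomorph Total Total} {f : Base → ℝ} {p : Base}

theorem contDiffAt_graph_image (hΦ : ContDiffOn ℝ ∞ Φ Φ.source) (hf : ContDiff ℝ ∞ f)
    (hp : (p, f p) ∈ Φ.source) : ContDiffAt ℝ ∞ (fun q => Φ (q, f q)) p :=
  ContDiffAt.comp (g := Φ) (f := fun q => (q, f q)) p
    (hΦ.contDiffAt (Φ.open_source.mem_nhds hp)) (contDiffAt_id.prodMk hf.contDiffAt)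

theorem contDiffAt_baseImage (hΦ : ContDiffOn ℝ ∞ Φ Φ.source) (hf : ContDiff ℝ ∞ f)
    (hp : (p, f p) ∈ Φ.source) : ContDiffAt ℝ ∞ (baseImage Φ f) p :=
  (contDiffAt_graph_image hΦ hf hp).fst

/-- A point symmetry maps the graph of a solution, transversally to the fibres, onto the graph of
a solution. -/
theorem IsPointSymmetry.exists_image_solution (hΦ : IsPointSymmetry Φ) (hf : ContDiff ℝ ∞ f)
    (hsol : ∀ q, kolmogorovOp f q = 0) (hp : (p, f p) ∈ Φ.source)
    (hinj : Function.Injective (fderiv ℝ (baseImage Φ f) p)) :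
    ∃ (g : Base → ℝ) (r : Base → Base), ContDiffAt ℝ ∞ r (baseImage Φ f p) ∧
      r (baseImage Φ f p) = p ∧
      (∀ᶠ q in 𝓝 (baseImage Φ f p), ContDiffAt ℝ ∞ g q ∧ kolmogorovOp g q = 0 ∧
        (r q, f (r q)) ∈ Φ.source ∧ Φ (r q, f (r q)) = (q, g q)) ∧
      ∀ᶠ q in 𝓝 p, g (baseImage Φ f q) = (Φ (q, f q)).2 := by
  obtain ⟨⟨hΦ1, hΦ2⟩, hsym⟩ := hΦ
  have hb := contDiffAt_baseImage hΦ1 hf hp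
  let e : Base ≃L[ℝ] Base := (LinearEquiv.ofInjectiveEndo
    (fderiv ℝ (baseImage Φ f) p : Base →ₗ[ℝ] Base) hinj).toContinuousLinearEquiv
  have he : (e : Base →L[ℝ] Base) = fderiv ℝ (baseImage Φ f) p := by
    exact ContinuousLinearMap.ext fun v => rfl
  have hb' : HasFDerivAt (baseImage Φ f) (e : Base →L[ℝ] Base) p := by
    rw [he]; exact (differentiableAt_of_contDiffAt hb).hasFDerivAt
  let h := hb.toOpenPartialHomeomorph (baseImage Φ f) hb' (by simp)
  have hcoe : ∀ q, h q = baseImage Φ f q := fun _ => rfl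
  have hph : p ∈ h.source := hb.mem_toOpenPartialHomeomorph_source hb' (by simp)
  have hgr : ContinuousAt (fun q => (q, f q)) p :=
    continuousAt_id.prodMk hf.continuous.continuousAt
  -- Invertible operators form an open set, so the differential stays invertible near p. This gives
  -- smoothness of the local inverse on all of D', not only at one point.
  have hev : ∀ᶠ q in 𝓝 p, q ∈ h.source ∧ (q, f q) ∈ Φ.source ∧
      fderiv ℝ (baseImage Φ f) q ∈ range ((↑) : (Base ≃L[ℝ] Base) → Base →L[ℝ] Base) := by
    refine (h.open_source.eventually_mem hph).and
      ((hgr.eventually (Φ.open_source.mem_nhds hp)).and ?_)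
    have hcont : ContinuousAt (fderiv ℝ (baseImage Φ f)) p :=
      (hb.fderiv_right (m := 0) (by simp)).continuousAt
    refine hcont.eventually ?_
    rw [← he]
    exact ContinuousLinearEquiv.nhds e
  obtain ⟨D, hDsub, hD, hpD⟩ := mem_nhds_iff.mp hev
  set D' : Set Base := h '' D with hD'def
  have hDh : D ⊆ h.source := fun q hq => (hDsub hq).1
  have hD' : IsOpen D' := h.isOpen_image_of_subset_source hD hDh
  have hr : ∀ q ∈ D', h.symm q ∈ D ∧ h (h.symm q) = q := by
    rintro _ ⟨q, hq, rfl⟩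
    rw [h.left_inv (hDh hq)]
    exact ⟨hq, rfl⟩
  have hrs : ∀ q ∈ D', ContDiffAt ℝ ∞ h.symm q := by
    intro q hq
    obtain ⟨h1, h2⟩ := hr q hq
    obtain ⟨-, h3, e', he'⟩ := hDsub h1
    have h4 := contDiffAt_baseImage hΦ1 hf h3
    refine h.contDiffAt_symm (f₀' := e') ?_ ?_ h4
    · rw [← h2]; exact h.map_source (hDh h1)
    · rw [he']; exact (differentiableAt_of_contDiffAt h4).hasFDerivAt
  let g : Base → ℝ := fun q => (Φ (h.symm q, f (h.symm q))).2
  have hgs : ContDiffOn ℝ ∞ g D' := by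
    intro q hq
    refine ContDiffAt.contDiffWithinAt ?_
    have := contDiffAt_graph_image hΦ1 hf (hDsub (hr q hq).1).2.1
    exact (ContDiffAt.comp (g := fun q => Φ (q, f q)) q this (hrs q hq)).snd
  have himg : ∀ q ∈ D', Φ (h.symm q, f (h.symm q)) = (q, g q) := fun q hq =>
    Prod.ext (hr q hq).2 rfl
  have hsolg : IsSolutionOn g D' := by
    refine (hsym D D' f g hD hD' hf.contDiffOn hgs ?_ ?_).mp
      ((isSolutionOn_iff hD).mpr ⟨hf.contDiffOn, fun q _ => hsol q⟩)
    · rintro _ ⟨q, hq, rfl⟩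
      exact (hDsub hq).2.1
    · apply Subset.antisymm
      · rintro _ ⟨_, ⟨q, hq, rfl⟩, rfl⟩
        refine ⟨h q, ⟨q, hq, rfl⟩, ?_⟩
        have := himg (h q) ⟨q, hq, rfl⟩
        rw [h.left_inv (hDh hq)] at this
        exact this.symm
      · rintro _ ⟨q, hq, rfl⟩
        exact ⟨_, ⟨h.symm q, (hr q hq).1, rfl⟩, himg q hq⟩
  rw [isSolutionOn_iff hD'] at hsolg
  have hpD' : baseImage Φ f p ∈ D' := ⟨p, hpD, rfl⟩
  refine ⟨g, h.symm, hrs _ hpD', h.left_inv hph, ?_, ?_⟩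
  · filter_upwards [hD'.mem_nhds hpD'] with q hq
    exact ⟨hgs.contDiffAt (hD'.mem_nhds hq), hsolg.2 q hq, (hDsub (hr q hq).1).2.1, himg q hq⟩
  · filter_upwards [hD.mem_nhds hpD] with q hq
    change (Φ (h.symm (h q), f (h.symm (h q)))).2 = _
    rw [h.left_inv (hDh hq)]

end Image

/-- A function on the line with vanishing 2-jet at zero. -/
theorem isLittleO_sq_of_jet {φ ψ : ℝ → ℝ} (h1 : ∀ᶠ s in 𝓝 (0 : ℝ), HasDerivAt φ (ψ s) s)
    (h2 : HasDerivAt ψ 0 0) (hφ : φ 0 = 0) (hψ : ψ 0 = 0) :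
    φ =o[𝓝 0] fun s : ℝ => s ^ 2 := by
  obtain ⟨ε, hε, hball⟩ := Metric.eventually_nhds_iff_ball.mp h1
  have hb : Metric.ball (0 : ℝ) ε ∈ 𝓝 (0 : ℝ) := Metric.ball_mem_nhds _ hε
  have h3 : ψ =o[𝓝 0] fun s : ℝ => (s - 0) ^ 1 := by
    have := h2.isLittleO
    simpa [hψ] using this
  have := (convex_ball (0 : ℝ) ε).isLittleO_pow_succ_real (f := φ) (f' := ψ)
    (Metric.mem_ball_self hε) (fun s hs => (hball s hs).hasDerivWithinAt)
    (h3.mono nhdsWithin_le_nhds)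
  rw [nhdsWithin_eq_nhds.mpr hb] at this
  simpa [hφ] using this

theorem hasDerivAt_line {E : Type*} [NormedAddCommGroup E] [NormedSpace ℝ E] (q v : E) (s : ℝ) :
    HasDerivAt (fun r : ℝ => q + r • v) v s := by
  simpa using ((hasDerivAt_id s).smul_const v).const_add q

/-- Two solutions with the same 1-jet at a point agree to the second order in the direction of
the `x`-axis. -/
theorem isLittleO_sub_of_solutions {g g₁ : Base → ℝ} {q : Base}
    (hg : ContDiffAt ℝ ∞ g q) (hg₁ : ContDiffAt ℝ ∞ g₁ q) (h : kolmogorovOp g q = 0)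
    (h₁ : kolmogorovOp g₁ q = 0) (hv : g q = g₁ q) (hd : fderiv ℝ g q = fderiv ℝ g₁ q) :
    (fun s : ℝ => g₁ (q + s • (0, 1, 0)) - g (q + s • (0, 1, 0))) =o[𝓝 0] fun s : ℝ => s ^ 2 := by
  have hline := hasDerivAt_line q ((0, 1, 0) : Base)
  have e0 : q + (0 : ℝ) • ((0, 1, 0) : Base) = q := by simp
  have key : ∀ k : Base → ℝ, ContDiffAt ℝ ∞ k q →
      (∀ᶠ s in 𝓝 (0 : ℝ), HasDerivAt (fun s : ℝ => k (q + s • (0, 1, 0)))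
        (pd (0, 1, 0) k (q + s • (0, 1, 0))) s) ∧
      HasDerivAt (fun s : ℝ => pd (0, 1, 0) k (q + s • (0, 1, 0)))
        (pd (0, 1, 0) (pd (0, 1, 0) k) q) 0 := by
    intro k hk
    have hev : ∀ᶠ r in 𝓝 (q + (0 : ℝ) • ((0, 1, 0) : Base)), DifferentiableAt ℝ k r := by
      rw [e0]
      exact ((hk.of_le (m := 1) (by simp)).eventually (by simp)).mono
        fun r hr => hr.differentiableAt one_ne_zero
    constructor
    · filter_upwards [(hline 0).continuousAt.eventually hev] with s hs
      exact hasDerivAt_comp_curve hs (hline s)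
    · have := hasDerivAt_comp_curve (f := pd (0, 1, 0) k) (c := fun s : ℝ => q + s • (0, 1, 0))
        (s := 0) (v := (0, 1, 0)) (by
          simp only [e0]; exact differentiableAt_of_contDiffAt (contDiffAt_pd _ hk)) (hline 0)
      simpa only [e0] using this
  obtain ⟨a1, a2⟩ := key g hg
  obtain ⟨b1, b2⟩ := key g₁ hg₁
  refine isLittleO_sq_of_jet (ψ := fun s => pd (0, 1, 0) g₁ (q + s • (0, 1, 0))
    - pd (0, 1, 0) g (q + s • (0, 1, 0))) ?_ ?_ ?_ ?_
  · filter_upwards [a1, b1] with s h1 h2 using h2.sub h1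
  · refine (b2.sub a2).congr_deriv ?_
    -- The equation expresses the second x-derivative through the 1-jet, which the two solutions
    -- share.
    unfold kolmogorovOp at h h₁
    have : pd (1, 0, q.2.1) g q = pd (1, 0, q.2.1) g₁ q := by simp [pd, hd]
    linarith
  · simp only [e0, hv, sub_self]
  · simp only [e0, pd, hd, sub_self]

section Direction

variable {Φ : OpenPartialHomeomorph Total Total} {f k : Base → ℝ} {p a : Base}

/-- The direction mapped to the direction of the `x`-axis by a point symmetry is tangent, to the
second order, to zero sets of solutions with vanishing 1-jets. -/
theorem IsPointSymmetry.exists_curve (hΦ : IsPointSymmetry Φ) (hf : ContDiff ℝ ∞ f)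
    (hsol : ∀ q, kolmogorovOp f q = 0) (hp : (p, f p) ∈ Φ.source)
    (hinj : Function.Injective (fderiv ℝ (baseImage Φ f) p))
    (ha : fderiv ℝ (baseImage Φ f) p a = (0, 1, 0))
    (hk : ContDiff ℝ ∞ k) (hksol : ∀ q, kolmogorovOp k q = 0) (hk0 : k p = 0)
    (hk1 : fderiv ℝ k p = 0) :
    ∃ z : ℝ → Base, z 0 = p ∧ HasDerivAt z a 0 ∧ (fun s => k (z s)) =o[𝓝 0] fun s : ℝ => s ^ 2 := by
  have hf₁ : ContDiff ℝ ∞ (f + k) := hf.add hk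
  have hval : (f + k) p = f p := by simp [hk0]
  have hp₁ : (p, (f + k) p) ∈ Φ.source := by rwa [hval]
  have hsol₁ : ∀ q, kolmogorovOp (f + k) q = 0 := fun q => by
    rw [kolmogorovOp_add hf.contDiffAt hk.contDiffAt, hsol, hksol, add_zero]
  have hder : ∀ l : Base → ℝ, ContDiff ℝ ∞ l → (p, l p) ∈ Φ.source →
      HasFDerivAt (fun q => Φ (q, l q)) ((fderiv ℝ Φ (p, l p)).comp
        ((ContinuousLinearMap.id ℝ Base).prod (fderiv ℝ l p))) p := by
    intro l hl hlp
    have h1 : HasFDerivAt Φ (fderiv ℝ Φ (p, l p)) (p, l p) := (differentiableAt_of_contDiffAt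
      (hΦ.1.1.contDiffAt (Φ.open_source.mem_nhds hlp))).hasFDerivAt
    have h2 : HasFDerivAt l (fderiv ℝ l p) p :=
      (differentiableAt_of_contDiffAt hl.contDiffAt).hasFDerivAt
    exact HasFDerivAt.comp (g := Φ) (f := fun q => (q, l q)) p h1 ((hasFDerivAt_id p).prodMk h2)
  have hfd : fderiv ℝ (f + k) p = fderiv ℝ f p := by
    rw [fderiv_add (differentiableAt_of_contDiffAt hf.contDiffAt)
      (differentiableAt_of_contDiffAt hk.contDiffAt), hk1, add_zero]
  have d0 := hder f hf hp
  have d1 := hder (f + k) hf₁ hp₁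
  rw [hval, hfd] at d1
  -- f and f + k have the same 1-jet at p, and the differential of the image depends on nothing
  -- else.
  have hb1 : fderiv ℝ (baseImage Φ (f + k)) p = fderiv ℝ (baseImage Φ f) p :=
    d1.fst.fderiv.trans d0.fst.fderiv.symm
  have hinj₁ : Function.Injective (fderiv ℝ (baseImage Φ (f + k)) p) := by rwa [hb1]
  obtain ⟨g, r, hr, hrp, hev, hgb⟩ := hΦ.exists_image_solution hf hsol hp hinj
  obtain ⟨g₁, r₁, hr₁, hrp₁, hev₁, hgb₁⟩ := hΦ.exists_image_solution hf₁ hsol₁ hp₁ hinj₁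
  have hq : baseImage Φ (f + k) p = baseImage Φ f p := by simp only [baseImage, hval]
  set q := baseImage Φ f p with hqdef
  rw [hq] at hr₁ hrp₁ hev₁
  obtain ⟨hg, hgsol, -, -⟩ := hev.self_of_nhds
  obtain ⟨hg₁, hgsol₁, -, -⟩ := hev₁.self_of_nhds
  have hbd := differentiableAt_of_contDiffAt (contDiffAt_baseImage hΦ.1.1 hf hp)
  have hbd₁ := differentiableAt_of_contDiffAt (contDiffAt_baseImage hΦ.1.1 hf₁ hp₁)
  have hgv : g q = g₁ q := by
    have h1 := hgb.self_of_nhds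
    have h2 := hgb₁.self_of_nhds
    rw [hq, hval] at h2
    exact h1.trans h2.symm
  have hgd : fderiv ℝ g q = fderiv ℝ g₁ q := by
    have h1 : HasFDerivAt (fun x => g (baseImage Φ f x))
        ((fderiv ℝ g q).comp (fderiv ℝ (baseImage Φ f) p)) p :=
      HasFDerivAt.comp p (differentiableAt_of_contDiffAt hg).hasFDerivAt hbd.hasFDerivAt
    have h2 : HasFDerivAt (fun x => g₁ (baseImage Φ (f + k) x))
        ((fderiv ℝ g₁ q).comp (fderiv ℝ (baseImage Φ (f + k)) p)) p :=
      HasFDerivAt.comp p (by rw [hq]; exact (differentiableAt_of_contDiffAt hg₁).hasFDerivAt)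
        hbd₁.hasFDerivAt
    have h3 := h1.unique (d0.snd.congr_of_eventuallyEq hgb)
    have h4 := h2.unique (d1.snd.congr_of_eventuallyEq hgb₁)
    rw [hb1] at h4
    have h5 := h3.trans h4.symm
    have hsurj : Function.Surjective (fderiv ℝ (baseImage Φ f) p) :=
      LinearMap.injective_iff_surjective.mp hinj
    refine ContinuousLinearMap.ext fun v => ?_
    obtain ⟨w, rfl⟩ := hsurj v
    exact DFunLike.congr_fun h5 w
  have hlo := isLittleO_sub_of_solutions hg hg₁ hgsol hgsol₁ hgv hgd
  refine ⟨fun s => r₁ (q + s • (0, 1, 0)), ?_, ?_, ?_⟩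
  · simpa using hrp₁
  · have e0 : q + (0 : ℝ) • ((0, 1, 0) : Base) = q := by simp
    have hz : HasDerivAt (fun s : ℝ => r₁ (q + s • (0, 1, 0))) (fderiv ℝ r₁ q (0, 1, 0)) 0 := by
      refine HasFDerivAt.comp_hasDerivAt (f := fun s : ℝ => q + s • ((0, 1, 0) : Base)) 0 ?_
        (hasDerivAt_line q (0, 1, 0) 0)
      rw [e0]
      exact (differentiableAt_of_contDiffAt hr₁).hasFDerivAt
    have hid : HasFDerivAt (fun x => baseImage Φ (f + k) (r₁ x))
        ((fderiv ℝ (baseImage Φ (f + k)) p).comp (fderiv ℝ r₁ q)) q := by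
      refine HasFDerivAt.comp (g := baseImage Φ (f + k)) (f := r₁) q ?_
        (differentiableAt_of_contDiffAt hr₁).hasFDerivAt
      rw [hrp₁]
      exact hbd₁.hasFDerivAt
    have hid' : (fun x => baseImage Φ (f + k) (r₁ x)) =ᶠ[𝓝 q] id := by
      filter_upwards [hev₁] with x hx
      exact congrArg Prod.fst hx.2.2.2
    have h1 := hid.unique ((hasFDerivAt_id (𝕜 := ℝ) q).congr_of_eventuallyEq hid')
    have h2 : fderiv ℝ (baseImage Φ f) p (fderiv ℝ r₁ q (0, 1, 0)) = (0, 1, 0) := by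
      rw [← hb1]
      exact DFunLike.congr_fun h1 (0, 1, 0)
    rwa [hinj (h2.trans ha.symm)] at hz
  -- H vanishes on the image of the graph of f and equals k∘r₁ on the image of the graph of f + k.
  -- Being locally Lipschitz, it is bounded by a multiple of g₁ − g.
  · let H : Total → ℝ := fun Q => (Φ.symm Q).2 - f (Φ.symm Q).1
    have hQ : (q, g q) ∈ Φ.target := by
      obtain ⟨-, -, h3, h4⟩ := hev.self_of_nhds
      rw [← h4]
      exact Φ.map_source h3
    have hH : ContDiffAt ℝ ∞ H (q, g q) := by
      have hs := hΦ.1.2.contDiffAt (Φ.open_target.mem_nhds hQ)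
      exact hs.snd.sub (hf.contDiffAt.comp _ hs.fst)
    have hO := (hH.hasStrictFDerivAt (by simp)).isBigO_sub
    have e0 : q + (0 : ℝ) • ((0, 1, 0) : Base) = q := by simp
    have hline : Tendsto (fun s : ℝ => q + s • ((0, 1, 0) : Base)) (𝓝 0) (𝓝 q) := by
      have := (hasDerivAt_line q ((0, 1, 0) : Base) 0).continuousAt.tendsto
      rwa [e0] at this
    have htend : Tendsto (fun s : ℝ => (((q + s • (0, 1, 0), g₁ (q + s • (0, 1, 0))) : Total),
        ((q + s • (0, 1, 0), g (q + s • (0, 1, 0))) : Total))) (𝓝 0) (𝓝 ((q, g q), (q, g q))) := by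
      have t1 := hg.continuousAt.tendsto.comp hline
      have t2 := hg₁.continuousAt.tendsto.comp hline
      rw [← hgv] at t2
      exact (hline.prodMk_nhds t2).prodMk_nhds (hline.prodMk_nhds t1)
    have hO' := hO.comp_tendsto htend
    have hO'' : (fun s : ℝ => k (r₁ (q + s • (0, 1, 0)))) =O[𝓝 0] fun s : ℝ =>
        g₁ (q + s • (0, 1, 0)) - g (q + s • (0, 1, 0)) := by
      refine (hO'.congr' ?_ (EventuallyEq.refl _ _)).trans (Asymptotics.IsBigO.of_bound 1
        (Eventually.of_forall fun s => ?_))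
      · filter_upwards [hline.eventually hev, hline.eventually hev₁] with s h1 h2
        obtain ⟨-, -, h3, h4⟩ := h1
        obtain ⟨-, -, h5, h6⟩ := h2
        simp only [Function.comp, H]
        rw [← h4, ← h6, Φ.left_inv h3, Φ.left_inv h5]
        simp
      · simp [Prod.norm_def]
    exact hO''.trans_isLittleO hlo

end Direction


/-! ### Polynomial solutions -/

section PdRules

variable {E : Type*} [NormedAddCommGroup E] [NormedSpace ℝ E] {f g : E → ℝ} {p : E} (v : E)

theorem pd_add (hf : DifferentiableAt ℝ f p) (hg : DifferentiableAt ℝ g p) :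
    pd v (fun q => f q + g q) p = pd v f p + pd v g p := by
  simp [pd, fderiv_fun_add hf hg]

theorem pd_sub (hf : DifferentiableAt ℝ f p) (hg : DifferentiableAt ℝ g p) :
    pd v (fun q => f q - g q) p = pd v f p - pd v g p := by
  simp [pd, fderiv_fun_sub hf hg]

theorem pd_mul (hf : DifferentiableAt ℝ f p) (hg : DifferentiableAt ℝ g p) :
    pd v (fun q => f q * g q) p = f p * pd v g p + g p * pd v f p := by
  simp [pd, fderiv_fun_mul hf hg]

theorem pd_pow (n : ℕ) (hf : DifferentiableAt ℝ f p) :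
    pd v (fun q => f q ^ n) p = n * f p ^ (n - 1) * pd v f p := by
  simp [pd, fderiv_fun_pow n hf]

theorem pd_const (c : ℝ) : pd v (fun _ => c) p = 0 := by
  simp [pd]

end PdRules

theorem pd_coord_t (v p : Base) : pd v (fun q : Base => q.1) p = v.1 := by
  have : HasFDerivAt (fun q : Base => q.1) (ContinuousLinearMap.fst ℝ ℝ (ℝ × ℝ)) p :=
    hasFDerivAt_fst
  simp [pd, this.fderiv]

theorem pd_coord_x (v p : Base) : pd v (fun q : Base => q.2.1) p = v.2.1 := by
  have : HasFDerivAt (fun q : Base => q.2.1) ((ContinuousLinearMap.fst ℝ ℝ ℝ).comp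
    (ContinuousLinearMap.snd ℝ ℝ (ℝ × ℝ))) p := hasFDerivAt_snd.fst
  simp [pd, this.fderiv]

theorem pd_coord_y (v p : Base) : pd v (fun q : Base => q.2.2) p = v.2.2 := by
  have : HasFDerivAt (fun q : Base => q.2.2) ((ContinuousLinearMap.snd ℝ ℝ ℝ).comp
    (ContinuousLinearMap.snd ℝ ℝ (ℝ × ℝ))) p := hasFDerivAt_snd.snd
  simp [pd, this.fderiv]

section Polynomials

variable (p₀ : Base)

/-- The polynomial solution with a given 1-jet at `p₀`. -/
noncomputable def jetSolution (c r q s : ℝ) (p : Base) : ℝ :=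
  c + q * (p.2.1 - p₀.2.1) + s * ((p.2.2 - p₀.2.2) - (p.1 - p₀.1) * p.2.1)
    -- The s-term contributes −s·x₀ to the t-derivative at p₀; the shift of r by s·x₀ compensates
    -- it.
    + (r + s * p₀.2.1) / 2 * ((p.2.1 - p₀.2.1) ^ 2 + 2 * (p.1 - p₀.1))

/-- A polynomial solution with the 2-jet `12 (t - t₀)²` at `p₀`. -/
noncomputable def quadT (p : Base) : ℝ :=
  (p.2.1 - p₀.2.1) ^ 4 + 12 * (p.2.1 - p₀.2.1) ^ 2 * (p.1 - p₀.1) + 12 * (p.1 - p₀.1) ^ 2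

/-- A polynomial solution with the 2-jet `(y - y₀ - x₀ (t - t₀))²` at `p₀`. -/
noncomputable def quadY (p : Base) : ℝ :=
  ((p.2.2 - p₀.2.2) - (p.1 - p₀.1) * p.2.1) ^ 2 + 2 / 3 * (p.1 - p₀.1) ^ 3

theorem contDiff_jetSolution (c r q s : ℝ) : ContDiff ℝ ∞ (jetSolution p₀ c r q s) := by
  unfold jetSolution; fun_prop

theorem contDiff_quadT : ContDiff ℝ ∞ (quadT p₀) := by
  unfold quadT; fun_prop

theorem contDiff_quadY : ContDiff ℝ ∞ (quadY p₀) := by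
  unfold quadY; fun_prop

theorem pd_jetSolution (c r q s : ℝ) (v p : Base) : pd v (jetSolution p₀ c r q s) p
    = q * v.2.1 + s * (v.2.2 - v.1 * p.2.1 - (p.1 - p₀.1) * v.2.1)
      + (r + s * p₀.2.1) * ((p.2.1 - p₀.2.1) * v.2.1 + v.1) := by
  unfold jetSolution
  simp (disch := fun_prop) only [pd_add, pd_sub, pd_mul, pd_pow, pd_const, pd_coord_t, pd_coord_x,
    pd_coord_y]
  push_cast
  ring

theorem pd_quadT (v p : Base) : pd v (quadT p₀) p
    = 4 * (p.2.1 - p₀.2.1) ^ 3 * v.2.1 + 24 * (p.2.1 - p₀.2.1) * (p.1 - p₀.1) * v.2.1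
      + 12 * (p.2.1 - p₀.2.1) ^ 2 * v.1 + 24 * (p.1 - p₀.1) * v.1 := by
  unfold quadT
  simp (disch := fun_prop) only [pd_add, pd_sub, pd_mul, pd_pow, pd_const, pd_coord_t, pd_coord_x]
  push_cast
  ring

theorem pd_quadY (v p : Base) : pd v (quadY p₀) p
    = 2 * ((p.2.2 - p₀.2.2) - (p.1 - p₀.1) * p.2.1)
        * (v.2.2 - v.1 * p.2.1 - (p.1 - p₀.1) * v.2.1) + 2 * (p.1 - p₀.1) ^ 2 * v.1 := by
  unfold quadY
  simp (disch := fun_prop) only [pd_add, pd_sub, pd_mul, pd_pow, pd_const, pd_coord_t, pd_coord_x,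
    pd_coord_y]
  push_cast
  ring

theorem pd_x_pd_x_jetSolution (c r q s : ℝ) (p : Base) :
    pd (0, 1, 0) (pd (0, 1, 0) (jetSolution p₀ c r q s)) p = r + s * p₀.2.1 := by
  rw [funext (pd_jetSolution p₀ c r q s (0, 1, 0))]
  simp (disch := fun_prop) only [pd_add, pd_sub, pd_mul, pd_const, pd_coord_t, pd_coord_x]
  ring

theorem kolmogorovOp_jetSolution (c r q s : ℝ) (p : Base) :
    kolmogorovOp (jetSolution p₀ c r q s) p = 0 := by
  rw [kolmogorovOp, pd_x_pd_x_jetSolution, pd_jetSolution]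
  ring

theorem kolmogorovOp_quadT (p : Base) : kolmogorovOp (quadT p₀) p = 0 := by
  rw [kolmogorovOp, funext (pd_quadT p₀ (0, 1, 0)), pd_quadT]
  simp (disch := fun_prop) only [pd_add, pd_sub, pd_mul, pd_pow, pd_const, pd_coord_t, pd_coord_x]
  push_cast
  ring

theorem kolmogorovOp_quadY (p : Base) : kolmogorovOp (quadY p₀) p = 0 := by
  rw [kolmogorovOp, funext (pd_quadY p₀ (0, 1, 0)), pd_quadY]
  simp (disch := fun_prop) only [pd_add, pd_sub, pd_mul, pd_pow, pd_const, pd_coord_t, pd_coord_x,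
    pd_coord_y]
  push_cast
  ring

theorem jetSolution_self (c r q s : ℝ) : jetSolution p₀ c r q s p₀ = c := by
  simp [jetSolution]

theorem fderiv_jetSolution_self (c r q s : ℝ) (v : Base) :
    fderiv ℝ (jetSolution p₀ c r q s) p₀ v = r * v.1 + q * v.2.1 + s * v.2.2 := by
  have := pd_jetSolution p₀ c r q s v p₀
  rw [pd] at this
  rw [this]
  ring

theorem fderiv_quadT_self : fderiv ℝ (quadT p₀) p₀ = 0 := by
  refine ContinuousLinearMap.ext fun v => ?_
  have := pd_quadT p₀ v p₀
  rw [pd] at this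
  rw [this]
  simp

theorem fderiv_quadY_self : fderiv ℝ (quadY p₀) p₀ = 0 := by
  refine ContinuousLinearMap.ext fun v => ?_
  have := pd_quadY p₀ v p₀
  rw [pd] at this
  rw [this]
  simp

end Polynomials

theorem tendsto_of_isLittleO_sq {φ : ℝ → ℝ} (h : φ =o[𝓝 0] fun s : ℝ => s ^ 2) :
    Tendsto (fun s => φ s / s ^ 2) (𝓝[≠] 0) (𝓝 0) :=
  h.tendsto_div_nhds_zero.mono_left nhdsWithin_le_nhds

section Tangent

variable {p₀ a : Base} {z : ℝ → Base}

theorem tendsto_div_of_hasDerivAt {φ : ℝ → ℝ} {φ' : ℝ} (h : HasDerivAt φ φ' 0) (h0 : φ 0 = 0) :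
    Tendsto (fun s => φ s / s) (𝓝[≠] 0) (𝓝 φ') := by
  have := hasDerivAt_iff_tendsto_slope.mp h
  refine this.congr fun s => ?_
  simp [slope_def_field, h0]

/-- Along the curve, `quadT` divided by s² tends to 12 times the square of the t-component of a, the
other two terms being o(s²). -/
theorem curve_direction_t (h0 : z 0 = p₀) (hz : HasDerivAt z a 0)
    (hk : (fun s => quadT p₀ (z s)) =o[𝓝 0] fun s : ℝ => s ^ 2) : a.1 = 0 := by
  have ht : HasDerivAt (fun s => (z s).1 - p₀.1) a.1 0 := hz.fst.sub_const _
  have hx : HasDerivAt (fun s => (z s).2.1 - p₀.2.1) a.2.1 0 := hz.snd.fst.sub_const _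
  have lt := tendsto_div_of_hasDerivAt ht (by simp [h0])
  have lx := tendsto_div_of_hasDerivAt hx (by simp [h0])
  have ct : Tendsto (fun s => (z s).1 - p₀.1) (𝓝[≠] 0) (𝓝 0) := by
    have := ht.continuousAt.tendsto.mono_left (nhdsWithin_le_nhds (s := {0}ᶜ))
    simpa [h0] using this
  have cx : Tendsto (fun s => (z s).2.1 - p₀.2.1) (𝓝[≠] 0) (𝓝 0) := by
    have := hx.continuousAt.tendsto.mono_left (nhdsWithin_le_nhds (s := {0}ᶜ))
    simpa [h0] using this
  have h1 := (((lx.pow 2).mul (cx.pow 2)).add (((lx.pow 2).mul ct).const_mul 12)).add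
    ((lt.pow 2).const_mul 12)
  have h2 := tendsto_nhds_unique ((tendsto_of_isLittleO_sq hk).congr' (by
    filter_upwards [self_mem_nhdsWithin] with s hs
    have hs' : s ≠ 0 := hs
    simp only [quadT]
    field_simp)) h1
  have h3 : a.1 ^ 2 = 0 := by linarith
  exact pow_eq_zero_iff (two_ne_zero) |>.mp h3

/-- The cubic term of `quadY` is o(s²). Once the t-component of a vanishes, the limit of the
quotient by s² is the square of the y-component. -/
theorem curve_direction_y (h0 : z 0 = p₀) (hz : HasDerivAt z a 0)
    (hk : (fun s => quadY p₀ (z s)) =o[𝓝 0] fun s : ℝ => s ^ 2) (ha : a.1 = 0) : a.2.2 = 0 := by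
  have ht : HasDerivAt (fun s => (z s).1 - p₀.1) a.1 0 := hz.fst.sub_const _
  have hx : HasDerivAt (fun s => (z s).2.1) a.2.1 0 := hz.snd.fst
  have hy : HasDerivAt (fun s => (z s).2.2 - p₀.2.2) a.2.2 0 := hz.snd.snd.sub_const _
  have lt := tendsto_div_of_hasDerivAt ht (by simp [h0])
  have le := tendsto_div_of_hasDerivAt (hy.sub (ht.mul hx)) (by simp [h0])
  have ct : Tendsto (fun s => (z s).1 - p₀.1) (𝓝[≠] 0) (𝓝 0) := by
    have := ht.continuousAt.tendsto.mono_left (nhdsWithin_le_nhds (s := {0}ᶜ))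
    simpa [h0] using this
  have h1 := (le.pow 2).add (((lt.pow 2).mul ct).const_mul (2 / 3))
  have h2 := tendsto_nhds_unique ((tendsto_of_isLittleO_sq hk).congr' (by
    filter_upwards [self_mem_nhdsWithin] with s hs
    have hs' : s ≠ 0 := hs
    simp only [quadY, Pi.sub_apply, Pi.mul_apply]
    field_simp)) h1
  simp only [ha, h0] at h2
  have h3 : a.2.2 ^ 2 = 0 := by linear_combination -h2
  exact pow_eq_zero_iff (two_ne_zero) |>.mp h3

end Tangent

/-! ### Components of point symmetries -/

section Components

variable {Φ : OpenPartialHomeomorph Total Total} {P : Total}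

theorem IsPointTransformation.contDiffAt (hΦ : IsPointTransformation Φ) (hP : P ∈ Φ.source) :
    ContDiffAt ℝ ∞ Φ P :=
  hΦ.1.contDiffAt (Φ.open_source.mem_nhds hP)

theorem IsPointTransformation.bijective_fderiv (hΦ : IsPointTransformation Φ)
    (hP : P ∈ Φ.source) : Function.Bijective (fderiv ℝ Φ P) := by
  have h1 := (differentiableAt_of_contDiffAt (hΦ.contDiffAt hP)).hasFDerivAt
  have h2 : HasFDerivAt Φ.symm (fderiv ℝ Φ.symm (Φ P)) (Φ P) :=
    (differentiableAt_of_contDiffAt (hΦ.2.contDiffAt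
      (Φ.open_target.mem_nhds (Φ.map_source hP)))).hasFDerivAt
  have h3 := (HasFDerivAt.comp P h2 h1).unique ((hasFDerivAt_id (𝕜 := ℝ) P).congr_of_eventuallyEq
    (by filter_upwards [Φ.open_source.mem_nhds hP] with Q hQ using Φ.left_inv hQ))
  have hinj : Function.Injective (fderiv ℝ Φ P) :=
    Function.LeftInverse.injective (g := fderiv ℝ Φ.symm (Φ P)) fun v => DFunLike.congr_fun h3 v
  exact ⟨hinj, LinearMap.injective_iff_surjective.mp hinj⟩

theorem fderiv_baseImage (hΦ : IsPointTransformation Φ) (c r q s : ℝ) {p : Base}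
    (hP : (p, c) ∈ Φ.source) (v : Base) :
    fderiv ℝ (baseImage Φ (jetSolution p c r q s)) p v
      = (fderiv ℝ Φ (p, c) (v, r * v.1 + q * v.2.1 + s * v.2.2)).1 := by
  have h1 := (differentiableAt_of_contDiffAt (hΦ.contDiffAt hP)).hasFDerivAt
  have h2 := (differentiableAt_of_contDiffAt
    (contDiff_jetSolution p c r q s).contDiffAt (p := p)).hasFDerivAt
  have h3 : HasFDerivAt (fun x => Φ (x, jetSolution p c r q s x)) ((fderiv ℝ Φ (p, c)).comp
      ((ContinuousLinearMap.id ℝ Base).prod (fderiv ℝ (jetSolution p c r q s) p))) p :=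
    HasFDerivAt.comp (g := Φ) (f := fun x => (x, jetSolution p c r q s x)) p
      (by rwa [jetSolution_self]) ((hasFDerivAt_id p).prodMk h2)
  have h4 : HasFDerivAt (baseImage Φ (jetSolution p c r q s)) _ p := h3.fst
  rw [h4.fderiv]
  simp [fderiv_jetSolution_self]

/-- If the graph with a given 1-jet is mapped transversally to the fibres, then the total
`x`-derivatives of the `t`- and `y`-components of a point symmetry vanish. -/
theorem IsPointSymmetry.total_x (hΦ : IsPointSymmetry Φ) {c r q s : ℝ} {p : Base}
    (hP : (p, c) ∈ Φ.source)
    (hinj : Function.Injective fun v : Base =>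
      (fderiv ℝ Φ (p, c) (v, r * v.1 + q * v.2.1 + s * v.2.2)).1) :
    (fderiv ℝ Φ (p, c) ((0, 1, 0), q)).1.1 = 0 ∧
      (fderiv ℝ Φ (p, c) ((0, 1, 0), q)).1.2.2 = 0 := by
  have hinj' : Function.Injective (fderiv ℝ (baseImage Φ (jetSolution p c r q s)) p) := by
    intro v w h
    rw [fderiv_baseImage hΦ.1 c r q s hP, fderiv_baseImage hΦ.1 c r q s hP] at h
    exact hinj h
  have hP' : (p, jetSolution p c r q s p) ∈ Φ.source := by rwa [jetSolution_self]
  obtain ⟨a, ha⟩ : ∃ a, fderiv ℝ (baseImage Φ (jetSolution p c r q s)) p a = (0, 1, 0) :=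
    LinearMap.injective_iff_surjective.mp hinj' (0, 1, 0)
  obtain ⟨z, h1, h2, h3⟩ := hΦ.exists_curve (contDiff_jetSolution p c r q s)
    (kolmogorovOp_jetSolution p c r q s) hP' hinj' ha (contDiff_quadT p) (kolmogorovOp_quadT p)
    (by simp [quadT]) (fderiv_quadT_self p)
  have at0 := curve_direction_t h1 h2 h3
  obtain ⟨z, h1, h2, h3⟩ := hΦ.exists_curve (contDiff_jetSolution p c r q s)
    (kolmogorovOp_jetSolution p c r q s) hP' hinj' ha (contDiff_quadY p) (kolmogorovOp_quadY p)
    (by simp [quadY]) (fderiv_quadY_self p)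
  have ay0 := curve_direction_y h1 h2 h3 at0
  have hax : a = a.2.1 • ((0, 1, 0) : Base) := by
    refine Prod.ext ?_ (Prod.ext ?_ ?_) <;> simp [at0, ay0]
  have h4 : fderiv ℝ (baseImage Φ (jetSolution p c r q s)) p (0, 1, 0)
      = (fderiv ℝ Φ (p, c) ((0, 1, 0), q)).1 := by
    rw [fderiv_baseImage hΦ.1 c r q s hP]; simp
  rw [hax, map_smul, h4] at ha
  have hne : a.2.1 ≠ 0 := by
    intro h
    rw [h, zero_smul] at ha
    have := congrArg (fun v : Base => v.2.1) ha
    simp at this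
  have e1 := congrArg Prod.fst ha
  have e2 := congrArg (fun v : Base => v.2.2) ha
  simp only [Prod.smul_fst, Prod.smul_snd, smul_eq_mul] at e1 e2
  exact ⟨(mul_eq_zero.mp e1).resolve_left hne, (mul_eq_zero.mp e2).resolve_left hne⟩

/-- The `t`- and `y`-components of a point symmetry do not depend on `x` and `u`. -/
theorem IsPointSymmetry.fderiv_t_y (hΦ : IsPointSymmetry Φ) (hP : P ∈ Φ.source) :
    (fderiv ℝ Φ P ((0, 1, 0), 0)).1.1 = 0 ∧ (fderiv ℝ Φ P ((0, 1, 0), 0)).1.2.2 = 0 ∧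
      (fderiv ℝ Φ P (0, 1)).1.1 = 0 ∧ (fderiv ℝ Φ P (0, 1)).1.2.2 = 0 := by
  obtain ⟨p, c⟩ := P
  obtain ⟨hi, hs⟩ := hΦ.1.bijective_fderiv hP
  set A := fderiv ℝ Φ (p, c) with hA
  -- (n, ν) is the direction that the symmetry sends to the fibre direction. A graph with 1-jet (r,
  -- q, s) has an image transversal to the fibres when it does not contain this direction.
  obtain ⟨⟨n, ν⟩, hn⟩ := hs (0, 1)
  have hnν : ¬ (n = 0 ∧ ν = 0) := by
    rintro ⟨rfl, rfl⟩
    have h1 := congrArg Prod.snd hn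
    rw [show ((0, 0) : Total) = 0 from rfl, map_zero] at h1
    simp at h1
  have key : ∀ r q s : ℝ, r * n.1 + q * n.2.1 + s * n.2.2 ≠ ν →
      (A ((0, 1, 0), q)).1.1 = 0 ∧ (A ((0, 1, 0), q)).1.2.2 = 0 := by
    intro r q s hj
    refine hΦ.total_x (r := r) (s := s) hP ?_
    rw [← hA]
    let L : Base →ₗ[ℝ] Base :=
      { toFun := fun v => (A (v, r * v.1 + q * v.2.1 + s * v.2.2)).1
        map_add' := fun v w => by
          rw [← Prod.fst_add, ← map_add]
          congr 2
          refine Prod.ext rfl ?_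
          simp; ring
        map_smul' := fun k v => by
          rw [RingHom.id_apply, ← Prod.smul_fst, ← map_smul]
          congr 2
          refine Prod.ext rfl ?_
          simp; ring }
    have hL : Function.Injective L := by
      rw [injective_iff_map_eq_zero]
      intro v hv
      have hv' : (A (v, r * v.1 + q * v.2.1 + s * v.2.2)).1 = 0 := hv
      set μ := (A (v, r * v.1 + q * v.2.1 + s * v.2.2)).2 with hμ
      have h1 : A (v, r * v.1 + q * v.2.1 + s * v.2.2) = A (μ • (n, ν)) := by
        rw [map_smul, hn]
        refine Prod.ext ?_ ?_
        · rw [hv']; simp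
        · simp [← hμ]
      have h2 := hi h1
      have h3 : v = μ • n := congrArg Prod.fst h2
      have h4 : r * v.1 + q * v.2.1 + s * v.2.2 = μ * ν := congrArg Prod.snd h2
      have h5 : μ * (r * n.1 + q * n.2.1 + s * n.2.2 - ν) = 0 := by
        rw [h3] at h4
        simp only [Prod.smul_fst, Prod.smul_snd, smul_eq_mul] at h4
        linear_combination h4
      have h6 := (mul_eq_zero.mp h5).resolve_right (sub_ne_zero.mpr hj)
      rw [h3, h6, zero_smul]
    exact hL
  have two : ∃ q q' : ℝ, q ≠ q' ∧ ((A ((0, 1, 0), q)).1.1 = 0 ∧ (A ((0, 1, 0), q)).1.2.2 = 0) ∧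
      (A ((0, 1, 0), q')).1.1 = 0 ∧ (A ((0, 1, 0), q')).1.2.2 = 0 := by
    have hj : ∃ r q s : ℝ, r * n.1 + q * n.2.1 + s * n.2.2 ≠ ν := by
      by_contra! h
      have h0 := h 0 0 0
      have h1 := h 1 0 0
      have h2 := h 0 1 0
      have h3 := h 0 0 1
      simp only [zero_mul, one_mul, add_zero, zero_add] at h0 h1 h2 h3
      refine hnν ⟨Prod.ext ?_ (Prod.ext ?_ ?_), h0.symm⟩ <;> simp <;> linarith
    obtain ⟨r, q, s, hj⟩ := hj
    -- The excluded condition is affine in q and fails at q, so it cannot hold at both q + 1 and q +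
    -- 2. Two admissible q separate the x- and u-derivatives below.
    by_cases h : r * n.1 + (q + 1) * n.2.1 + s * n.2.2 = ν
    · refine ⟨q, q + 2, by simp, key r q s hj, key r (q + 2) s fun h' => hj ?_⟩
      linear_combination 2 * h - h'
    · exact ⟨q, q + 1, by simp, key r q s hj, key r (q + 1) s h⟩
  obtain ⟨q, q', hqq, ⟨h1, h2⟩, h3, h4⟩ := two
  have dec : ∀ k : ℝ, A ((0, 1, 0), k) = A ((0, 1, 0), 0) + k • A (0, 1) := by
    intro k
    rw [← map_smul, ← map_add]
    congr 1
    refine Prod.ext ?_ ?_ <;> simp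
  rw [dec] at h1 h2 h3 h4
  simp only [Prod.fst_add, Prod.snd_add, Prod.smul_fst, Prod.smul_snd, smul_eq_mul] at h1 h2 h3 h4
  have hne := sub_ne_zero.mpr hqq
  have h5 : (A (0, 1)).1.1 = 0 := by
    have : (q - q') * (A (0, 1)).1.1 = 0 := by linear_combination h1 - h3
    exact (mul_eq_zero.mp this).resolve_left hne
  have h6 : (A (0, 1)).1.2.2 = 0 := by
    have : (q - q') * (A (0, 1)).1.2.2 = 0 := by linear_combination h2 - h4
    exact (mul_eq_zero.mp this).resolve_left hne
  rw [h5] at h1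
  rw [h6] at h2
  exact ⟨by linarith, by linarith, h5, h6⟩

end Components


/-! ### Determining equations -/

theorem pd_comm {E : Type*} [NormedAddCommGroup E] [NormedSpace ℝ E] {f : E → ℝ} {p : E}
    (hf : ContDiffAt ℝ ∞ f p) (v w : E) : pd v (pd w f) p = pd w (pd v f) p := by
  have hsymm := hf.isSymmSndFDerivAt (by
    rw [minSmoothness_of_isRCLikeNormedField]; exact WithTop.coe_le_coe.mpr le_top)
  have hd : DifferentiableAt ℝ (fderiv ℝ f) p :=
    (hf.fderiv_right (m := ∞) (by simp)).differentiableAt (by simp)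
  have key : ∀ v w : E, pd v (pd w f) p = fderiv ℝ (fderiv ℝ f) p v w := by
    intro v w
    have h : HasFDerivAt (fun q => fderiv ℝ f q w)
        ((fderiv ℝ (fderiv ℝ f) p).flip w) p := by
      simpa using hd.hasFDerivAt.clm_apply (hasFDerivAt_const w p)
    change fderiv ℝ (fun q => fderiv ℝ f q w) p v = _
    rw [h.fderiv]
    rfl
  rw [key, key, hsymm.eq]

/-- The direction of the `t`-axis. -/
abbrev dirT : Total := ((1, 0, 0), 0)

/-- The direction of the `x`-axis. -/
abbrev dirX : Total := ((0, 1, 0), 0)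

/-- The direction of the `y`-axis. -/
abbrev dirY : Total := ((0, 0, 1), 0)

/-- The direction of the `u`-axis. -/
abbrev dirU : Total := ((0, 0, 0), 1)

section Components

variable (Φ : Total → Total)

/-- The `t`-component of a transformation. -/
def compT (P : Total) : ℝ := (Φ P).1.1

/-- The `x`-component of a transformation. -/
def compX (P : Total) : ℝ := (Φ P).1.2.1

/-- The `y`-component of a transformation. -/
def compY (P : Total) : ℝ := (Φ P).1.2.2

/-- The `u`-component of a transformation. -/
def compU (P : Total) : ℝ := (Φ P).2

variable {Φ} {P : Total}

theorem pd_components (h : DifferentiableAt ℝ Φ P) (v : Total) :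
    fderiv ℝ Φ P v = ((pd v (compT Φ) P, pd v (compX Φ) P, pd v (compY Φ) P), pd v (compU Φ) P) := by
  have h1 := h.hasFDerivAt
  have hT : HasFDerivAt (compT Φ) _ P := h1.fst.fst
  have hX : HasFDerivAt (compX Φ) _ P := h1.fst.snd.fst
  have hY : HasFDerivAt (compY Φ) _ P := h1.fst.snd.snd
  have hU : HasFDerivAt (compU Φ) _ P := h1.snd
  simp only [pd, hT.fderiv, hX.fderiv, hY.fderiv, hU.fderiv]
  rfl

end Components

section Lift

variable {f : Base → ℝ} {G : Total → ℝ} {p : Base}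

theorem pd_lift (hf : DifferentiableAt ℝ f p) (hG : DifferentiableAt ℝ G (p, f p)) (v : Base) :
    pd v (fun q => G (q, f q)) p = pd (v, 0) G (p, f p) + pd v f p * pd dirU G (p, f p) := by
  have h : HasFDerivAt (fun q => G (q, f q)) ((fderiv ℝ G (p, f p)).comp
      ((ContinuousLinearMap.id ℝ Base).prod (fderiv ℝ f p))) p :=
    HasFDerivAt.comp (g := G) (f := fun q => (q, f q)) p hG.hasFDerivAt
      ((hasFDerivAt_id p).prodMk hf.hasFDerivAt)
  rw [pd, h.fderiv, ← pd_smul_vec, ← pd_add_vec]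
  change fderiv ℝ G (p, f p) (v, fderiv ℝ f p v) = _
  rw [pd]
  congr 1
  refine Prod.ext ?_ ?_
  · simp
  · simp [pd]

theorem pd_x_pd_x_lift (hf : ContDiff ℝ ∞ f) {S : Set Total} (hS : IsOpen S)
    (hG : ContDiffOn ℝ ∞ G S) (hp : (p, f p) ∈ S) :
    pd (0, 1, 0) (pd (0, 1, 0) fun q => G (q, f q)) p
      = pd dirX (pd dirX G) (p, f p) + 2 * pd (0, 1, 0) f p * pd dirX (pd dirU G) (p, f p)
        + pd (0, 1, 0) f p ^ 2 * pd dirU (pd dirU G) (p, f p)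
        + pd (0, 1, 0) (pd (0, 1, 0) f) p * pd dirU G (p, f p) := by
  have hgr : ContinuousAt (fun q => (q, f q)) p :=
    continuousAt_id.prodMk hf.continuous.continuousAt
  have hGp : ContDiffAt ℝ ∞ G (p, f p) := hG.contDiffAt (hS.mem_nhds hp)
  have hfd : ∀ q, DifferentiableAt ℝ f q := fun q => differentiableAt_of_contDiffAt hf.contDiffAt
  have hev : pd (0, 1, 0) (fun q => G (q, f q)) =ᶠ[𝓝 p]
      fun q => pd dirX G (q, f q) + pd (0, 1, 0) f q * pd dirU G (q, f q) := by
    filter_upwards [hgr.eventually (hS.mem_nhds hp)] with q hq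
    exact pd_lift (hfd q) (differentiableAt_of_contDiffAt (hG.contDiffAt (hS.mem_nhds hq))) _
  have hX := differentiableAt_of_contDiffAt (contDiffAt_pd dirX hGp)
  have hU := differentiableAt_of_contDiffAt (contDiffAt_pd dirU hGp)
  have hfx := differentiableAt_of_contDiffAt (contDiffAt_pd (0, 1, 0) (hf.contDiffAt (x := p)))
  have hgd : DifferentiableAt ℝ (fun q => (q, f q)) p := differentiableAt_id.prodMk (hfd p)
  have hX' : DifferentiableAt ℝ (fun q => pd dirX G (q, f q)) p :=
    DifferentiableAt.comp (g := pd dirX G) p hX hgd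
  have hU' : DifferentiableAt ℝ (fun q => pd dirU G (q, f q)) p :=
    DifferentiableAt.comp (g := pd dirU G) p hU hgd
  rw [pd_congr _ hev, pd_add _ hX' (hfx.fun_mul hU'), pd_mul _ hfx hU', pd_lift (hfd p) hX,
    pd_lift (hfd p) hU, pd_comm hGp dirU dirX]
  ring

end Lift

section Determining

variable {Φ : OpenPartialHomeomorph Total Total} {P : Total}

theorem contDiffOn_components (h : ContDiffOn ℝ ∞ Φ Φ.source) :
    ContDiffOn ℝ ∞ (compT Φ) Φ.source ∧ ContDiffOn ℝ ∞ (compX Φ) Φ.source ∧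
      ContDiffOn ℝ ∞ (compY Φ) Φ.source ∧ ContDiffOn ℝ ∞ (compU Φ) Φ.source :=
  ⟨h.fst.fst, h.fst.snd.fst, h.fst.snd.snd, h.snd⟩

theorem IsPointSymmetry.pd_t_y (hΦ : IsPointSymmetry Φ) (hP : P ∈ Φ.source) :
    pd dirX (compT Φ) P = 0 ∧ pd dirX (compY Φ) P = 0 ∧
      pd dirU (compT Φ) P = 0 ∧ pd dirU (compY Φ) P = 0 := by
  have hd := differentiableAt_of_contDiffAt (hΦ.1.contDiffAt hP)
  obtain ⟨h1, h2, h3, h4⟩ := hΦ.fderiv_t_y hP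
  have e : ((0, 1) : Total) = dirU := rfl
  rw [e] at h3 h4
  rw [pd_components hd] at h1 h2 h3 h4
  exact ⟨h1, h2, h3, h4⟩

theorem pd_total_decomp (G : Total → ℝ) (P w : Total) :
    pd w G P = w.1.1 * pd dirT G P + w.1.2.1 * pd dirX G P + w.1.2.2 * pd dirY G P
      + w.2 * pd dirU G P := by
  rw [← pd_smul_vec, ← pd_smul_vec, ← pd_smul_vec, ← pd_smul_vec, ← pd_add_vec, ← pd_add_vec,
    ← pd_add_vec]
  congr 1
  refine Prod.ext (Prod.ext ?_ (Prod.ext ?_ ?_)) ?_ <;> simp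

/-- The Jacobians of the `(t, y)`- and `(x, u)`-components of a point symmetry. -/
theorem IsPointSymmetry.jacobian_ne (hΦ : IsPointSymmetry Φ) (hP : P ∈ Φ.source) :
    pd dirT (compT Φ) P * pd dirY (compY Φ) P - pd dirY (compT Φ) P * pd dirT (compY Φ) P ≠ 0 ∧
      pd dirU (compU Φ) P * pd dirX (compX Φ) P
        - pd dirU (compX Φ) P * pd dirX (compU Φ) P ≠ 0 := by
  have hd := differentiableAt_of_contDiffAt (hΦ.1.contDiffAt hP)
  obtain ⟨h1, h2, h3, h4⟩ := hΦ.pd_t_y hP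
  have hs := (hΦ.1.bijective_fderiv hP).2
  have comps : ∀ v : Total, ∃ w : Total, pd w (compT Φ) P = v.1.1 ∧ pd w (compX Φ) P = v.1.2.1 ∧
      pd w (compY Φ) P = v.1.2.2 ∧ pd w (compU Φ) P = v.2 := by
    intro v
    obtain ⟨w, hw⟩ := hs v
    rw [pd_components hd] at hw
    subst hw
    exact ⟨w, rfl, rfl, rfl, rfl⟩
  obtain ⟨w, a1, a2, a3, a4⟩ := comps dirT
  obtain ⟨w', b1, b2, b3, b4⟩ := comps dirY
  obtain ⟨z, c1, c2, c3, c4⟩ := comps dirX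
  obtain ⟨z', e1, e2, e3, e4⟩ := comps dirU
  rw [pd_total_decomp] at a1 a2 a3 a4 b1 b2 b3 b4 c1 c2 c3 c4 e1 e2 e3 e4
  -- Since T and Y have no x- and u-derivatives, the Jacobian matrix is block triangular. Its
  -- invertibility gives that of the (t, y)-block and then of the (x, u)-block.
  simp only [h1, h2, h3, h4, mul_zero, add_zero] at a1 a3 b1 b3 c1 c3 e1 e3
  generalize pd dirT (compT Φ) P = Tt at *
  generalize pd dirY (compT Φ) P = Ty at *
  generalize pd dirT (compY Φ) P = Yt at *
  generalize pd dirY (compY Φ) P = Yy at *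
  have hne : Tt * Yy - Ty * Yt ≠ 0 := by
    intro h
    have : (Tt * Yy - Ty * Yt) * (w.1.1 * w'.1.2.2 - w.1.2.2 * w'.1.1) = 1 := by
      calc _ = (w.1.1 * Tt + w.1.2.2 * Ty) * (w'.1.1 * Yt + w'.1.2.2 * Yy)
            - (w'.1.1 * Tt + w'.1.2.2 * Ty) * (w.1.1 * Yt + w.1.2.2 * Yy) := by ring
        _ = 1 := by rw [a1, a3, b1, b3]; norm_num
    rw [h, zero_mul] at this
    exact zero_ne_one this
  refine ⟨hne, ?_⟩
  have van : ∀ z : Total, z.1.1 * Tt + z.1.2.2 * Ty = 0 → z.1.1 * Yt + z.1.2.2 * Yy = 0 →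
      z.1.1 = 0 ∧ z.1.2.2 = 0 := by
    intro z h5 h6
    constructor
    · refine (mul_eq_zero.mp ?_).resolve_left hne
      linear_combination Yy * h5 - Ty * h6
    · refine (mul_eq_zero.mp ?_).resolve_left hne
      linear_combination Tt * h6 - Yt * h5
  obtain ⟨z1, z2⟩ := van z c1 c3
  obtain ⟨z1', z2'⟩ := van z' e1 e3
  simp only [z1, z2, zero_mul, zero_add, add_zero] at c2 c4
  simp only [z1', z2', zero_mul, zero_add, add_zero] at e2 e4
  generalize pd dirX (compX Φ) P = Xx at *
  generalize pd dirU (compX Φ) P = Xu at *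
  generalize pd dirX (compU Φ) P = Ux at *
  generalize pd dirU (compU Φ) P = Uu at *
  intro h
  have : (Uu * Xx - Xu * Ux) * (z.1.2.1 * z'.2 - z.2 * z'.1.2.1) = 1 := by
    calc _ = (z.1.2.1 * Xx + z.2 * Xu) * (z'.1.2.1 * Ux + z'.2 * Uu)
            - (z'.1.2.1 * Xx + z'.2 * Xu) * (z.1.2.1 * Ux + z.2 * Uu) := by ring
        _ = 1 := by rw [c2, c4, e2, e4]; norm_num
  rw [h, zero_mul] at this
  exact zero_ne_one this

/-- The condition that the image of a solution with the 1-jet `(r, q, s)` satisfies the equation. -/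
theorem IsPointSymmetry.determining (hΦ : IsPointSymmetry Φ) (hP : P ∈ Φ.source) (r q s : ℝ)
    (hξ : pd dirX (compX Φ) P + q * pd dirU (compX Φ) P ≠ 0) :
    (pd dirX (compX Φ) P + q * pd dirU (compX Φ) P) ^ 2
      * ((pd dirY (compY Φ) P - compX Φ P * pd dirY (compT Φ) P)
          * ((pd dirT (compU Φ) P + r * pd dirU (compU Φ) P)
              * (pd dirX (compX Φ) P + q * pd dirU (compX Φ) P)
            - (pd dirX (compU Φ) P + q * pd dirU (compU Φ) P)
              * (pd dirT (compX Φ) P + r * pd dirU (compX Φ) P))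
        + (compX Φ P * pd dirT (compT Φ) P - pd dirT (compY Φ) P)
          * ((pd dirY (compU Φ) P + s * pd dirU (compU Φ) P)
              * (pd dirX (compX Φ) P + q * pd dirU (compX Φ) P)
            - (pd dirX (compU Φ) P + q * pd dirU (compU Φ) P)
              * (pd dirY (compX Φ) P + s * pd dirU (compX Φ) P)))
      = (pd dirT (compT Φ) P * pd dirY (compY Φ) P - pd dirY (compT Φ) P * pd dirT (compY Φ) P)
        * ((pd dirX (pd dirX (compU Φ)) P + 2 * q * pd dirX (pd dirU (compU Φ)) P
              + q ^ 2 * pd dirU (pd dirU (compU Φ)) P + (r + s * P.1.2.1) * pd dirU (compU Φ) P)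
            * (pd dirX (compX Φ) P + q * pd dirU (compX Φ) P)
          - (pd dirX (compU Φ) P + q * pd dirU (compU Φ) P)
            * (pd dirX (pd dirX (compX Φ)) P + 2 * q * pd dirX (pd dirU (compX Φ)) P
              + q ^ 2 * pd dirU (pd dirU (compX Φ)) P
              + (r + s * P.1.2.1) * pd dirU (compX Φ) P)) := by
  obtain ⟨p, c⟩ := P
  obtain ⟨sT, sX, sY, sU⟩ := contDiffOn_components hΦ.1.1
  obtain ⟨h1, h2, h3, h4⟩ := hΦ.pd_t_y hP
  have hdne := (hΦ.jacobian_ne hP).1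
  have hd := differentiableAt_of_contDiffAt (hΦ.1.contDiffAt hP)
  set f := jetSolution p c r q s with hfdef
  have hf : ContDiff ℝ ∞ f := contDiff_jetSolution p c r q s
  have hfp : f p = c := jetSolution_self p c r q s
  have hfv : ∀ v : Base, pd v f p = r * v.1 + q * v.2.1 + s * v.2.2 :=
    fderiv_jetSolution_self p c r q s
  have hfxx : pd (0, 1, 0) (pd (0, 1, 0) f) p = r + s * p.2.1 := pd_x_pd_x_jetSolution p c r q s p
  have hPf : (p, f p) ∈ Φ.source := by rwa [hfp]
  have hinj : Function.Injective (fderiv ℝ (baseImage Φ f) p) := by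
    refine (injective_iff_map_eq_zero (fderiv ℝ (baseImage Φ f) p)).mpr fun v hv => ?_
    rw [hfdef, fderiv_baseImage hΦ.1 c r q s hP, pd_components hd] at hv
    have e1 : pd (v, r * v.1 + q * v.2.1 + s * v.2.2) (compT Φ) (p, c) = 0 :=
      congrArg Prod.fst hv
    have e2 : pd (v, r * v.1 + q * v.2.1 + s * v.2.2) (compX Φ) (p, c) = 0 :=
      congrArg (fun w : Base => w.2.1) hv
    have e3 : pd (v, r * v.1 + q * v.2.1 + s * v.2.2) (compY Φ) (p, c) = 0 :=
      congrArg (fun w : Base => w.2.2) hv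
    rw [pd_total_decomp] at e1 e2 e3
    simp only [h1, h2, h3, h4, mul_zero, add_zero] at e1 e3
    have v1 : v.1 = 0 := by
      refine (mul_eq_zero.mp ?_).resolve_left hdne
      linear_combination pd dirY (compY Φ) (p, c) * e1 - pd dirY (compT Φ) (p, c) * e3
    have v3 : v.2.2 = 0 := by
      refine (mul_eq_zero.mp ?_).resolve_left hdne
      linear_combination pd dirT (compT Φ) (p, c) * e3 - pd dirT (compY Φ) (p, c) * e1
    simp only [v1, v3] at e2
    have v2 : v.2.1 = 0 := by
      refine (mul_eq_zero.mp ?_).resolve_left hξ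
      linear_combination e2
    exact Prod.ext v1 (Prod.ext v2 v3)
  obtain ⟨g, ρ, -, -, hev, hgb⟩ :=
    hΦ.exists_image_solution hf (kolmogorovOp_jetSolution p c r q s) hPf hinj
  obtain ⟨hg, hgsol, -, -⟩ := hev.self_of_nhds
  have hgr : ContinuousAt (fun x => (x, f x)) p :=
    continuousAt_id.prodMk hf.continuous.continuousAt
  have hbc : ContinuousAt (baseImage Φ f) p := (contDiffAt_baseImage hΦ.1.1 hf hPf).continuousAt
  have hfd : ∀ x, DifferentiableAt ℝ f x := fun x => differentiableAt_of_contDiffAt hf.contDiffAt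
  have hsrc : ∀ᶠ x in 𝓝 p, (x, f x) ∈ Φ.source := hgr.eventually (Φ.open_source.mem_nhds hPf)
  -- chain rule for the first derivatives
  have chain : ∀ k : Base → ℝ, ∀ x, DifferentiableAt ℝ k (baseImage Φ f x) → (x, f x) ∈ Φ.source →
      ∀ v, pd v (fun z => k (baseImage Φ f z)) x
        = pd v (fun z => compT Φ (z, f z)) x * pd (1, 0, 0) k (baseImage Φ f x)
          + pd v (fun z => compX Φ (z, f z)) x * pd (0, 1, 0) k (baseImage Φ f x)
          + pd v (fun z => compY Φ (z, f z)) x * pd (0, 0, 1) k (baseImage Φ f x) := by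
    intro k x hk hx v
    have hb := (differentiableAt_of_contDiffAt (contDiffAt_baseImage hΦ.1.1 hf hx)).hasFDerivAt
    have hT : HasFDerivAt (fun z => compT Φ (z, f z)) _ x := hb.fst
    have hX : HasFDerivAt (fun z => compX Φ (z, f z)) _ x := hb.snd.fst
    have hY : HasFDerivAt (fun z => compY Φ (z, f z)) _ x := hb.snd.snd
    have hk' : HasFDerivAt (fun z => k (baseImage Φ f z)) _ x :=
      HasFDerivAt.comp (g := k) (f := baseImage Φ f) x hk.hasFDerivAt hb
    rw [← pd_base_decomp]
    simp only [pd, hT.fderiv, hX.fderiv, hY.fderiv, hk'.fderiv]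
    rfl
  have vanish : ∀ᶠ x in 𝓝 p, pd (0, 1, 0) (fun z => compT Φ (z, f z)) x = 0 ∧
      pd (0, 1, 0) (fun z => compY Φ (z, f z)) x = 0 := by
    filter_upwards [hsrc] with x hx
    obtain ⟨k1, k2, k3, k4⟩ := hΦ.pd_t_y hx
    rw [pd_lift (hfd x) (differentiableAt_of_contDiffAt
        (sT.contDiffAt (Φ.open_source.mem_nhds hx))),
      pd_lift (hfd x) (differentiableAt_of_contDiffAt
        (sY.contDiffAt (Φ.open_source.mem_nhds hx))), k1, k2, k3, k4]
    simp
  have hgdiff : ∀ᶠ x in 𝓝 p, DifferentiableAt ℝ g (baseImage Φ f x) :=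
    hbc.eventually (hev.mono fun x hx => differentiableAt_of_contDiffAt hx.1)
  have hUeq : (fun x => g (baseImage Φ f x)) =ᶠ[𝓝 p] fun x => compU Φ (x, f x) := hgb
  -- Along the graph, T and Y have zero total x-derivative, so only g_X enters. Differentiating
  -- again in x therefore brings in only g_XX.
  have first : (pd (0, 1, 0) fun z => compU Φ (z, f z)) =ᶠ[𝓝 p]
      fun x => pd (0, 1, 0) (fun z => compX Φ (z, f z)) x * pd (0, 1, 0) g (baseImage Φ f x) := by
    filter_upwards [hsrc, vanish, hgdiff, hUeq.eventually_nhds] with x k1 k2 k3 k4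
    rw [← pd_congr _ k4, chain g x k3 k1, k2.1, k2.2]
    ring
  have hcompX : ContDiffAt ℝ ∞ (fun z => compX Φ (z, f z)) p :=
    (contDiffAt_baseImage hΦ.1.1 hf hPf).snd.fst
  have hgx : ContDiffAt ℝ ∞ (fun x => pd (0, 1, 0) g (baseImage Φ f x)) p :=
    ContDiffAt.comp p (contDiffAt_pd (0, 1, 0) hg) (contDiffAt_baseImage hΦ.1.1 hf hPf)
  have second := pd_congr (0, 1, 0) first
  rw [pd_mul _ (differentiableAt_of_contDiffAt (contDiffAt_pd _ hcompX))
    (differentiableAt_of_contDiffAt hgx),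
    chain (pd (0, 1, 0) g) p (differentiableAt_of_contDiffAt (contDiffAt_pd _ hg)) hPf,
    vanish.self_of_nhds.1, vanish.self_of_nhds.2, pd_x_pd_x_lift hf Φ.open_source sU hPf,
    pd_x_pd_x_lift hf Φ.open_source sX hPf] at second
  have fx := first.self_of_nhds
  have ft := chain g p (differentiableAt_of_contDiffAt hg) hPf (1, 0, 0)
  have fy := chain g p (differentiableAt_of_contDiffAt hg) hPf (0, 0, 1)
  rw [pd_congr _ hUeq] at ft fy
  have lift : ∀ (G : Total → ℝ), ContDiffOn ℝ ∞ G Φ.source → ∀ v : Base,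
      pd v (fun z => G (z, f z)) p
        = pd (v, 0) G (p, c) + (r * v.1 + q * v.2.1 + s * v.2.2) * pd dirU G (p, c) := by
    intro G hG v
    rw [pd_lift (hfd p) (differentiableAt_of_contDiffAt
      (hG.contDiffAt (Φ.open_source.mem_nhds hPf))), hfv, hfp]
  simp only [lift _ sT, lift _ sX, lift _ sY, lift _ sU, h3, h4, hfp, hfxx, hfv] at second fx ft fy
  have eqn : pd (1, 0, 0) g (baseImage Φ f p) + compX Φ (p, c) * pd (0, 0, 1) g (baseImage Φ f p)
      = pd (0, 1, 0) (pd (0, 1, 0) g) (baseImage Φ f p) := by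
    have hX : (baseImage Φ f p).2.1 = compX Φ (p, c) := by simp only [baseImage, compX, hfp]
    rw [kolmogorovOp, pd_base_decomp 1 0, hX] at hgsol
    linear_combination hgsol
  simp only [mul_one, mul_zero, add_zero, zero_add, zero_mul] at second fx ft fy
  generalize pd (1, 0, 0) g (baseImage Φ f p) = gT at *
  generalize pd (0, 1, 0) g (baseImage Φ f p) = gX at *
  generalize pd (0, 0, 1) g (baseImage Φ f p) = gY at *
  rw [← eqn] at second
  -- With U_t, U_y, U_x expressed through g_T, g_X, g_Y, cross-multiplication cancels g_X on the
  -- left. The combination with Y_y − X·T_y and X·T_t − Y_t amounts to Cramer's rule for g_T +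
  -- X·g_Y, which equals g_XX.
  rw [ft, fy, fx]
  linear_combination (-(pd dirT (compT Φ) (p, c) * pd dirY (compY Φ) (p, c)
    - pd dirY (compT Φ) (p, c) * pd dirT (compY Φ) (p, c)))
      * (pd dirX (compX Φ) (p, c) + q * pd dirU (compX Φ) (p, c)) * second

end Determining


/-! ### Splitting the determining equation with respect to the 1-jet -/

section Consequences

variable {Φ : OpenPartialHomeomorph Total Total} {P : Total}

/-- The determining equation is affine in r and s, and differences of its values isolate their
coefficients. After cancellation of the (x, u)-Jacobian these carry the factor (X_x + qX_u)² on one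
side only. -/
theorem IsPointSymmetry.first_order (hΦ : IsPointSymmetry Φ) (hP : P ∈ Φ.source) :
    pd dirU (compX Φ) P = 0 ∧ pd dirX (compX Φ) P ≠ 0 ∧ pd dirU (compU Φ) P ≠ 0 ∧
      (pd dirY (compY Φ) P - compX Φ P * pd dirY (compT Φ) P) * pd dirX (compX Φ) P ^ 2
        = pd dirT (compT Φ) P * pd dirY (compY Φ) P
          - pd dirY (compT Φ) P * pd dirT (compY Φ) P ∧
      compX Φ P * pd dirT (compT Φ) P - pd dirT (compY Φ) P
        = P.1.2.1 * (pd dirY (compY Φ) P - compX Φ P * pd dirY (compT Φ) P) := by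
  obtain ⟨hd, hΔ⟩ := hΦ.jacobian_ne hP
  have hA : ∀ q, pd dirX (compX Φ) P + q * pd dirU (compX Φ) P ≠ 0 →
      (pd dirX (compX Φ) P + q * pd dirU (compX Φ) P) ^ 2
        * (pd dirY (compY Φ) P - compX Φ P * pd dirY (compT Φ) P)
      = pd dirT (compT Φ) P * pd dirY (compY Φ) P
          - pd dirY (compT Φ) P * pd dirT (compY Φ) P := by
    intro q hq
    have e0 := hΦ.determining hP 0 q 0 hq
    have e1 := hΦ.determining hP 1 q 0 hq
    refine mul_right_cancel₀ hΔ ?_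
    linear_combination e1 - e0
  have hC : ∀ q, pd dirX (compX Φ) P + q * pd dirU (compX Φ) P ≠ 0 →
      (pd dirX (compX Φ) P + q * pd dirU (compX Φ) P) ^ 2
        * (compX Φ P * pd dirT (compT Φ) P - pd dirT (compY Φ) P)
      = P.1.2.1 * (pd dirT (compT Φ) P * pd dirY (compY Φ) P
          - pd dirY (compT Φ) P * pd dirT (compY Φ) P) := by
    intro q hq
    have e0 := hΦ.determining hP 0 q 0 hq
    have e1 := hΦ.determining hP 0 q 1 hq
    refine mul_right_cancel₀ hΔ ?_
    linear_combination e1 - e0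
  -- If X_u ≠ 0, the quantity X_x + qX_u takes the values 1 and 2, and the same coefficient times 1
  -- and times 4 would equal the nonzero (t, y)-Jacobian.
  have hXu : pd dirU (compX Φ) P = 0 := by
    by_contra hne
    have hξ : ∀ z : ℝ, pd dirX (compX Φ) P
        + (z - pd dirX (compX Φ) P) / pd dirU (compX Φ) P * pd dirU (compX Φ) P = z := by
      intro z; field_simp; ring
    have e1 := hA ((1 - pd dirX (compX Φ) P) / pd dirU (compX Φ) P) (by rw [hξ]; norm_num)
    have e2 := hA ((2 - pd dirX (compX Φ) P) / pd dirU (compX Φ) P) (by rw [hξ]; norm_num)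
    rw [hξ] at e1 e2
    exact hd (by linarith)
  rw [hXu, zero_mul, sub_zero] at hΔ
  have hXx := right_ne_zero_of_mul hΔ
  have hUu := left_ne_zero_of_mul hΔ
  have a := hA 0 (by simpa using hXx)
  have c := hC 0 (by simpa using hXx)
  rw [zero_mul, add_zero] at a c
  refine ⟨hXu, hXx, hUu, by linear_combination a, ?_⟩
  refine mul_left_cancel₀ (pow_ne_zero 2 hXx) ?_
  linear_combination c - P.1.2.1 * a

/-- With X_u = 0 and r = s = 0 the determining equation is quadratic in q. Its values at q = 0, 1,
−1 give the three coefficients. -/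
theorem IsPointSymmetry.second_order (hΦ : IsPointSymmetry Φ) (hP : P ∈ Φ.source) :
    pd dirU (pd dirU (compU Φ)) P = 0 ∧
      pd dirU (compU Φ) P * (pd dirT (compX Φ) P + P.1.2.1 * pd dirY (compX Φ) P)
        = pd dirU (compU Φ) P * pd dirX (pd dirX (compX Φ)) P
          - 2 * pd dirX (pd dirU (compU Φ)) P * pd dirX (compX Φ) P ∧
      (pd dirT (compU Φ) P + P.1.2.1 * pd dirY (compU Φ) P) * pd dirX (compX Φ) P
          - pd dirX (compU Φ) P * (pd dirT (compX Φ) P + P.1.2.1 * pd dirY (compX Φ) P)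
        = pd dirX (pd dirX (compU Φ)) P * pd dirX (compX Φ) P
          - pd dirX (compU Φ) P * pd dirX (pd dirX (compX Φ)) P := by
  have hd := (hΦ.jacobian_ne hP).1
  obtain ⟨hXu, hXx, hUu, hA, hC⟩ := hΦ.first_order hP
  have hz : pd dirU (compX Φ) =ᶠ[𝓝 P] fun _ => 0 := by
    filter_upwards [Φ.open_source.mem_nhds hP] with Q hQ using (hΦ.first_order hQ).1
  have hXxu : pd dirX (pd dirU (compX Φ)) P = 0 := by rw [pd_congr _ hz, pd_const]
  have hXuu : pd dirU (pd dirU (compX Φ)) P = 0 := by rw [pd_congr _ hz, pd_const]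
  have hq : ∀ q : ℝ, (pd dirT (compU Φ) P * pd dirX (compX Φ) P
      - (pd dirX (compU Φ) P + q * pd dirU (compU Φ) P) * pd dirT (compX Φ) P)
      + P.1.2.1 * (pd dirY (compU Φ) P * pd dirX (compX Φ) P
        - (pd dirX (compU Φ) P + q * pd dirU (compU Φ) P) * pd dirY (compX Φ) P)
      = (pd dirX (pd dirX (compU Φ)) P + 2 * q * pd dirX (pd dirU (compU Φ)) P
          + q ^ 2 * pd dirU (pd dirU (compU Φ)) P) * pd dirX (compX Φ) P
        - (pd dirX (compU Φ) P + q * pd dirU (compU Φ) P) * pd dirX (pd dirX (compX Φ)) P := by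
    intro q
    have e := hΦ.determining hP 0 q 0 (by rw [hXu, mul_zero, add_zero]; exact hXx)
    rw [hXu, hXxu, hXuu, hC, ← hA] at e
    rw [← hA] at hd
    refine mul_left_cancel₀ hd ?_
    linear_combination e
  have q0 := hq 0
  have q1 := hq 1
  have q2 := hq (-1)
  refine ⟨?_, by linear_combination (q2 - q1) / 2, by linear_combination q0⟩
  refine (mul_eq_zero.mp ?_).resolve_right hXx
  linear_combination q0 - q1 / 2 - q2 / 2

end Consequences

/-! ### The algebra of smooth functions on an open set -/

section SmoothFun

/-- The extension by zero of a function on a set. -/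
noncomputable def extendZero {S : Set Total} (F : S → ℝ) : Total → ℝ :=
  Function.extend Subtype.val F 0

variable {S : Set Total}

theorem extendZero_apply (F : S → ℝ) (P : S) : extendZero F P = F P :=
  Subtype.val_injective.extend_apply F 0 P

theorem eqOn_extendZero {F : S → ℝ} {G : Total → ℝ} (h : ∀ P : S, F P = G P) :
    EqOn (extendZero F) G S :=
  fun P hP => (extendZero_apply F ⟨P, hP⟩).trans (h ⟨P, hP⟩)

/-- The algebra of smooth functions on a set. -/
noncomputable def smoothFun (S : Set Total) : Subalgebra ℝ (S → ℝ) where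
  carrier := {F | ContDiffOn ℝ ∞ (extendZero F) S}
  mul_mem' {F G} hF hG := (hF.mul hG).congr (eqOn_extendZero fun P => by
    simp [extendZero_apply])
  add_mem' {F G} hF hG := (hF.add hG).congr (eqOn_extendZero fun P => by
    simp [extendZero_apply])
  algebraMap_mem' c := (contDiffOn_const (c := c)).congr (eqOn_extendZero fun _ => rfl)

/-- The restriction of a smooth function. -/
noncomputable def toSmoothFun (G : Total → ℝ) (hG : ContDiffOn ℝ ∞ G S) : smoothFun S :=
  ⟨fun P => G P, hG.congr (eqOn_extendZero fun _ => rfl)⟩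

theorem pd_extendZero_congr (hS : IsOpen S) {F : S → ℝ} {G : Total → ℝ}
    (h : ∀ P : S, F P = G P) (v : Total) (P : S) : pd v (extendZero F) P = pd v G P :=
  pd_congr v ((eqOn_extendZero h).eventuallyEq_of_mem (hS.mem_nhds P.2))

theorem contDiffAt_extendZero (hS : IsOpen S) (F : smoothFun S) (P : S) :
    ContDiffAt ℝ ∞ (extendZero F.1) P :=
  F.2.contDiffAt (hS.mem_nhds P.2)

theorem contDiffOn_pd (hS : IsOpen S) {G : Total → ℝ} (hG : ContDiffOn ℝ ∞ G S) (v : Total) :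
    ContDiffOn ℝ ∞ (pd v G) S :=
  fun _ hP => (contDiffAt_pd v (hG.contDiffAt (hS.mem_nhds hP))).contDiffWithinAt

/-- The directional derivative as a derivation of the algebra of smooth functions. -/
noncomputable def derSmooth (hS : IsOpen S) (v : Total) :
    Derivation ℝ (smoothFun S) (smoothFun S) :=
  Derivation.mk'
    { toFun := fun F => toSmoothFun (pd v (extendZero F.1)) (contDiffOn_pd hS F.2 v)
      map_add' := fun F G => by
        ext P
        change pd v (extendZero (F.1 + G.1)) P = pd v (extendZero F.1) P + pd v (extendZero G.1) P
        rw [← pd_add v (differentiableAt_of_contDiffAt (contDiffAt_extendZero hS F P))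
          (differentiableAt_of_contDiffAt (contDiffAt_extendZero hS G P))]
        exact pd_extendZero_congr hS (fun Q => by simp [extendZero_apply]) v P
      map_smul' := fun c F => by
        ext P
        change pd v (extendZero (c • F.1)) P = c * pd v (extendZero F.1) P
        have h := pd_mul v (differentiableAt_const c)
          (differentiableAt_of_contDiffAt (contDiffAt_extendZero hS F P))
        rw [pd_const, mul_zero, add_zero] at h
        rw [← h]
        exact pd_extendZero_congr hS (fun Q => by simp [extendZero_apply]) v P }
    fun F G => by
      ext P
      change pd v (extendZero (F.1 * G.1)) P
        = F.1 P * pd v (extendZero G.1) P + G.1 P * pd v (extendZero F.1) P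
      rw [← extendZero_apply F.1 P, ← extendZero_apply G.1 P,
        ← pd_mul v (differentiableAt_of_contDiffAt (contDiffAt_extendZero hS F P))
          (differentiableAt_of_contDiffAt (contDiffAt_extendZero hS G P))]
      exact pd_extendZero_congr hS (fun Q => by simp [extendZero_apply]) v P

theorem derSmooth_apply (hS : IsOpen S) (v : Total) (F : smoothFun S) (P : S) :
    (derSmooth hS v F : S → ℝ) P = pd v (extendZero F.1) P := rfl

theorem derSmooth_toSmoothFun (hS : IsOpen S) (v : Total) {G : Total → ℝ}
    (hG : ContDiffOn ℝ ∞ G S) :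
    derSmooth hS v (toSmoothFun G hG) = toSmoothFun (pd v G) (contDiffOn_pd hS hG v) := by
  ext P
  exact pd_extendZero_congr hS (fun Q => rfl) v P

theorem derSmooth_derSmooth_apply (hS : IsOpen S) (v w : Total) (F : smoothFun S) (P : S) :
    (derSmooth hS v (derSmooth hS w F) : S → ℝ) P = pd v (pd w (extendZero F.1)) P := by
  rw [derSmooth_apply]
  exact pd_extendZero_congr hS (G := pd w (extendZero F.1)) (fun Q => rfl) v P

theorem derSmooth_comm (hS : IsOpen S) (v w : Total) (F : smoothFun S) :
    derSmooth hS v (derSmooth hS w F) = derSmooth hS w (derSmooth hS v F) := by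
  ext P
  rw [derSmooth_derSmooth_apply, derSmooth_derSmooth_apply]
  exact pd_comm (contDiffAt_extendZero hS F P) v w

theorem exists_mul_eq_one (hS : IsOpen S) (F : smoothFun S) (hF : ∀ P, F.1 P ≠ 0) :
    ∃ G : smoothFun S, F * G = 1 := by
  refine ⟨⟨fun P => (F.1 P)⁻¹, ?_⟩, ?_⟩
  · refine ContDiffOn.congr (f := fun P => (extendZero F.1 P)⁻¹) (fun P hP => ?_)
      (eqOn_extendZero fun P => by rw [extendZero_apply])
    refine ((contDiffAt_extendZero hS F ⟨P, hP⟩).inv ?_).contDiffWithinAt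
    rw [extendZero_apply F.1 ⟨P, hP⟩]
    exact hF _
  · ext P
    exact mul_inv_cancel₀ (hF P)

/-- Connectedness of the domain enters here: it makes the constants of integration the same at all
points. -/
theorem smoothFun_const (hS : IsOpen S) (hS' : IsPreconnected S) (F : smoothFun S)
    (hT : derSmooth hS dirT F = 0) (hX : derSmooth hS dirX F = 0) (hY : derSmooth hS dirY F = 0)
    (hU : derSmooth hS dirU F = 0) (P Q : S) : F.1 P = F.1 Q := by
  have hz : ∀ R ∈ S, fderiv ℝ (extendZero F.1) R = 0 := by
    intro R hR
    refine ContinuousLinearMap.ext fun w => ?_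
    have e : ∀ v, derSmooth hS v F = 0 → pd v (extendZero F.1) R = 0 := fun v hv =>
      congrFun (congrArg Subtype.val hv) ⟨R, hR⟩
    have := pd_total_decomp (extendZero F.1) R w
    rw [e _ hT, e _ hX, e _ hY, e _ hU] at this
    simpa [pd] using this
  have hd : DifferentiableOn ℝ (extendZero F.1) S := fun R hR =>
    (differentiableAt_of_contDiffAt (contDiffAt_extendZero hS F ⟨R, hR⟩)).differentiableWithinAt
  have := hS.is_const_of_fderiv_eq_zero hS' hd hz P.2 Q.2
  rwa [extendZero_apply, extendZero_apply] at this

end SmoothFun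


/-! ### Consequences of the determining equations in a differential algebra -/

section DifferentialAlgebra

variable {R : Type*} [CommRing R] [Algebra ℝ R]

theorem der_ofNat (D : Derivation ℝ R R) (n : ℕ) [n.AtLeastTwo] :
    D (ofNat(n) : R) = 0 :=
  D.map_natCast n

theorem eq_zero_of_ofNat_mul (n : ℕ) [n.AtLeastTwo] {z : R} (h : (OfNat.ofNat n : R) * z = 0) :
    z = 0 := by
  have h1 : algebraMap ℝ R (OfNat.ofNat n) = (OfNat.ofNat n : R) := map_ofNat _ n
  have h2 : algebraMap ℝ R (OfNat.ofNat n)⁻¹ * algebraMap ℝ R (OfNat.ofNat n) = 1 := by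
    rw [← map_mul, inv_mul_cancel₀ (OfNat.ofNat_ne_zero n), map_one]
  calc z = (algebraMap ℝ R (OfNat.ofNat n)⁻¹ * algebraMap ℝ R (OfNat.ofNat n)) * z := by
        rw [h2, one_mul]
    _ = algebraMap ℝ R (OfNat.ofNat n)⁻¹ * ((OfNat.ofNat n : R) * z) := by rw [h1, mul_assoc]
    _ = 0 := by rw [h, mul_zero]

/-- The derivative of an inverse. -/
theorem der_inverse (D : Derivation ℝ R R) {a b : R} (h : a * b = 1) : D b = -(b ^ 2 * D a) := by
  have h1 : a * D b + b * D a = 0 := by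
    have := congrArg D h
    rwa [D.leibniz, D.map_one_eq_zero, smul_eq_mul, smul_eq_mul] at this
  linear_combination b * h1 - D b * h

variable {Dt Dx Dy Du : Derivation ℝ R R} {T X Y x : R}

/-- The first group of consequences: the `t`-component depends only on `t`. -/
theorem base_components (hxt : ∀ z, Dx (Dt z) = Dt (Dx z)) (hxy : ∀ z, Dx (Dy z) = Dy (Dx z))
    (hx : Dx x = 1) (hTx : Dx T = 0) (hYx : Dx Y = 0) {di : R}
    (hdi : (Dt T * Dy Y - Dy T * Dt Y) * di = 1)
    (hA : (Dy Y - X * Dy T) * Dx X ^ 2 = Dt T * Dy Y - Dy T * Dt Y)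
    (hC : X * Dt T - Dt Y = x * (Dy Y - X * Dy T)) :
    Dy T = 0 ∧ X * Dt T = Dt Y + x * Dy Y ∧ Dy Y ^ 2 = Dt T ^ 3 := by
  have hTtx : Dx (Dt T) = 0 := by rw [hxt, hTx, map_zero]
  have hTyx : Dx (Dy T) = 0 := by rw [hxy, hTx, map_zero]
  have hYtx : Dx (Dt Y) = 0 := by rw [hxt, hYx, map_zero]
  have hYyx : Dx (Dy Y) = 0 := by rw [hxy, hYx, map_zero]
  have h1 : X * (Dt T + x * Dy T) = Dt Y + x * Dy Y := by linear_combination hC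
  -- The x-derivative of `h1`; X is the only factor besides x itself that depends on x.
  have h2 : X * Dy T + (Dt T + x * Dy T) * Dx X = Dy Y := by
    have := congrArg Dx h1
    simpa [Derivation.leibniz, hTtx, hTyx, hYtx, hYyx, hx] using this
  have h3 : (Dy Y - X * Dy T) * (Dt T + x * Dy T) = Dt T * Dy Y - Dy T * Dt Y := by
    linear_combination -Dy T * h1
  generalize hd : Dt T * Dy Y - Dy T * Dt Y = d at *
  generalize hτ : Dt T + x * Dy T = τ at *
  have h4 : Dx X * τ ^ 2 = d := by linear_combination h3 + τ * h2
  have h5 : Dx X ^ 3 * τ = d := by linear_combination hA + Dx X ^ 2 * h2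
  -- X_x is eliminated from X_x·τ² = d and X_x³·τ = d, and the unit d is cancelled.
  have h6 : d ^ 2 = τ ^ 5 := by
    have h7 : d * (d ^ 2 - τ ^ 5) = 0 := by
      linear_combination -(Dx X ^ 2 * τ ^ 4 + Dx X * τ ^ 2 * d + d ^ 2) * h4 + τ ^ 5 * h5
    linear_combination di * h7 - (d ^ 2 - τ ^ 5) * hdi
  have hdx : Dx d = 0 := by
    rw [← hd]; simp [Derivation.leibniz, hTtx, hTyx, hYtx, hYyx]
  have hτx : Dx τ = Dy T := by
    rw [← hτ]; simp [Derivation.leibniz, hTtx, hTyx, hx]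
  -- d does not depend on x while τ_x = T_y, so the x-derivative of `h6` kills τ⁴T_y; τ is a unit.
  have h8 : 5 * (τ ^ 4 * Dy T) = 0 := by
    have := congrArg Dx h6
    simp [Derivation.leibniz_pow, hdx, hτx] at this
    linear_combination -this
  have h9 := eq_zero_of_ofNat_mul 5 h8
  have hu : τ * ((Dy Y - X * Dy T) * di) = 1 := by linear_combination hdi + di * h3
  have hTy : Dy T = 0 := by
    calc Dy T = (τ * ((Dy Y - X * Dy T) * di)) ^ 4 * Dy T := by rw [hu]; ring
      _ = ((Dy Y - X * Dy T) * di) ^ 4 * (τ ^ 4 * Dy T) := by ring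
      _ = 0 := by rw [h9, mul_zero]
  rw [hTy, mul_zero, add_zero] at hτ
  rw [hTy, zero_mul, sub_zero] at hd
  refine ⟨hTy, by rw [hτ]; exact h1, ?_⟩
  rw [hτ] at hd ⊢
  rw [hTy, mul_zero, sub_zero] at hu
  have h10 : τ ^ 2 * (Dy Y ^ 2 - τ ^ 3) = 0 := by
    rw [← hd] at h6; linear_combination h6
  calc Dy Y ^ 2 = τ ^ 3 + (τ * (Dy Y * di)) ^ 2 * (Dy Y ^ 2 - τ ^ 3) := by rw [hu]; ring
    _ = τ ^ 3 + (Dy Y * di) ^ 2 * (τ ^ 2 * (Dy Y ^ 2 - τ ^ 3)) := by ring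
    _ = τ ^ 3 := by rw [h10, mul_zero, add_zero]

/-- The second group of consequences: the normal form of the base components in terms of functions
of `t`. -/
theorem normal_form (hyt : ∀ z, Dy (Dt z) = Dt (Dy z)) (hxt : ∀ z, Dx (Dt z) = Dt (Dx z))
    (hxy : ∀ z, Dx (Dy z) = Dy (Dx z)) (hut : ∀ z, Du (Dt z) = Dt (Du z))
    (huy : ∀ z, Du (Dy z) = Dy (Du z)) {y wi : R} (hty : Dt y = 0) (hxy' : Dx y = 0)
    (hyy : Dy y = 1) (huy' : Du y = 0) (hTx : Dx T = 0) (hTy : Dy T = 0) (hTu : Du T = 0)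
    (hYx : Dx Y = 0) (hYu : Du Y = 0) (hX : X * Dt T = Dt Y + x * Dy Y)
    (hYy : Dy Y ^ 2 = Dt T ^ 3) (hwi : Dy Y * wi = 1) :
    ∃ ρ ρi H : R, ρ * ρi = 1 ∧ ρ ^ 2 * Dt T = 1 ∧ ρ ^ 3 * Y = y + H ∧
      Dx ρ = 0 ∧ Dy ρ = 0 ∧ Du ρ = 0 ∧ Dx H = 0 ∧ Dy H = 0 ∧ Du H = 0 ∧
      X = ρi * (x + Dt H) - 3 * Dt ρ * ρi ^ 2 * (y + H) := by
  have hwx : Dx (Dy Y) = 0 := by rw [hxy, hYx, map_zero]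
  have hwu : Du (Dy Y) = 0 := by rw [huy, hYu, map_zero]
  have hTtx : Dx (Dt T) = 0 := by rw [hxt, hTx, map_zero]
  have hTty : Dy (Dt T) = 0 := by rw [hyt, hTy, map_zero]
  have hTtu : Du (Dt T) = 0 := by rw [hut, hTu, map_zero]
  have hwy : Dy (Dy Y) = 0 := by
    have := congrArg Dy hYy
    simp [Derivation.leibniz_pow, hTty] at this
    have h2 := eq_zero_of_ofNat_mul 2 (z := Dy Y * Dy (Dy Y)) (by linear_combination this)
    linear_combination wi * h2 - Dy (Dy Y) * hwi
  -- ρ is T_t/Y_y. By Y_y² = T_t³, both ρ²T_t and ρ³Y_y equal 1, so no square root of T_t has to be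
  -- chosen.
  have e1 : (Dt T * wi) ^ 2 * Dt T = 1 := by
    linear_combination -wi ^ 2 * hYy + (Dy Y * wi + 1) * hwi
  have e2 : (Dt T * wi) ^ 3 * Dy Y = 1 := by
    linear_combination (Dt T * wi) ^ 2 * Dt T * hwi + e1
  have e3 : (Dt T * wi) * (Dt T * wi * Dt T) = 1 := by linear_combination e1
  have ρD : ∀ D : Derivation ℝ R R, D (Dt T) = 0 → D (Dy Y) = 0 → D (Dt T * wi) = 0 := by
    intro D h1 h2
    simp [Derivation.leibniz, der_inverse D hwi, h1, h2]
  have hρx := ρD Dx hTtx hwx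
  have hρy := ρD Dy hTty hwy
  have hρu := ρD Du hTtu hwu
  generalize Dt T * wi = ρ at *
  generalize hρi : ρ * Dt T = ρi at *
  refine ⟨ρ, ρi, ρ ^ 3 * Y - y, e3, e1, by ring, hρx, hρy, hρu, ?_, ?_, ?_, ?_⟩
  · simp [Derivation.leibniz, Derivation.leibniz_pow, hρx, hYx, hxy']
  · simp [Derivation.leibniz, Derivation.leibniz_pow, hρy, hyy]
    linear_combination e2
  · simp [Derivation.leibniz, Derivation.leibniz_pow, hρu, hYu, huy']
  · simp [Derivation.leibniz, Derivation.leibniz_pow, hty]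
    have h1 : X = ρ ^ 2 * (Dt Y + x * Dy Y) := by linear_combination -X * e1 + ρ ^ 2 * hX
    have h2 : ρ ^ 2 * Dy Y = ρi := by linear_combination -ρ ^ 2 * Dy Y * e3 + ρi * e2
    rw [h1, mul_add, ← mul_assoc, mul_comm _ x, mul_assoc, h2]
    linear_combination (-(ρ ^ 2 * Dt Y) + 3 * Dt ρ * Y * ρ * (ρ * ρi + 1)
      - 3 * Dt ρ * Y * ρ) * e3

end DifferentialAlgebra


/-! ### Ordinary differential equations for ρ and H and their constants of integration -/

section DifferentialAlgebra

variable {R : Type*} [CommRing R] [Algebra ℝ R]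
variable {Dt Dx Dy Du : Derivation ℝ R R} {T x y ρ ρi H N Ni κ b e : R}

/-- The first logarithmic derivatives of the multiplier `N` along `x` and along the drift determine
its logarithmic `y`-derivative, and force the functions of `t` to satisfy ordinary differential
equations. -/
theorem multiplier_system (hxt : ∀ z, Dx (Dt z) = Dt (Dx z)) (hxy : ∀ z, Dx (Dy z) = Dy (Dx z))
    (hyt : ∀ z, Dy (Dt z) = Dt (Dy z)) (htx : Dt x = 0) (hxx : Dx x = 1) (hyx : Dy x = 0)
    (hty : Dt y = 0) (hxy' : Dx y = 0) (hyy : Dy y = 1) (hHx : Dx H = 0) (hHy : Dy H = 0)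
    (hbt : Dt b = e - b ^ 2) (hbx : Dx b = 0) (hby : Dy b = 0)
    (hκ : κ = -4 * b * (x + Dt H) + Dt (Dt H) + (6 * b ^ 2 - 3 * e) * (y + H))
    (hN : N * Ni = 1) (hNx : 2 * Dx N = -(κ * N))
    (hNt : Dt N + x * Dy N = κ * Dx N + Dx (Dx N)) :
    e = 0 ∧ Dt (Dt (Dt (Dt H))) = 0 ∧ 4 * (Dt N + x * Dy N) = -((κ ^ 2 - 8 * b) * N) ∧
      2 * Dy N = (-6 * b ^ 2 * (x + Dt H) + 12 * b ^ 3 * (y + H) + Dt (Dt (Dt H))) * N := by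
  have hH1x : Dx (Dt H) = 0 := by rw [hxt, hHx, map_zero]
  have hH1y : Dy (Dt H) = 0 := by rw [hyt, hHy, map_zero]
  have hH2x : Dx (Dt (Dt H)) = 0 := by rw [hxt, hH1x, map_zero]
  have hH2y : Dy (Dt (Dt H)) = 0 := by rw [hyt, hH1y, map_zero]
  have hH3x : Dx (Dt (Dt (Dt H))) = 0 := by rw [hxt, hH2x, map_zero]
  have hH3y : Dy (Dt (Dt (Dt H))) = 0 := by rw [hyt, hH2y, map_zero]
  have he : e = Dt b + b ^ 2 := by rw [hbt]; ring
  have hex : Dx e = 0 := by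
    rw [he]; simp [Derivation.leibniz_pow, hbx, hxt]
  have hey : Dy e = 0 := by
    rw [he]; simp [Derivation.leibniz_pow, hby, hyt]
  have hκx : Dx κ = -4 * b := by
    rw [hκ]
    simp [Derivation.leibniz, Derivation.leibniz_pow, der_ofNat, hbx, hxx, hxy', hHx, hex, hH1x,
      hH2x]
  have hκy : Dy κ = 6 * b ^ 2 - 3 * e := by
    rw [hκ]
    simp [Derivation.leibniz, Derivation.leibniz_pow, der_ofNat, hby, hyx, hyy, hHy, hey, hH1y,
      hH2y]
  have cancel : ∀ z : R, z * N = 0 → z = 0 := fun z hz => by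
    linear_combination Ni * hz - z * hN
  have a1 : 4 * (Dt N + x * Dy N) = -((κ ^ 2 - 8 * b) * N) := by
    have h := congrArg Dx hNx
    simp [Derivation.leibniz, der_ofNat, hκx] at h
    linear_combination 4 * hNt + 2 * h + κ * hNx
  -- The commutator of ∂_x with the drift ∂_t + x∂_y is ∂_y. Cross-differentiating the two known
  -- logarithmic derivatives therefore yields the third.
  have a2 : 2 * Dy N = (Dt κ + x * Dy κ - κ * Dx κ) * N := by
    have h := congrArg Dx a1
    have ht := congrArg Dt hNx
    have hy := congrArg Dy hNx
    simp [Derivation.leibniz, Derivation.leibniz_pow, der_ofNat, hκx, hbx, hxx, hxt, hxy]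
      at h ht hy
    have h2 : 4 * (2 * Dy N - (Dt κ + x * Dy κ - κ * Dx κ) * N) = 0 := by
      rw [hκx]
      linear_combination 2 * h - 4 * ht - 4 * x * hy + κ * a1 - (κ ^ 2 - 8 * b) * hNx
    linear_combination eq_zero_of_ofNat_mul 4 h2
  generalize hG : Dt κ + x * Dy κ - κ * Dx κ = G at *
  -- Compatibility of the logarithmic x- and y-derivatives, −κ/2 and G/2.
  have a3 : Dy κ + Dx G = 0 := by
    have h := congrArg Dx a2
    have h' := congrArg Dy hNx
    simp [Derivation.leibniz, der_ofNat, hxy] at h h'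
    refine cancel _ (eq_zero_of_ofNat_mul 2 ?_)
    linear_combination -2 * h + 2 * h' - G * hNx - κ * a2
  have hκt : Dt κ = -4 * (e - b ^ 2) * (x + Dt H) - 4 * b * Dt (Dt H) + Dt (Dt (Dt H))
      + (12 * b * (e - b ^ 2) - 3 * Dt e) * (y + H) + (6 * b ^ 2 - 3 * e) * Dt H := by
    rw [hκ]
    simp [Derivation.leibniz, Derivation.leibniz_pow, der_ofNat, hbt, htx, hty]
    ring
  -- All terms with b² cancel in the compatibility condition, which reduces to −10e = 0.
  have he0 : e = 0 := by
    rw [← hG, hκt, hκy, hκx] at a3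
    simp [Derivation.leibniz, Derivation.leibniz_pow, der_ofNat, hbx, hxx, hxy', hHx, hex, hH1x,
      hH2x, hH3x, hxt, hκx] at a3
    refine eq_zero_of_ofNat_mul 10 ?_
    linear_combination -a3
  subst he0
  have hG' : G = -6 * b ^ 2 * (x + Dt H) + 12 * b ^ 3 * (y + H) + Dt (Dt (Dt H)) := by
    rw [← hG, hκt, hκy, hκx, hκ, map_zero]
    ring
  refine ⟨rfl, ?_, a1, hG' ▸ a2⟩
  -- ∂_y commutes with the drift, so the corresponding logarithmic derivatives are compatible; this
  -- is the equation H'''' = 0.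
  have a4 : Dt G + x * Dy G + κ * Dy κ = 0 := by
    have h := congrArg Dt a2
    have h' := congrArg Dy a1
    have h2 := congrArg Dy a2
    simp [Derivation.leibniz, Derivation.leibniz_pow, der_ofNat, hyx, hyt, hby] at h h' h2
    refine cancel _ (eq_zero_of_ofNat_mul 4 ?_)
    linear_combination 2 * h' - 4 * h - 4 * x * h2 - G * a1 - (κ ^ 2 - 8 * b) * a2
  rw [hκy, hκ, hG'] at a4
  simp [Derivation.leibniz, Derivation.leibniz_pow, der_ofNat, hbt, hby, hyx, hyy, hHy, hH1y, hH3y,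
    htx, hty] at a4
  linear_combination a4

/-- The logarithmic `x`-derivative of the multiplier in terms of functions of `t`. -/
theorem kappa_formula {X : R} (htx : Dt x = 0) (hyx : Dy x = 0)
    (hty : Dt y = 0) (hyy : Dy y = 1) (hHy : Dy H = 0) (hH1y : Dy (Dt H) = 0)
    (hρ : ρ * ρi = 1) (hρy : Dy ρ = 0) (hρty : Dy (Dt ρ) = 0)
    (hX : X = ρi * (x + Dt H) - 3 * Dt ρ * ρi ^ 2 * (y + H)) :
    ρ * (Dt X + x * Dy X) = -4 * (Dt ρ * ρi) * (x + Dt H) + Dt (Dt H)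
      + (6 * (Dt ρ * ρi) ^ 2 - 3 * (Dt (Dt ρ) * ρi)) * (y + H) := by
  have hρit : Dt ρi = -(ρi ^ 2 * Dt ρ) := der_inverse Dt hρ
  have hρiy : Dy ρi = 0 := by rw [der_inverse Dy hρ, hρy, mul_zero, neg_zero]
  rw [hX]
  simp [Derivation.leibniz, Derivation.leibniz_pow, der_ofNat, htx, hty, hyx, hyy, hHy, hH1y, hρit,
    hρiy, hρty]
  linear_combination (-4 * (Dt ρ * ρi) * (x + Dt H) + Dt (Dt H)
      + (6 * (Dt ρ * ρi) ^ 2 - 3 * (Dt (Dt ρ) * ρi)) * (y + H)) * hρ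

/-- The constants of the fractional linear transformation of `t`. -/
theorem moebius_constants {D : Derivation ℝ R R} {t τt : R} (hρ : ρ * ρi = 1) (hT : ρ ^ 2 * τt = 1)
    {θ γ : R} (hD : D T = θ * τt) (hDt : D t = θ) (hDρ : D ρ = θ * γ) (hDγ : D γ = 0) :
    D (ρ - t * γ) = 0 ∧ D (T * γ + ρi) = 0 ∧ D (T * (ρ - t * γ) - t * ρi) = 0 := by
  have hτ : τt = ρi ^ 2 := by
    linear_combination ρi ^ 2 * hT - τt * (ρ * ρi + 1) * hρ
  have hρi := der_inverse D hρ
  refine ⟨?_, ?_, ?_⟩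
  · simp [Derivation.leibniz, hDt, hDρ, hDγ]; ring
  · simp [Derivation.leibniz, hD, hDρ, hDγ, hρi, hτ]; ring
  · simp [Derivation.leibniz, hD, hDt, hDρ, hDγ, hρi, hτ]
    linear_combination θ * ρi * hρ

/-- The constants of the polynomial `H`. -/
theorem cubic_constants {D : Derivation ℝ R R} {t H1 H2 H3 θ : R} (hDt : D t = θ)
    (h0 : D H = θ * H1) (h1 : D H1 = θ * H2) (h2 : D H2 = θ * H3) (h3 : D H3 = 0) :
    D (H2 - t * H3) = 0 ∧ D (2 * H1 - 2 * t * H2 + t ^ 2 * H3) = 0 ∧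
      D (6 * H - 6 * t * H1 + 3 * t ^ 2 * H2 - t ^ 3 * H3) = 0 := by
  refine ⟨?_, ?_, ?_⟩ <;>
    simp [Derivation.leibniz, Derivation.leibniz_pow, der_ofNat, hDt, h0, h1, h2, h3] <;> ring

end DifferentialAlgebra


/-! ### Solving the determining equations -/

section DifferentialAlgebra

variable {R : Type*} [CommRing R] [Algebra ℝ R]
variable {Dt Dx Dy Du : Derivation ℝ R R} {T X Y U t x y u : R}

/-- The general solution of the determining equations in terms of functions of `t`. -/
theorem determining_solution (hxt : ∀ z, Dx (Dt z) = Dt (Dx z))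
    (hxy : ∀ z, Dx (Dy z) = Dy (Dx z)) (hyt : ∀ z, Dy (Dt z) = Dt (Dy z))
    (hut : ∀ z, Du (Dt z) = Dt (Du z)) (hux : ∀ z, Du (Dx z) = Dx (Du z))
    (huy : ∀ z, Du (Dy z) = Dy (Du z))
    (htx : Dt x = 0) (hxx : Dx x = 1) (hyx : Dy x = 0) (hux' : Du x = 0)
    (hty : Dt y = 0) (hxy' : Dx y = 0) (hyy : Dy y = 1) (huy' : Du y = 0)
    (htu : Dt u = 0) (hxu : Dx u = 0) (hyu : Dy u = 0) (huu : Du u = 1)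
    (hTx : Dx T = 0) (hTu : Du T = 0) (hYx : Dx Y = 0) (hYu : Du Y = 0)
    {di Ni : R} (hdi : (Dt T * Dy Y - Dy T * Dt Y) * di = 1) (hNi : Du U * Ni = 1)
    (hA : (Dy Y - X * Dy T) * Dx X ^ 2 = Dt T * Dy Y - Dy T * Dt Y)
    (hC : X * Dt T - Dt Y = x * (Dy Y - X * Dy T))
    (hUu : Du (Du U) = 0)
    (hB : Du U * (Dt X + x * Dy X) = Du U * Dx (Dx X) - 2 * Dx (Du U) * Dx X)
    (hE : (Dt U + x * Dy U) * Dx X - Dx U * (Dt X + x * Dy X)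
      = Dx (Dx U) * Dx X - Dx U * Dx (Dx X)) :
    ∃ ρ ρi H F κ : R, ρ * ρi = 1 ∧ ρ ^ 2 * Dt T = 1 ∧ ρ ^ 3 * Y = y + H ∧
      Dx ρ = 0 ∧ Dy ρ = 0 ∧ Du ρ = 0 ∧ Dx H = 0 ∧ Dy H = 0 ∧ Du H = 0 ∧
      X = ρi * (x + Dt H) - 3 * Dt ρ * ρi ^ 2 * (y + H) ∧
      Dy T = 0 ∧ Dt (Dt ρ) = 0 ∧ Dt (Dt (Dt (Dt H))) = 0 ∧
      κ = -4 * (Dt ρ * ρi) * (x + Dt H) + Dt (Dt H) + 6 * (Dt ρ * ρi) ^ 2 * (y + H) ∧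
      2 * Dx (Du U) = -(κ * Du U) ∧
      4 * (Dt (Du U) + x * Dy (Du U)) = -((κ ^ 2 - 8 * (Dt ρ * ρi)) * Du U) ∧
      2 * Dy (Du U) = (-6 * (Dt ρ * ρi) ^ 2 * (x + Dt H) + 12 * (Dt ρ * ρi) ^ 3 * (y + H)
        + Dt (Dt (Dt H))) * Du U ∧
      U = Du U * (u + F) ∧ Du F = 0 ∧ Dt F + x * Dy F = Dx (Dx F) := by
  obtain ⟨hTy, hX1, hYy⟩ := base_components hxt hxy hxx hTx hYx hdi hA hC
  have hwi : Dy Y * (Dt T * di) = 1 := by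
    rw [hTy] at hdi; linear_combination hdi
  obtain ⟨ρ, ρi, H, hρ, hρT, hρY, hρx, hρy, hρu, hHx, hHy, hHu, hX⟩ :=
    normal_form hyt hxt hxy hut huy hty hxy' hyy huy' hTx hTy hTu hYx hYu hX1 hYy hwi
  have hH1x : Dx (Dt H) = 0 := by rw [hxt, hHx, map_zero]
  have hH1y : Dy (Dt H) = 0 := by rw [hyt, hHy, map_zero]
  have hH1u : Du (Dt H) = 0 := by rw [hut, hHu, map_zero]
  have hH2u : Du (Dt (Dt H)) = 0 := by rw [hut, hH1u, map_zero]
  have hρtx : Dx (Dt ρ) = 0 := by rw [hxt, hρx, map_zero]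
  have hρty : Dy (Dt ρ) = 0 := by rw [hyt, hρy, map_zero]
  have hρtu : Du (Dt ρ) = 0 := by rw [hut, hρu, map_zero]
  have hρix : Dx ρi = 0 := by rw [der_inverse Dx hρ, hρx, mul_zero, neg_zero]
  have hρiy : Dy ρi = 0 := by rw [der_inverse Dy hρ, hρy, mul_zero, neg_zero]
  have hρiu : Du ρi = 0 := by rw [der_inverse Du hρ, hρu, mul_zero, neg_zero]
  have hXx : Dx X = ρi := by
    rw [hX]
    simp [Derivation.leibniz, Derivation.leibniz_pow, der_ofNat, hxx, hxy', hHx, hH1x, hρtx, hρix]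
  have hκ := kappa_formula htx hyx hty hyy hHy hH1y hρ hρy hρty hX
  generalize hκX : ρ * (Dt X + x * Dy X) = κ at hκ
  rw [hXx, hρix] at hB hE
  have hNx : 2 * Dx (Du U) = -(κ * Du U) := by
    rw [← hκX]; linear_combination ρ * hB - 2 * Dx (Du U) * hρ
  have hU : Dt U + x * Dy U = κ * Dx U + Dx (Dx U) := by
    rw [← hκX]; linear_combination ρ * hE - (Dt U + x * Dy U - Dx (Dx U)) * hρ
  have hκu : Du κ = 0 := by
    rw [hκ]
    simp [Derivation.leibniz, Derivation.leibniz_pow, der_ofNat, hux', huy', hHu, hH1u, hH2u, hρtu,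
      hρiu, hut]
  -- The u-derivative of the equation for U, since κ does not depend on u.
  have hNt : Dt (Du U) + x * Dy (Du U) = κ * Dx (Du U) + Dx (Dx (Du U)) := by
    have h := congrArg Du hU
    simp [Derivation.leibniz, hut, huy, hux, hux', hκu] at h
    exact h
  have hbt : Dt (Dt ρ * ρi) = Dt (Dt ρ) * ρi - (Dt ρ * ρi) ^ 2 := by
    simp [Derivation.leibniz, der_inverse Dt hρ]; ring
  have hbx : Dx (Dt ρ * ρi) = 0 := by simp [Derivation.leibniz, hρtx, hρix]
  have hby : Dy (Dt ρ * ρi) = 0 := by simp [Derivation.leibniz, hρty, hρiy]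
  obtain ⟨he, hH4, h1, h2⟩ := multiplier_system hxt hxy hyt htx hxx hyx hty hxy' hyy hHx hHy
    hbt hbx hby hκ hNi hNx hNt
  rw [he, mul_zero, sub_zero] at hκ
  have hρtt : Dt (Dt ρ) = 0 := by linear_combination ρ * he - Dt (Dt ρ) * hρ
  -- The function F = U/U_u − u is independent of u because U_uu = 0.
  refine ⟨ρ, ρi, H, U * Ni - u, κ, hρ, hρT, hρY, hρx, hρy, hρu, hHx, hHy, hHu, hX, hTy, hρtt, hH4,
    hκ, hNx, h1, h2, by linear_combination -U * hNi, ?_, ?_⟩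
  · simp [Derivation.leibniz, der_inverse Du hNi, hUu, huu]
    linear_combination hNi
  · have hF : U = Du U * (u + (U * Ni - u)) := by linear_combination -U * hNi
    generalize U * Ni - u = F at hF
    have hFx : Dx U = Du U * Dx F + (u + F) * Dx (Du U) := by
      conv_lhs => rw [hF]
      simp [Derivation.leibniz, hxu]
    have hFt : Dt U = Du U * Dt F + (u + F) * Dt (Du U) := by
      conv_lhs => rw [hF]
      simp [Derivation.leibniz, htu]
    have hFy : Dy U = Du U * Dy F + (u + F) * Dy (Du U) := by
      conv_lhs => rw [hF]
      simp [Derivation.leibniz, hyu]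
    have hFxx : Dx (Dx U) = Du U * Dx (Dx F) + Dx F * Dx (Du U)
        + ((u + F) * Dx (Dx (Du U)) + Dx (Du U) * Dx F) := by
      rw [hFx]
      simp [Derivation.leibniz, hxu]
    rw [hFxx, hFx, hFt, hFy] at hU
    -- In the equation for U, the terms with u + F cancel by the equation for U_u, and those with
    -- F_x cancel by its logarithmic x-derivative.
    have h3 : Du U * (Dt F + x * Dy F - Dx (Dx F)) = 0 := by
      linear_combination hU - (u + F) * hNt + Dx F * hNx
    linear_combination Ni * h3 - (Dt F + x * Dy F - Dx (Dx F)) * hNi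

end DifferentialAlgebra


/-! ### Transfer to smooth functions on the domain of a symmetry -/

section Evaluation

variable {S : Set Total}

/-- The evaluation of smooth functions at a point. -/
noncomputable def evalAt (P : S) : smoothFun S →ₐ[ℝ] ℝ :=
  (Pi.evalAlgHom ℝ (fun _ : S => ℝ) P).comp (smoothFun S).val

theorem smoothFun_ext {F G : smoothFun S} (h : ∀ P, evalAt P F = evalAt P G) : F = G :=
  Subtype.ext (funext h)

theorem evalAt_apply (F : smoothFun S) (P : S) : evalAt P F = (F : S → ℝ) P := rfl

theorem evalAt_toSmoothFun {G : Total → ℝ} (hG : ContDiffOn ℝ ∞ G S) (P : S) :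
    evalAt P (toSmoothFun G hG) = G P := rfl

theorem evalAt_derSmooth (hS : IsOpen S) (v : Total) {G : Total → ℝ}
    (hG : ContDiffOn ℝ ∞ G S) (P : S) :
    evalAt P (derSmooth hS v (toSmoothFun G hG)) = pd v G P := by
  rw [derSmooth_toSmoothFun]; rfl

theorem evalAt_derSmooth_derSmooth (hS : IsOpen S) (v w : Total) {G : Total → ℝ}
    (hG : ContDiffOn ℝ ∞ G S) (P : S) :
    evalAt P (derSmooth hS v (derSmooth hS w (toSmoothFun G hG))) = pd v (pd w G) P := by
  rw [derSmooth_toSmoothFun, derSmooth_toSmoothFun]; rfl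

theorem derSmooth_linear (hS : IsOpen S) (v : Total) (L : Total →L[ℝ] ℝ) :
    derSmooth hS v (toSmoothFun L L.contDiff.contDiffOn) = algebraMap ℝ (smoothFun S) (L v) := by
  refine smoothFun_ext fun P => ?_
  rw [evalAt_derSmooth, AlgHom.commutes, pd, L.fderiv]
  rfl

theorem pd_comp_fst {f : Base → ℝ} {P : Total} (hf : DifferentiableAt ℝ f P.1) (v : Total) :
    pd v (fun Q : Total => f Q.1) P = pd v.1 f P.1 := by
  have h : HasFDerivAt (fun Q : Total => f Q.1) _ P := hf.hasFDerivAt.comp P hasFDerivAt_fst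
  rw [pd, h.fderiv]
  rfl

end Evaluation

/-- Equal logarithmic derivatives make the ratio constant. The factor 4 clears the denominators of
the logarithmic derivatives of the multiplier. -/
theorem der_ratio {R : Type*} [CommRing R] [Algebra ℝ R] {D : Derivation ℝ R R} {N m mi c : R}
    (hmi : m * mi = 1) (hN : 4 * D N = c * N) (hm : 4 * D m = c * m) : D (N * mi) = 0 := by
  refine eq_zero_of_ofNat_mul 4 ?_
  simp [Derivation.leibniz, der_inverse D hmi]
  linear_combination mi * hN - N * mi ^ 2 * hm - c * N * mi * hmi

/-- The coordinate `t`. -/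
def coordT : Total →L[ℝ] ℝ := (ContinuousLinearMap.fst ℝ ℝ (ℝ × ℝ)).comp (ContinuousLinearMap.fst ℝ Base ℝ)

/-- The coordinate `x`. -/
def coordX : Total →L[ℝ] ℝ := ((ContinuousLinearMap.fst ℝ ℝ ℝ).comp
  (ContinuousLinearMap.snd ℝ ℝ (ℝ × ℝ))).comp (ContinuousLinearMap.fst ℝ Base ℝ)

/-- The coordinate `y`. -/
def coordY : Total →L[ℝ] ℝ := ((ContinuousLinearMap.snd ℝ ℝ ℝ).comp
  (ContinuousLinearMap.snd ℝ ℝ (ℝ × ℝ))).comp (ContinuousLinearMap.fst ℝ Base ℝ)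

/-- The coordinate `u`. -/
def coordU : Total →L[ℝ] ℝ := ContinuousLinearMap.snd ℝ Base ℝ

section SmoothFun

variable {S : Set Total} (hS : IsOpen S)

/-- The restriction of a linear function to a set. -/
noncomputable def linSmooth (S : Set Total) (L : Total →L[ℝ] ℝ) : smoothFun S :=
  toSmoothFun L L.contDiff.contDiffOn

theorem derSmooth_linSmooth_zero {v : Total} {L : Total →L[ℝ] ℝ} (h : L v = 0) :
    derSmooth hS v (linSmooth S L) = 0 := by
  rw [linSmooth, derSmooth_linear, h, map_zero]

theorem derSmooth_linSmooth_one {v : Total} {L : Total →L[ℝ] ℝ} (h : L v = 1) :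
    derSmooth hS v (linSmooth S L) = 1 := by
  rw [linSmooth, derSmooth_linear, h, map_one]

end SmoothFun

theorem IsPointSymmetry.determining_solution {Φ : OpenPartialHomeomorph Total Total}
    (hΦ : IsPointSymmetry Φ) {Dt Dx Dy Du : Derivation ℝ (smoothFun Φ.source) (smoothFun Φ.source)}
    (hDt : Dt = derSmooth Φ.open_source dirT) (hDx : Dx = derSmooth Φ.open_source dirX)
    (hDy : Dy = derSmooth Φ.open_source dirY) (hDu : Du = derSmooth Φ.open_source dirU)
    {T X Y U x y u : smoothFun Φ.source}
    (hT : T = toSmoothFun (compT Φ) (contDiffOn_components hΦ.1.1).1)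
    (hX : X = toSmoothFun (compX Φ) (contDiffOn_components hΦ.1.1).2.1)
    (hY : Y = toSmoothFun (compY Φ) (contDiffOn_components hΦ.1.1).2.2.1)
    (hU : U = toSmoothFun (compU Φ) (contDiffOn_components hΦ.1.1).2.2.2)
    (hx : x = linSmooth Φ.source coordX)
    (hy : y = linSmooth Φ.source coordY) (hu : u = linSmooth Φ.source coordU) :
    Dx T = 0 ∧ Du T = 0 ∧ Du (Du U) = 0 ∧ (∃ Ni, Du U * Ni = 1) ∧
    ∃ ρ ρi H F κ : smoothFun Φ.source,
      ρ * ρi = 1 ∧ ρ ^ 2 * Dt T = 1 ∧ ρ ^ 3 * Y = y + H ∧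
      Dx ρ = 0 ∧ Dy ρ = 0 ∧ Du ρ = 0 ∧ Dx H = 0 ∧ Dy H = 0 ∧ Du H = 0 ∧
      X = ρi * (x + Dt H) - 3 * Dt ρ * ρi ^ 2 * (y + H) ∧
      Dy T = 0 ∧ Dt (Dt ρ) = 0 ∧ Dt (Dt (Dt (Dt H))) = 0 ∧
      κ = -4 * (Dt ρ * ρi) * (x + Dt H) + Dt (Dt H) + 6 * (Dt ρ * ρi) ^ 2 * (y + H) ∧
      2 * Dx (Du U) = -(κ * Du U) ∧
      4 * (Dt (Du U) + x * Dy (Du U)) = -((κ ^ 2 - 8 * (Dt ρ * ρi)) * Du U) ∧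
      2 * Dy (Du U) = (-6 * (Dt ρ * ρi) ^ 2 * (x + Dt H) + 12 * (Dt ρ * ρi) ^ 3 * (y + H)
        + Dt (Dt (Dt H))) * Du U ∧
      U = Du U * (u + F) ∧ Du F = 0 ∧ Dt F + x * Dy F = Dx (Dx F) := by
  have hS := Φ.open_source
  have comm : ∀ v w z, derSmooth hS v (derSmooth hS w z) = derSmooth hS w (derSmooth hS v z) :=
    derSmooth_comm hS
  have hTx : Dx T = 0 := by
    subst hDx hT
    exact smoothFun_ext fun P => by rw [evalAt_derSmooth, map_zero, (hΦ.pd_t_y P.2).1]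
  have hYx : Dx Y = 0 := by
    subst hDx hY
    exact smoothFun_ext fun P => by rw [evalAt_derSmooth, map_zero, (hΦ.pd_t_y P.2).2.1]
  have hTu : Du T = 0 := by
    subst hDu hT
    exact smoothFun_ext fun P => by rw [evalAt_derSmooth, map_zero, (hΦ.pd_t_y P.2).2.2.1]
  have hYu : Du Y = 0 := by
    subst hDu hY
    exact smoothFun_ext fun P => by rw [evalAt_derSmooth, map_zero, (hΦ.pd_t_y P.2).2.2.2]
  have hUuu : Du (Du U) = 0 := by
    subst hDu hU
    exact smoothFun_ext fun P => by
      rw [evalAt_derSmooth_derSmooth, map_zero, (hΦ.second_order P.2).1]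
  obtain ⟨Ni, hNi⟩ : ∃ Ni, Du U * Ni = 1 := by
    refine exists_mul_eq_one hS _ fun P => ?_
    subst hDu hU
    rw [← evalAt_apply]
    rw [evalAt_derSmooth]
    exact (hΦ.first_order P.2).2.2.1
  obtain ⟨di, hdi⟩ : ∃ di, (Dt T * Dy Y - Dy T * Dt Y) * di = 1 := by
    refine exists_mul_eq_one hS _ fun P => ?_
    subst hDt hDy hT hY
    rw [← evalAt_apply]
    simp only [map_sub (evalAt P), map_mul (evalAt P), evalAt_derSmooth]
    exact (hΦ.jacobian_ne P.2).1
  refine ⟨hTx, hTu, hUuu, ⟨Ni, hNi⟩, ?_⟩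
  have hA : (Dy Y - X * Dy T) * Dx X ^ 2 = Dt T * Dy Y - Dy T * Dt Y := by
    subst hDt hDx hDy hT hX hY
    refine smoothFun_ext fun P => ?_
    simp only [map_sub (evalAt P), map_mul (evalAt P), map_pow (evalAt P), evalAt_derSmooth,
      evalAt_toSmoothFun]
    exact (hΦ.first_order P.2).2.2.2.1
  have hC : X * Dt T - Dt Y = x * (Dy Y - X * Dy T) := by
    subst hDt hDy hT hX hY hx
    refine smoothFun_ext fun P => ?_
    simp only [map_sub (evalAt P), map_mul (evalAt P), evalAt_derSmooth, linSmooth,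
      evalAt_toSmoothFun]
    exact (hΦ.first_order P.2).2.2.2.2
  have hB : Du U * (Dt X + x * Dy X) = Du U * Dx (Dx X) - 2 * Dx (Du U) * Dx X := by
    subst hDt hDx hDy hDu hX hU hx
    refine smoothFun_ext fun P => ?_
    simp only [map_sub (evalAt P), map_add (evalAt P), map_mul (evalAt P), evalAt_derSmooth,
      evalAt_derSmooth_derSmooth, linSmooth, evalAt_toSmoothFun, map_ofNat (evalAt P)]
    exact (hΦ.second_order P.2).2.1
  have hE : (Dt U + x * Dy U) * Dx X - Dx U * (Dt X + x * Dy X)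
      = Dx (Dx U) * Dx X - Dx U * Dx (Dx X) := by
    subst hDt hDx hDy hX hU hx
    refine smoothFun_ext fun P => ?_
    simp only [map_sub (evalAt P), map_add (evalAt P), map_mul (evalAt P), evalAt_derSmooth,
      evalAt_derSmooth_derSmooth, linSmooth, evalAt_toSmoothFun]
    exact (hΦ.second_order P.2).2.2
  refine Kolmogorov.determining_solution (Du := Du) ?_ ?_ ?_ ?_ ?_ ?_ ?_ ?_ ?_ ?_ ?_ ?_ ?_ ?_ ?_ ?_
    ?_ ?_ hTx hTu hYx hYu hdi hNi hA hC hUuu hB hE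
  all_goals subst hDt hDx hDy hDu
  any_goals exact comm _ _
  all_goals subst hx hy hu
  all_goals first
    | exact derSmooth_linSmooth_zero hS rfl
    | exact derSmooth_linSmooth_one hS rfl


/-! ### Recovering the constant parameters -/

section Constants

variable {R : Type*} [CommRing R] [Algebra ℝ R] {Dt Dx Dy Du : Derivation ℝ R R}
  {T X Y t x y ρ ρi H κ : R}

/-- Meant for the derivations along x, y and u, which annihilate every function of t. The derivation
along t is treated by `moebius_constants` and `cubic_constants`. -/
theorem constant_combinations {D : Derivation ℝ R R} (hDt : ∀ z, D (Dt z) = Dt (D z))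
    (ht : D t = 0) (hT : D T = 0) (hρ : ρ * ρi = 1) (hDρ : D ρ = 0) (hDH : D H = 0) :
    D (Dt ρ) = 0 ∧ D (ρ - t * Dt ρ) = 0 ∧ D (T * Dt ρ + ρi) = 0 ∧
      D (T * (ρ - t * Dt ρ) - t * ρi) = 0 ∧ D (Dt (Dt (Dt H))) = 0 ∧
      D (Dt (Dt H) - t * Dt (Dt (Dt H))) = 0 ∧
      D (2 * Dt H - 2 * t * Dt (Dt H) + t ^ 2 * Dt (Dt (Dt H))) = 0 ∧
      D (6 * H - 6 * t * Dt H + 3 * t ^ 2 * Dt (Dt H) - t ^ 3 * Dt (Dt (Dt H))) = 0 := by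
  simp [Derivation.leibniz, Derivation.leibniz_pow, der_ofNat, hDt, ht, hT, hDρ, hDH,
    der_inverse D hρ]

/-- The constant parameters in terms of the functions of `t`. -/
theorem exists_params_of_functions {ι : Type*} [Nonempty ι] (ev : ι → R →ₐ[ℝ] ℝ)
    (const : ∀ z, Dt z = 0 → Dx z = 0 → Dy z = 0 → Du z = 0 → ∀ P Q, ev P z = ev Q z)
    (hxt : ∀ z, Dx (Dt z) = Dt (Dx z)) (hyt : ∀ z, Dy (Dt z) = Dt (Dy z))
    (hut : ∀ z, Du (Dt z) = Dt (Du z)) (htt : Dt t = 1) (htx : Dx t = 0) (hty : Dy t = 0)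
    (htu : Du t = 0) (hTx : Dx T = 0) (hTy : Dy T = 0) (hTu : Du T = 0)
    (hρ : ρ * ρi = 1) (hρT : ρ ^ 2 * Dt T = 1) (hρY : ρ ^ 3 * Y = y + H)
    (hρx : Dx ρ = 0) (hρy : Dy ρ = 0) (hρu : Du ρ = 0) (hHx : Dx H = 0) (hHy : Dy H = 0)
    (hHu : Du H = 0) (hX : X = ρi * (x + Dt H) - 3 * Dt ρ * ρi ^ 2 * (y + H))
    (hρtt : Dt (Dt ρ) = 0) (hH4 : Dt (Dt (Dt (Dt H))) = 0)
    (hκ : κ = -4 * (Dt ρ * ρi) * (x + Dt H) + Dt (Dt H) + 6 * (Dt ρ * ρi) ^ 2 * (y + H)) :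
    ∃ a : Params, ∀ P, a.den (ev P t) ≠ 0 ∧
      a.baseMap (ev P t, ev P x, ev P y) = (ev P T, ev P X, ev P Y) ∧
      a.kappa (ev P t, ev P x, ev P y) = ev P κ ∧ a.γ / a.den (ev P t) = ev P (Dt ρ * ρi) ∧
      2 * a.kappaY (ev P t, ev P x, ev P y) = ev P (-6 * (Dt ρ * ρi) ^ 2 * (x + Dt H)
        + 12 * (Dt ρ * ρi) ^ 3 * (y + H) + Dt (Dt (Dt H))) := by
  have mt := moebius_constants (D := Dt) (T := T) (t := t) (θ := 1) (γ := Dt ρ) hρ hρT (by ring)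
    htt (by ring) hρtt
  have ct := cubic_constants (D := Dt) (t := t) (θ := 1) htt (one_mul (Dt H)).symm
    (one_mul (Dt (Dt H))).symm (one_mul (Dt (Dt (Dt H)))).symm hH4
  obtain ⟨x1, x2, x3, x4, x5, x6, x7, x8⟩ := constant_combinations hxt htx hTx hρ hρx hHx
  obtain ⟨y1, y2, y3, y4, y5, y6, y7, y8⟩ := constant_combinations hyt hty hTy hρ hρy hHy
  obtain ⟨u1, u2, u3, u4, u5, u6, u7, u8⟩ := constant_combinations hut htu hTu hρ hρu hHu
  obtain ⟨P₀⟩ := ‹Nonempty ι›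
  have kγ := fun P => const _ hρtt x1 y1 u1 P₀ P
  have kδ := fun P => const _ mt.1 x2 y2 u2 P₀ P
  have kα := fun P => const _ mt.2.1 x3 y3 u3 P₀ P
  have kβ := fun P => const _ mt.2.2 x4 y4 u4 P₀ P
  have k3 := fun P => const _ hH4 x5 y5 u5 P₀ P
  have k2 := fun P => const _ ct.1 x6 y6 u6 P₀ P
  have k1 := fun P => const _ ct.2.1 x7 y7 u7 P₀ P
  have k0 := fun P => const _ ct.2.2 x8 y8 u8 P₀ P
  -- The determinant of the recovered matrix collapses to ρ·ρ⁻¹.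
  have hdet : ev P₀ (T * Dt ρ + ρi) * ev P₀ (ρ - t * Dt ρ)
      - ev P₀ (T * (ρ - t * Dt ρ) - t * ρi) * ev P₀ (Dt ρ) = 1 := by
    rw [← map_mul, ← map_mul, ← map_sub, ← map_one (ev P₀)]
    congr 1
    linear_combination hρ
  -- γ = ρ', δ = ρ − tρ', α = Tγ + 1/ρ, β = Tδ − t/ρ. The λᵢ are the coefficients of the cubic H,
  -- obtained by Taylor expansion from t back to 0. The value σ = 1 is provisional.
  refine ⟨⟨_, _, _, _,
    ev P₀ (6 * H - 6 * t * Dt H + 3 * t ^ 2 * Dt (Dt H) - t ^ 3 * Dt (Dt (Dt H))) / 6,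
    ev P₀ (2 * Dt H - 2 * t * Dt (Dt H) + t ^ 2 * Dt (Dt (Dt H))) / 2,
    ev P₀ (Dt (Dt H) - t * Dt (Dt (Dt H))) / 2, ev P₀ (Dt (Dt (Dt H))) / 6, 1, hdet,
    one_ne_zero⟩, fun P => ?_⟩
  simp only [Params.baseMap, Params.kappa, Params.kappaY, Params.xHat, Params.yHat, Params.den]
  rw [kγ P, kδ P, kα P, kβ P, k3 P, k2 P, k1 P, k0 P]
  have hρ' := congrArg (ev P) hρ
  have hρY' := congrArg (ev P) hρY
  rw [hX, hκ]
  simp only [map_mul, map_add, map_sub, map_pow, map_neg, map_ofNat, map_one] at hρ' hρY' ⊢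
  generalize ev P ρ = r at *
  have hr : r ≠ 0 := left_ne_zero_of_mul (hρ'.trans_ne one_ne_zero)
  have hri : ev P ρi = r⁻¹ := eq_inv_of_mul_eq_one_right hρ'
  have hY' : ev P Y = (ev P y + ev P H) / r ^ 3 := by
    rw [eq_div_iff (pow_ne_zero 3 hr), ← hρY', mul_comm]
  rw [hri, hY']
  generalize ev P (Dt ρ) = g
  have e1 : g * ev P t + (r - ev P t * g) = r := by ring
  rw [e1]
  refine ⟨hr, Prod.ext ?_ (Prod.ext ?_ ?_), ?_, ?_, ?_⟩
  · simp only
    field_simp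
    ring
  · simp only
    field_simp
    ring
  · simp only
    congr 1
    ring
  · field_simp
    ring
  · rw [div_eq_mul_inv]
  · field_simp
    ring

end Constants


/-! ### Every point symmetry with connected domain is locally of the form (*) -/

/-- The constant parameters and the functional parameter of a point symmetry with connected
domain. -/
theorem IsPointSymmetry.exists_params {Φ : OpenPartialHomeomorph Total Total}
    (hΦ : IsPointSymmetry Φ) (hconn : IsConnected Φ.source) :
    ∃ (a : Params) (G : Total → ℝ), ContDiffOn ℝ ∞ G Φ.source ∧ ∀ P ∈ Φ.source,
      a.den P.1.1 ≠ 0 ∧ Φ P = (a.baseMap P.1, a.multiplier P.1 * (P.2 + G P)) ∧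
      pd dirU G P = 0 ∧ pd dirT G P + P.1.2.1 * pd dirY G P = pd dirX (pd dirX G) P := by
  have hS := Φ.open_source
  have comm : ∀ v w z, derSmooth hS v (derSmooth hS w z) = derSmooth hS w (derSmooth hS v z) :=
    derSmooth_comm hS
  obtain ⟨P₀, hP₀⟩ := hconn.nonempty
  have hne : Nonempty Φ.source := ⟨⟨P₀, hP₀⟩⟩
  obtain ⟨Dt, hDt⟩ : ∃ D, D = derSmooth hS dirT := ⟨_, rfl⟩
  obtain ⟨Dx, hDx⟩ : ∃ D, D = derSmooth hS dirX := ⟨_, rfl⟩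
  obtain ⟨Dy, hDy⟩ : ∃ D, D = derSmooth hS dirY := ⟨_, rfl⟩
  obtain ⟨Du, hDu⟩ : ∃ D, D = derSmooth hS dirU := ⟨_, rfl⟩
  obtain ⟨T, hT⟩ : ∃ z, z = toSmoothFun (compT Φ) (contDiffOn_components hΦ.1.1).1 := ⟨_, rfl⟩
  obtain ⟨X, hX⟩ : ∃ z, z = toSmoothFun (compX Φ) (contDiffOn_components hΦ.1.1).2.1 := ⟨_, rfl⟩
  obtain ⟨Y, hY⟩ : ∃ z, z = toSmoothFun (compY Φ) (contDiffOn_components hΦ.1.1).2.2.1 := ⟨_, rfl⟩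
  obtain ⟨U, hU⟩ : ∃ z, z = toSmoothFun (compU Φ) (contDiffOn_components hΦ.1.1).2.2.2 := ⟨_, rfl⟩
  obtain ⟨t, ht⟩ : ∃ z, z = linSmooth Φ.source coordT := ⟨_, rfl⟩
  obtain ⟨x, hx⟩ : ∃ z, z = linSmooth Φ.source coordX := ⟨_, rfl⟩
  obtain ⟨y, hy⟩ : ∃ z, z = linSmooth Φ.source coordY := ⟨_, rfl⟩
  obtain ⟨u, hu⟩ : ∃ z, z = linSmooth Φ.source coordU := ⟨_, rfl⟩
  obtain ⟨hTx, hTu, hNu, ⟨Ni, hNi⟩, ρ, ρi, H, F, κ, hρ, hρT, hρY, hρx, hρy, hρu, hHx, hHy, hHu,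
    hXf, hTy, hρtt, hH4, hκ, hNx, hNt, hNy, hUF, hFu, hFe⟩ :=
    hΦ.determining_solution hDt hDx hDy hDu hT hX hY hU hx hy hu
  have const : ∀ z, Dt z = 0 → Dx z = 0 → Dy z = 0 → Du z = 0 →
      ∀ P Q : Φ.source, evalAt P z = evalAt Q z := fun z h1 h2 h3 h4 P Q =>
    smoothFun_const hS hconn.isPreconnected z (by rw [← hDt, h1]) (by rw [← hDx, h2])
      (by rw [← hDy, h3]) (by rw [← hDu, h4]) P Q
  obtain ⟨a, ha⟩ := exists_params_of_functions (t := t) evalAt const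
    (fun z => by rw [hDx, hDt, comm]) (fun z => by rw [hDy, hDt, comm])
    (fun z => by rw [hDu, hDt, comm])
    (by rw [hDt, ht]; exact derSmooth_linSmooth_one hS rfl)
    (by rw [hDx, ht]; exact derSmooth_linSmooth_zero hS rfl)
    (by rw [hDy, ht]; exact derSmooth_linSmooth_zero hS rfl)
    (by rw [hDu, ht]; exact derSmooth_linSmooth_zero hS rfl)
    hTx hTy hTu hρ hρT hρY hρx hρy hρu hHx hHy hHu hXf hρtt hH4 hκ
  have hpt : ∀ P : Φ.source, (evalAt P t, evalAt P x, evalAt P y) = P.1.1 := by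
    intro P; rw [ht, hx, hy]; rfl
  have hpt' : ∀ P : Φ.source, evalAt P t = P.1.1.1 := by intro P; rw [ht]; rfl
  have hpx : ∀ P : Φ.source, evalAt P x = P.1.1.2.1 := by intro P; rw [hx]; rfl
  simp only [hpt] at ha
  simp only [hpt'] at ha
  have hm : ContDiffOn ℝ ∞ (fun Q : Total => a.multiplier Q.1) Φ.source := fun Q hQ =>
    ((a.contDiffAt_multiplier (ha ⟨Q, hQ⟩).1).comp Q contDiffAt_fst).contDiffWithinAt
  obtain ⟨m, hmdef⟩ : ∃ m, m = toSmoothFun _ hm := ⟨_, rfl⟩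
  obtain ⟨mi, hmi⟩ : ∃ mi, m * mi = 1 := by
    rw [hmdef]
    exact exists_mul_eq_one hS _ fun P => a.multiplier_ne_zero (ha P).1
  have hmd : ∀ (v : Total) (P : Φ.source),
      evalAt P (derSmooth hS v m) = pd v.1 a.multiplier P.1.1 := fun v P => by
    rw [hmdef, evalAt_derSmooth, pd_comp_fst
      (differentiableAt_of_contDiffAt (a.contDiffAt_multiplier (ha P).1))]
  have hmval : ∀ P : Φ.source, evalAt P m = a.multiplier P.1.1 := fun P => by rw [hmdef]; rfl
  have hmx : 4 * Dx m = -(2 * κ) * m := smoothFun_ext fun P => by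
    obtain ⟨h1, -, h3, -⟩ := ha P
    rw [map_mul, map_mul, map_neg, map_mul, map_ofNat, map_ofNat, hDx, hmd, hmval, ← h3,
      a.pd_x_multiplier h1]
    ring
  generalize hG : -6 * (Dt ρ * ρi) ^ 2 * (x + Dt H) + 12 * (Dt ρ * ρi) ^ 3 * (y + H)
        + Dt (Dt (Dt H)) = G at *
  have hmy : 4 * Dy m = (2 * G) * m := smoothFun_ext fun P => by
    obtain ⟨h1, -, -, -, h5⟩ := ha P
    rw [map_mul, map_mul, map_mul, map_ofNat, map_ofNat, hDy, hmd, hmval, ← h5,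
      a.pd_y_multiplier h1]
    ring
  have hmt : 4 * Dt m = (-(κ ^ 2 - 8 * (Dt ρ * ρi)) - 2 * x * G) * m := smoothFun_ext fun P => by
    obtain ⟨h1, -, h3, h4, h5⟩ := ha P
    have h6 := a.pd_drift_multiplier h1
    rw [pd_base_decomp, a.pd_y_multiplier h1] at h6
    rw [map_mul, map_mul, map_sub, map_neg, map_sub, map_pow, map_mul _ 8, ← h4, map_mul, map_mul,
      map_ofNat, map_ofNat, map_ofNat, hDt, hmd, hmval, ← h5, ← h3, hpx]
    linear_combination 4 * h6
  have hmu : 4 * Du m = 0 * m := smoothFun_ext fun P => by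
    have e : dirU.1 = 0 := rfl
    rw [map_mul, hDu, hmd, zero_mul, map_zero, e, pd, map_zero, mul_zero]
  -- U_u and the multiplier for σ = 1 have the same logarithmic derivatives in all four directions.
  -- Their ratio is a constant c, which is absorbed into σ.
  have c1 := der_ratio hmi (N := Du U) (by linear_combination 2 * hNx) hmx
  have c2 := der_ratio hmi (N := Du U) (by linear_combination 2 * hNy) hmy
  have c3 := der_ratio hmi (N := Du U) (by linear_combination hNt - 2 * x * hNy) hmt
  have c4 := der_ratio hmi (N := Du U) (by rw [hNu]; ring) hmu
  have hc := fun P => const _ c3 c1 c2 c4 P ⟨P₀, hP₀⟩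
  have hc0 : evalAt ⟨P₀, hP₀⟩ (Du U * mi) ≠ 0 := by
    intro h
    have h1 : (Du U * mi) * (Ni * m) = 1 := by linear_combination hNi * mi * m + hmi
    have h2 := congrArg (evalAt ⟨P₀, hP₀⟩) h1
    rw [map_mul, h, zero_mul, map_one] at h2
    exact zero_ne_one h2
  generalize evalAt ⟨P₀, hP₀⟩ (Du U * mi) = c at *
  have hNc : ∀ P, evalAt P (Du U) = c * a.multiplier P.1.1 := fun P => by
    rw [← hc P, ← hmval, ← map_mul]
    congr 1
    linear_combination -Du U * hmi
  refine ⟨{ a with σ := a.σ * c, σ_ne := mul_ne_zero a.σ_ne hc0 }, extendZero F.1, F.2,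
    fun P hP => ?_⟩
  obtain ⟨h1, h2, -⟩ := ha ⟨P, hP⟩
  have hP' := congrArg (evalAt ⟨P, hP⟩) hUF
  have hu' := congrArg (evalAt ⟨P, hP⟩) hFu
  have he' := congrArg (evalAt ⟨P, hP⟩) hFe
  rw [map_mul, hNc, map_add] at hP'
  rw [map_add, map_mul, hpx, hDt, hDx, hDy] at he'
  rw [hDu] at hu'
  refine ⟨h1, Prod.ext ?_ ?_, hu', ?_⟩
  · change (Φ P).1 = a.baseMap P.1
    rw [h2, hT, hX, hY]
    rfl
  · rw [hU, hu] at hP'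
    have e : ∀ p, Params.multiplier { a with σ := a.σ * c, σ_ne := mul_ne_zero a.σ_ne hc0 } p
        = c * a.multiplier p := fun p => by
      simp only [Params.multiplier, Params.den, Params.xHat, Params.yHat]; ring
    rw [e, extendZero_apply F.1 ⟨P, hP⟩]
    exact hP'
  · rw [← derSmooth_derSmooth_apply hS dirX dirX F ⟨P, hP⟩]
    exact he'

/-- G has zero u-derivative, but a fibre of the domain may be disconnected, so G need not descend to
the base globally. On a ball around P it does, with u frozen at its value at P; hence f may depend
on the point. -/
theorem IsPointSymmetry.locallyHasForm {Φ : OpenPartialHomeomorph Total Total}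
    (hΦ : IsPointSymmetry Φ) (hconn : IsConnected Φ.source) : LocallyHasForm Φ := by
  obtain ⟨a, G, hG, h⟩ := hΦ.exists_params hconn
  refine ⟨a, fun P hP => ?_⟩
  obtain ⟨r, hr, hball⟩ := Metric.isOpen_iff.mp Φ.open_source P hP
  have hsub : ∀ Q : Total, Q.1 ∈ Metric.ball P.1 r → Q.2 ∈ Metric.ball P.2 r → Q ∈ Φ.source :=
    fun Q h1 h2 => hball (by rw [← ball_prod_same]; exact ⟨h1, h2⟩)
  have hsub0 : ∀ q ∈ Metric.ball P.1 r, ((q, P.2) : Total) ∈ Φ.source := fun q hq =>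
    hsub (q, P.2) hq (Metric.mem_ball_self hr)
  refine ⟨Metric.ball P.1 r, fun q => G (q, P.2), Metric.isOpen_ball, ?_,
    ⟨Metric.mem_ball_self hr, (h P hP).1⟩, ?_⟩
  · rw [isSolutionOn_iff Metric.isOpen_ball]
    refine ⟨hG.comp (contDiff_id.prodMk contDiff_const).contDiffOn hsub0, fun q hq => ?_⟩
    have hq' := hsub0 q hq
    have hGd := differentiableAt_of_contDiffAt (hG.contDiffAt (Φ.open_source.mem_nhds hq'))
    have h1 := pd_lift (f := fun _ => P.2) (differentiableAt_const _) hGd (1, 0, q.2.1)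
    have h2 := pd_x_pd_x_lift (f := fun _ => P.2) (p := q) contDiff_const Φ.open_source hG hq'
    have h3 := (h _ hq').2.2.2
    have hz : pd (0, 1, 0) (fun _ : Base => P.2) = fun _ => 0 := funext fun _ => pd_const _ _
    rw [kolmogorovOp, h1, h2, pd_const, hz, pd_const, pd_total_decomp]
    simp only at h3 ⊢
    linear_combination h3
  · filter_upwards [Metric.ball_mem_nhds P hr] with Q hQ
    rw [← ball_prod_same] at hQ
    have hQ' := hsub Q hQ.1 hQ.2
    rw [(h Q hQ').2.1]
    have hconst : G (Q.1, Q.2) = G (Q.1, P.2) := by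
      have hd : ∀ s ∈ Metric.ball P.2 r, HasDerivAt (fun s => G (Q.1, s)) 0 s := fun s hs => by
        have hs' := hsub (Q.1, s) hQ.1 hs
        have e := hasDerivAt_comp_curve (c := fun s : ℝ => ((Q.1, s) : Total)) (s := s) (v := dirU)
          (differentiableAt_of_contDiffAt (hG.contDiffAt (Φ.open_source.mem_nhds hs')))
          ((hasDerivAt_const s Q.1).prodMk (hasDerivAt_id s))
        rwa [(h _ hs').2.2.1] at e
      exact (convex_ball P.2 r).is_const_of_fderivWithin_eq_zero (𝕜 := ℝ)
        (f := fun s => G (Q.1, s))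
        (fun s hs => (hd s hs).differentiableAt.differentiableWithinAt)
        (fun s hs => by
          rw [fderivWithin_of_isOpen Metric.isOpen_ball hs]
          ext
          simp [(hd s hs).deriv])
        hQ.2 (Metric.mem_ball_self hr)
    change _ = (a.baseMap Q.1, a.multiplier Q.1 * (Q.2 + G (Q.1, P.2)))
    rw [← hconst]


end Kolmogorov

theorem mainTheorem5 :
    -- `G` is the complete point symmetry (pseudo)group of the equation
    (∀ Φ : OpenPartialHomeomorph Kolmogorov.Total Kolmogorov.Total,
      Kolmogorov.IsPointTransformation Φ → IsConnected Φ.source →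
        (Kolmogorov.IsPointSymmetry Φ ↔ Kolmogorov.LocallyHasForm Φ)) ∧
    (∀ g : Kolmogorov.TransformationClass, g ∈ Kolmogorov.pointSymmetryGroup ↔
      ∃ Φ : Kolmogorov.DenseDiffeo, Kolmogorov.HasForm Φ.toHomeo ∧ g = Φ.toClass) ∧
    (∀ Φ : Kolmogorov.DenseDiffeo, Kolmogorov.HasForm Φ.toHomeo →
      Kolmogorov.IsPointSymmetry Φ.toHomeo) ∧
    -- the change of the sign of `u` is the only independent discrete symmetry
    (∃ J : Kolmogorov.pointSymmetryGroup,
      (J : Kolmogorov.TransformationClass) = Kolmogorov.signChange.toClass ∧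
      J * J = 1 ∧
      J ∉ connectedComponent (1 : Kolmogorov.pointSymmetryGroup) ∧
      ∀ g : Kolmogorov.pointSymmetryGroup,
        g ∉ connectedComponent (1 : Kolmogorov.pointSymmetryGroup) →
          ∃ h ∈ connectedComponent (1 : Kolmogorov.pointSymmetryGroup), g = J * h) ∧
    -- the factor group with respect to the identity component
    (∃ (N : Subgroup Kolmogorov.pointSymmetryGroup) (_ : N.Normal),
      (N : Set Kolmogorov.pointSymmetryGroup)
        = connectedComponent (1 : Kolmogorov.pointSymmetryGroup) ∧
      Nonempty ((Kolmogorov.pointSymmetryGroup ⧸ N) ≃* Multiplicative (ZMod 2))) := by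
  refine ⟨fun Φ hΦ hconn => ⟨fun h => h.locallyHasForm hconn,
      Kolmogorov.isPointSymmetry_of_locallyHasForm hΦ⟩,
    fun g => Kolmogorov.mem_pointSymmetryGroup,
    fun Φ h => Kolmogorov.isPointSymmetry_of_locallyHasForm Φ.isPointTransformation
      h.locallyHasForm,
    Kolmogorov.exists_signChange, Kolmogorov.exists_identity_component⟩
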